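/- Let $M$ be a connected (Hausdorff, second countable) smooth $4$-manifold with a volume form $\eta$, let $\Sigma\to M$ be the bundle of Lorentzian metrics (signature $(-+++)$) and $C(LM)\to M$ the bundle of linear connections (torsion allowed), and let $\pi\colon E=\Sigma\times_M C(LM)\to M$, with first jet bundle $J^1\pi$ ($\dim J^1\pi=374$). A chart $(x^\mu)$ of $M$ with $\eta=\mathrm d^4x=\mathrm dx^0\wedge\dots\wedge \mathrm dx^3$ induces coordinates $(x^\mu,g_{\alpha\beta},\Gamma^\alpha_{\beta\gamma},g_{\alpha\beta,\mu},\Gamma^\alpha_{\beta\gamma,\mu})$ on $J^1\pi$, where $g_{\alpha\beta}=g_{\beta\alpha}$, so that only the ten $g_{\alpha\beta}$ with $\alpha\le\beta$ are independent; call these adapted coordinates. Repeated indices are summed. Put $\varrho=\sqrt{|\det (g_{\alpha\beta})|}$, $$R_{\alpha\beta}=\Gamma^{\gamma}_{\beta\alpha,\gamma}-\Gamma^{\gamma}_{\gamma\alpha,\beta}+\Gamma^{\gamma}_{\beta\alpha}\Gamma^{\sigma}_{\sigma\gamma}-\Gamma^{\gamma}_{\beta\sigma}\Gamma^{\sigma}_{\gamma\alpha},\qquad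 L=\varrho\, g^{\alpha\beta}R_{\alpha\beta},$$ $$L^{\beta\gamma,\mu}_{\alpha}=\frac{\partial L}{\partial\Gamma^\alpha_{\beta\gamma,\mu}},\qquad H=L^{\beta\gamma,\mu}_{\alpha}\Gamma^\alpha_{\beta\gamma,\mu}-L,$$ $$T^\alpha_{\beta\gamma}=\Gamma^\alpha_{\beta\gamma}-\Gamma^\alpha_{\gamma\beta},\qquad T^\alpha_{\beta\gamma,\nu}=\Gamma^\alpha_{\beta\gamma,\nu}-\Gamma^\alpha_{\gamma\beta,\nu}.$$ Let $\Omega_L=-\mathrm d\Theta_L$ be the Poincaré–Cartan $5$-form of the Einstein–Palatini Lagrangian density $L\,\mathrm d^4x$, where $$\Theta_L=\sum_{a,\mu}\frac{\partial L}{\partial y^a_\mu}\,\bigl(\mathrm dy^a-y^a_\nu\,\mathrm dx^\nu\bigr)\wedge i(\partial/\partial x^\mu)\mathrm d^4x+L\,\mathrm d^4x,$$ $y^a$ running over the fibre coordinates $g_{\alpha\beta}$ ($\alpha\le\beta$) and $\Gamma^\alpha_{\beta\gamma}$, and $y^a_\mu$ being the corresponding jet coordinates. A smooth $4$-vector field $\mathbf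 X$ on $J^1\pi$ is called semiholonomic if in adapted coordinates $$\mathbf X=f\bigwedge_{\nu=0}^3\Bigl(\frac{\partial}{\partial x^\nu}+\sum_a y^a_\nu\frac{\partial}{\partial y^a}+\sum_{a,\mu}F^a_{\mu,\nu}\frac{\partial}{\partial y^a_\mu}\Bigr)$$ with smooth functions $F^a_{\mu,\nu}$ and a smooth nowhere vanishing function $f$. Theorem. There exist an embedded submanifold $\mathcal S_{sh}\hookrightarrow J^1\pi$ and a semiholonomic $4$-vector field $\mathbf X$ on $J^1\pi$ such that $i(\mathbf X)\Omega_L=0$ at every point of $\mathcal S_{sh}$ and $\mathbf X$ is tangent to $\mathcal S_{sh}$ (at each $p\in\mathcal S_{sh}$ it is a $4$-vector of $T_p\mathcal S_{sh}$). In every system of adapted coordinates, $\mathcal S_{sh}$ is exactly the set of points at which $$c^{\mu\nu}\equiv\frac{\partial H}{\partial g_{\mu\nu}}-\frac{\partial L^{\beta\gamma,\sigma}_\alpha}{\partial g_{\mu\nu}}\Gamma^\alpha_{\beta\gamma,\sigma}=0,$$ $$m_{\rho\sigma,\mu}\equiv g_{\rho\sigma,\mu}-g_{\sigma\lambda}\Gamma^\lambda_{\mu\rho}-g_{\rho\lambda}\Gamma^\lambda_{\mu\sigma}-\tfrac23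 g_{\rho\sigma}T^\lambda_{\lambda\mu}=0,$$ $$t^\alpha_{\beta\gamma}\equiv T^\alpha_{\beta\gamma}-\tfrac13\delta^\alpha_\beta T^\mu_{\mu\gamma}+\tfrac13\delta^\alpha_\gamma T^\mu_{\mu\beta}=0,$$ $$r^\alpha_{\beta\gamma,\nu}\equiv T^\alpha_{\beta\gamma,\nu}-\tfrac13\delta^\alpha_\beta T^\mu_{\mu\gamma,\nu}+\tfrac13\delta^\alpha_\gamma T^\mu_{\mu\beta,\nu}=0$$ for all values of the free indices. -/

import Mathlib

open scoped ContDiff Manifold Topology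

namespace EinsteinPalatini

/-- The model space of space-time, with coordinates `x^μ`. -/
abbrev Base := EuclideanSpace ℝ (Fin 4)
/-- Fibre coordinates `(g_{αβ}, Γ^α_{βγ})` of the bundle of pairs (metric, linear connection).
The ten coordinates `g_{αβ}`, `α ≤ β`, are indexed by unordered pairs `s(α, β)`, so that
`g_{αβ} = g_{βα}` and the partial derivative with respect to `g_{αβ}` is the one with respect to a
single independent coordinate. The entry `Γ α β γ` is `Γ^α_{βγ}`. -/
abbrev Fiber := (Sym2 (Fin 4) → ℝ) × (Fin 4 → Fin 4 → Fin 4 → ℝ)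
/-- Coordinates of a 1-jet of a section: base point, value and derivative of the section.
The coordinates `g_{αβ,μ}` and `Γ^α_{βγ,μ}` are the components of the derivative. -/
abbrev JCoord := Base × Fiber × (Base →L[ℝ] Fiber)

noncomputable def bvec (i : Fin 4) : Base := EuclideanSpace.single i 1

/-- The bilinear form with components `g_{μν}`. -/
noncomputable def gform (g : Sym2 (Fin 4) → ℝ) (v w : Base) : ℝ :=
  ∑ μ, ∑ ν, v μ * w ν * g s(μ, ν)

/-- The vector `Γ(v, w)` with components `Γ^l_{μν} v^μ w^ν`. -/
noncomputable def chris (Γ : Fin 4 → Fin 4 → Fin 4 → ℝ) (v w : Base) : Base :=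
  WithLp.toLp 2 fun l => ∑ μ, ∑ ν, v μ * w ν * Γ l μ ν

theorem gform_comm (g : Sym2 (Fin 4) → ℝ) (v w : Base) : gform g v w = gform g w v := by
  unfold gform
  rw [Finset.sum_comm]
  refine Finset.sum_congr rfl fun μ _ => Finset.sum_congr rfl fun ν _ => ?_
  rw [Sym2.eq_swap]; ring

/-- Nondegenerate of signature `(-+++)`. -/
def IsLorentzian (g : Sym2 (Fin 4) → ℝ) : Prop :=
  (∃ v : Base, gform g v v < 0) ∧
    ∃ W : Submodule ℝ Base, Module.finrank ℝ W = 3 ∧ ∀ w ∈ W, w ≠ 0 → 0 < gform g w w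

/-- Transformation of the components of a metric and a connection at one point under a change of
coordinates `y = φ(x)`, `x = ψ(y)`, where `A = ∂x/∂y`, `B = ∂y/∂x` and `Q = ∂²x/∂y∂y`:
`g'_{αβ} = A^μ_α A^ν_β g_{μν}` and
`Γ'^l_{μν} = B^l_a (Γ^a_{bc} A^b_μ A^c_ν + Q^a_{μν})`. -/
noncomputable def transport (A B : Base →L[ℝ] Base) (Q : Base →L[ℝ] Base →L[ℝ] Base) (s : Fiber) :
    Fiber :=
  (fun p => Sym2.lift ⟨fun α β => gform s.1 (A (bvec α)) (A (bvec β)),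
      fun _ _ => gform_comm _ _ _⟩ p,
    fun l μ ν => B (chris s.2 (A (bvec μ)) (A (bvec ν)) + Q (bvec μ) (bvec ν)) l)

/-- `transport` for the change of coordinates `φ` with inverse `ψ`, at the new base point `y`. -/
noncomputable def push (φ ψ : Base → Base) (y : Base) (s : Fiber) : Fiber :=
  transport (fderiv ℝ ψ y) (fderiv ℝ φ (ψ y)) (fderiv ℝ (fderiv ℝ ψ) y) s

/-- The affine local section whose 1-jet at `u.1` is `u`. -/
noncomputable def affineRep (u : JCoord) (x : Base) : Fiber := u.2.1 + u.2.2 (x - u.1)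

/-- The change of jet coordinates induced by a change of base coordinates `φ` with inverse `ψ`:
the 1-jet at `φ(x)` of the transformed section `y ↦ push φ ψ y (s (ψ y))`, where `s` is a
representative of the given 1-jet at `x`. -/
noncomputable def jetLift (φ ψ : Base → Base) (u : JCoord) : JCoord :=
  (φ u.1, push φ ψ (φ u.1) (affineRep u (ψ (φ u.1))),
    fderiv ℝ (fun y => push φ ψ y (affineRep u (ψ y))) (φ u.1))

/-- `φ : s → t` is a diffeomorphism between open sets, with inverse `ψ`. -/
structure LocDiffeo (φ ψ : Base → Base) (s t : Set Base) : Prop where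
  os : IsOpen s
  ot : IsOpen t
  ms : Set.MapsTo φ s t
  mt : Set.MapsTo ψ t s
  li : ∀ x ∈ s, ψ (φ x) = x
  ri : ∀ y ∈ t, φ (ψ y) = y
  cs : ContDiffOn ℝ ∞ φ s
  ct : ContDiffOn ℝ ∞ ψ t

theorem base_sum (v : Base) : v = ∑ i, v i • bvec i := by
  ext j; simp [bvec, Pi.single_apply]

theorem gform_expand (g : Sym2 (Fin 4) → ℝ) (f : Base →L[ℝ] Base) (v w : Base) :
    gform g (f v) (f w) = ∑ μ, ∑ ν, v μ * w ν * gform g (f (bvec μ)) (f (bvec ν)) := by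
  have h1 : ∀ a b : Base, gform g a b = LinearMap.mk₂ ℝ (gform g)
      (by intros; simp [gform, add_mul, Finset.sum_add_distrib])
      (by intros; simp [gform, Finset.mul_sum, mul_assoc])
      (by intros; simp [gform, add_mul, mul_add, Finset.sum_add_distrib])
      (by intros; simp [gform, Finset.mul_sum, mul_assoc, mul_left_comm]) a b := fun a b => rfl
  simp only [h1]
  conv_lhs => rw [base_sum v, base_sum w]
  simp only [map_sum, map_smul, LinearMap.sum_apply, LinearMap.smul_apply, Finset.mul_sum,
    smul_eq_mul]
  rw [Finset.sum_comm]
  exact Finset.sum_congr rfl fun μ _ => Finset.sum_congr rfl fun ν _ => by ring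

theorem chris_expand (Γ : Fin 4 → Fin 4 → Fin 4 → ℝ) (f : Base →L[ℝ] Base) (v w : Base) :
    chris Γ (f v) (f w) = ∑ μ, ∑ ν, (v μ * w ν) • chris Γ (f (bvec μ)) (f (bvec ν)) := by
  have h1 : ∀ a b : Base, chris Γ a b = LinearMap.mk₂ ℝ (chris Γ)
      (by intros; ext; simp [chris, add_mul, Finset.sum_add_distrib])
      (by intros; ext; simp [chris, Finset.mul_sum, mul_assoc])
      (by intros; ext; simp [chris, add_mul, mul_add, Finset.sum_add_distrib])
      (by intros; ext; simp [chris, Finset.mul_sum, mul_assoc, mul_left_comm]) a b := fun a b => rfl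
  simp only [h1]
  conv_lhs => rw [base_sum v, base_sum w]
  simp only [map_sum, map_smul, LinearMap.sum_apply, LinearMap.smul_apply, Finset.smul_sum,
    smul_smul]
  rw [Finset.sum_comm]
  exact Finset.sum_congr rfl fun μ _ => Finset.sum_congr rfl fun ν _ => by rw [mul_comm]

theorem gform_transport (A B : Base →L[ℝ] Base) (Q : Base →L[ℝ] Base →L[ℝ] Base) (s : Fiber)
    (v w : Base) : gform (transport A B Q s).1 v w = gform s.1 (A v) (A w) := by
  rw [gform_expand]; rfl

theorem chris_transport (A B : Base →L[ℝ] Base) (Q : Base →L[ℝ] Base →L[ℝ] Base) (s : Fiber)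
    (v w : Base) : chris (transport A B Q s).2 v w = B (chris s.2 (A v) (A w) + Q v w) := by
  have hQ : Q v w = ∑ μ, ∑ ν, (v μ * w ν) • Q (bvec μ) (bvec ν) := by
    conv_lhs => rw [base_sum v, base_sum w]
    simp only [map_sum, map_smul, sum_apply, smul_apply,
      Finset.smul_sum, smul_smul]
    rw [Finset.sum_comm]
    exact Finset.sum_congr rfl fun μ _ => Finset.sum_congr rfl fun ν _ => by rw [mul_comm]
  rw [chris_expand, hQ]
  simp only [← Finset.sum_add_distrib, ← smul_add, map_sum, map_smul]
  ext l
  simp [chris, transport, mul_add]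

theorem transport_comp {A B A' B' : Base →L[ℝ] Base} {Q Q' Q'' : Base →L[ℝ] Base →L[ℝ] Base}
    (hBA : ∀ v, B (A v) = v) (hQ : ∀ v w, Q'' v w = Q (A' v) (A' w) + A (Q' v w)) (s : Fiber) :
    transport A' B' Q' (transport A B Q s) = transport (A.comp A') (B'.comp B) Q'' s := by
  refine Prod.ext (funext fun p => ?_) (funext fun l => funext fun μ => funext fun ν => ?_)
  · induction p with
    | h α β => exact gform_transport A B Q s (A' (bvec α)) (A' (bvec β))
  · change B' (chris (transport A B Q s).2 _ _ + _) l = B' (B (_ + Q'' _ _)) l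
    rw [chris_transport, hQ, ← add_assoc, map_add B, map_add B, map_add B, hBA]
    rfl

theorem transport_id (s : Fiber) :
    transport (ContinuousLinearMap.id ℝ Base) (ContinuousLinearMap.id ℝ Base) 0 s = s := by
  refine Prod.ext (funext fun p => ?_) (funext fun l => funext fun μ => funext fun ν => ?_)
  · induction p with
    | h α β => simp [transport, gform, bvec]
  · simp [transport, chris, bvec]

theorem IsLorentzian.transport {s : Fiber} (h : IsLorentzian s.1) {A B : Base →L[ℝ] Base}
    (hBA : ∀ v, B (A v) = v) (Q : Base →L[ℝ] Base →L[ℝ] Base) :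
    IsLorentzian (transport A B Q s).1 := by
  have hinj : Function.Injective (A : Base →ₗ[ℝ] Base) := Function.LeftInverse.injective hBA
  have hAB : ∀ v, A (B v) = v := by
    intro v
    obtain ⟨w, rfl⟩ := (LinearMap.injective_iff_surjective.1 hinj) v
    exact congrArg A (hBA w)
  have hB : Function.Injective (B : Base →ₗ[ℝ] Base) := Function.LeftInverse.injective hAB
  obtain ⟨⟨v, hv⟩, W, hW, hpos⟩ := h
  refine ⟨⟨B v, by rw [gform_transport, hAB]; exact hv⟩, W.map (B : Base →ₗ[ℝ] Base), ?_, ?_⟩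
  · rw [← hW]; exact (LinearEquiv.finrank_eq (Submodule.equivMapOfInjective _ hB W)).symm
  · rintro _ ⟨w, hw, rfl⟩ h0
    rw [gform_transport]
    change 0 < gform s.1 (A (B w)) (A (B w))
    rw [hAB]
    exact hpos w hw (by rintro rfl; exact h0 (map_zero _))

theorem continuous_gform : Continuous fun p : (Sym2 (Fin 4) → ℝ) × Base => gform p.1 p.2 p.2 := by
  unfold gform; fun_prop

theorem isOpen_isLorentzian : IsOpen {g | IsLorentzian g} := by
  rw [isOpen_iff_mem_nhds]
  rintro g ⟨⟨v, hv⟩, W, hW, hpos⟩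
  have h1 : ∀ᶠ g' in 𝓝 g, gform g' v v < 0 :=
    (continuous_gform.comp (Continuous.prodMk_left v)).continuousAt.eventually_lt_const hv
  have hK : IsCompact (Metric.sphere (0 : Base) 1 ∩ W) :=
    (isCompact_sphere _ _).inter_right W.closed_of_finiteDimensional
  have h2 : ∀ᶠ g' in 𝓝 g, ∀ w ∈ Metric.sphere (0 : Base) 1 ∩ W, 0 < gform g' w w := by
    refine hK.eventually_forall_of_forall_eventually fun w hw => ?_
    refine continuous_gform.continuousAt.eventually_const_lt (hpos w hw.2 ?_)
    rintro rfl
    simp at hw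
  filter_upwards [h1, h2] with g' a1 a2
  refine ⟨⟨v, a1⟩, W, hW, fun w hw h0 => ?_⟩
  have hn : 0 < ‖w‖ := norm_pos_iff.2 h0
  have := a2 (‖w‖⁻¹ • w) ⟨by simp [norm_smul, hn.ne'], W.smul_mem _ hw⟩
  have e : gform g' (‖w‖⁻¹ • w) (‖w‖⁻¹ • w) = ‖w‖⁻¹ ^ 2 * gform g' w w := by
    simp only [gform, Finset.mul_sum, PiLp.smul_apply, smul_eq_mul]
    exact Finset.sum_congr rfl fun μ _ => Finset.sum_congr rfl fun ν _ => by ring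
  rw [e] at this
  exact pos_of_mul_pos_right this (by positivity)

theorem LocDiffeo.symm {φ ψ : Base → Base} {s t : Set Base} (h : LocDiffeo φ ψ s t) :
    LocDiffeo ψ φ t s := ⟨h.ot, h.os, h.mt, h.ms, h.ri, h.li, h.ct, h.cs⟩

theorem LocDiffeo.contDiffAt {φ ψ : Base → Base} {s t : Set Base} (h : LocDiffeo φ ψ s t)
    {x : Base} (hx : x ∈ s) : ContDiffAt ℝ ∞ φ x := h.cs.contDiffAt (h.os.mem_nhds hx)

theorem LocDiffeo.fderiv_fderiv {φ ψ : Base → Base} {s t : Set Base} (h : LocDiffeo φ ψ s t)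
    {y : Base} (hy : y ∈ t) (v : Base) : fderiv ℝ φ (ψ y) (fderiv ℝ ψ y v) = v := by
  have h1 := (h.contDiffAt (h.mt hy)).differentiableAt (by simp)
  have h2 := (h.symm.contDiffAt hy).differentiableAt (by simp)
  have h3 : fderiv ℝ (φ ∘ ψ) y = ContinuousLinearMap.id ℝ Base := by
    rw [Filter.EventuallyEq.fderiv_eq (f₁ := φ ∘ ψ) (f := id)
      (Filter.eventuallyEq_of_mem (h.ot.mem_nhds hy) h.ri)]
    exact fderiv_id
  rw [fderiv_comp _ h1 h2] at h3
  exact DFunLike.congr_fun h3 v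

theorem push_isLorentzian {φ ψ : Base → Base} {s t : Set Base} (h : LocDiffeo φ ψ s t)
    {y : Base} (hy : y ∈ t) {σ : Fiber} (hσ : IsLorentzian σ.1) :
    IsLorentzian (push φ ψ y σ).1 := hσ.transport (h.fderiv_fderiv hy) _

theorem push_comp {φ ψ φ' ψ' : Base → Base} {s t s' t' : Set Base} (h : LocDiffeo φ ψ s t)
    (h' : LocDiffeo φ' ψ' s' t') {y : Base} (hy : y ∈ t') (hy' : ψ' y ∈ t) (σ : Fiber) :
    push φ' ψ' y (push φ ψ (ψ' y) σ) = push (φ' ∘ φ) (ψ ∘ ψ') y σ := by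
  have d1 := (h.symm.contDiffAt hy').differentiableAt (by simp)
  have d2 := (h'.symm.contDiffAt hy).differentiableAt (by simp)
  have e1 : fderiv ℝ (ψ ∘ ψ') y = (fderiv ℝ ψ (ψ' y)).comp (fderiv ℝ ψ' y) := fderiv_comp _ d1 d2
  have e2 : fderiv ℝ (φ' ∘ φ) ((ψ ∘ ψ') y) =
      (fderiv ℝ φ' (ψ' y)).comp (fderiv ℝ φ (ψ (ψ' y))) := by
    rw [Function.comp_apply, fderiv_comp _
      (by rw [h.ri _ hy']; exact (h'.contDiffAt (h'.mt hy)).differentiableAt (by simp))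
      ((h.contDiffAt (h.mt hy')).differentiableAt (by simp)), h.ri _ hy']
  have e3 : fderiv ℝ (ψ ∘ ψ') =ᶠ[𝓝 y] fun z => (fderiv ℝ ψ (ψ' z)).comp (fderiv ℝ ψ' z) := by
    filter_upwards [h'.ot.mem_nhds hy,
      (h'.symm.contDiffAt hy).continuousAt.preimage_mem_nhds (h.ot.mem_nhds hy')] with z z1 z2
    exact fderiv_comp _ ((h.symm.contDiffAt z2).differentiableAt (by simp))
      ((h'.symm.contDiffAt z1).differentiableAt (by simp))
  have c1 : DifferentiableAt ℝ (fderiv ℝ ψ) (ψ' y) :=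
    ((h.symm.contDiffAt hy').fderiv_right (m := 1) (by norm_cast)).differentiableAt
      (by simp)
  have c2 : DifferentiableAt ℝ (fderiv ℝ ψ') y :=
    ((h'.symm.contDiffAt hy).fderiv_right (m := 1) (by norm_cast)).differentiableAt
      (by simp)
  unfold push
  rw [e1, e2]
  refine transport_comp (h.fderiv_fderiv hy') (fun v w => ?_) σ
  rw [e3.fderiv_eq]
  have := (c1.hasFDerivAt.comp y d2.hasFDerivAt).clm_comp c2.hasFDerivAt
  have this' : fderiv ℝ (fun z => (fderiv ℝ ψ (ψ' z)).comp (fderiv ℝ ψ' z)) y = _ :=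
    HasFDerivAt.fderiv this
  rw [this']
  simp [add_comm]

theorem push_contDiffAt {φ ψ : Base → Base} {s t : Set Base} (h : LocDiffeo φ ψ s t)
    {y : Base} (hy : y ∈ t) (σ : Fiber) :
    ContDiffAt ℝ ∞ (fun p : Base × Fiber => push φ ψ p.1 p.2) (y, σ) := by
  have a1 : ContDiffAt ℝ ∞ (fderiv ℝ ψ) y := (h.symm.contDiffAt hy).fderiv_right (by simp)
  have a2 : ContDiffAt ℝ ∞ (fderiv ℝ (fderiv ℝ ψ)) y := a1.fderiv_right (by simp)
  have a3 : ContDiffAt ℝ ∞ (fun y => fderiv ℝ φ (ψ y)) y :=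
    ContDiffAt.comp (g := fderiv ℝ φ) y ((h.contDiffAt (h.mt hy)).fderiv_right (by simp))
      (h.symm.contDiffAt hy)
  have b1 : ContDiffAt ℝ ∞ (fun p : Base × Fiber => fderiv ℝ ψ p.1) (y, σ) :=
    ContDiffAt.comp (y, σ) a1 contDiffAt_fst
  have b2 : ContDiffAt ℝ ∞ (fun p : Base × Fiber => fderiv ℝ (fderiv ℝ ψ) p.1) (y, σ) :=
    ContDiffAt.comp (y, σ) a2 contDiffAt_fst
  have b3 : ContDiffAt ℝ ∞ (fun p : Base × Fiber => fderiv ℝ φ (ψ p.1)) (y, σ) :=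
    ContDiffAt.comp (g := fun y => fderiv ℝ φ (ψ y)) (y, σ) a3 contDiffAt_fst
  have co : ∀ {f : Base × Fiber → Base}, ContDiffAt ℝ ∞ f (y, σ) → ∀ i,
      ContDiffAt ℝ ∞ (fun p => f p i) (y, σ) := fun hf i => (contDiffAt_piLp 2).1 hf i
  have k : ∀ μ i, ContDiffAt ℝ ∞ (fun p : Base × Fiber => fderiv ℝ ψ p.1 (bvec μ) i) (y, σ) :=
    fun μ i => co (b1.clm_apply contDiffAt_const) i
  have g1 : ∀ q, ContDiffAt ℝ ∞ (fun p : Base × Fiber => p.2.1 q) (y, σ) :=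
    fun q => ContDiff.contDiffAt (by fun_prop)
  have g2 : ∀ a b c, ContDiffAt ℝ ∞ (fun p : Base × Fiber => p.2.2 a b c) (y, σ) :=
    fun a b c => ContDiff.contDiffAt (by fun_prop)
  refine ContDiffAt.prodMk (contDiffAt_pi.2 fun q => ?_) (contDiffAt_pi.2 fun l =>
    contDiffAt_pi.2 fun μ => contDiffAt_pi.2 fun ν => ?_)
  · induction q with
    | h α β =>
      change ContDiffAt ℝ ∞ (fun p : Base × Fiber => ∑ i, ∑ j,
        fderiv ℝ ψ p.1 (bvec α) i * fderiv ℝ ψ p.1 (bvec β) j * p.2.1 s(i, j)) (y, σ)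
      exact ContDiffAt.sum fun i _ => ContDiffAt.sum fun j _ => ((k α i).mul (k β j)).mul (g1 _)
  · refine co (b3.clm_apply (ContDiffAt.add ?_
      ((b2.clm_apply contDiffAt_const).clm_apply contDiffAt_const))) l
    refine (contDiffAt_piLp 2).2 fun m => ?_
    change ContDiffAt ℝ ∞ (fun p : Base × Fiber => ∑ i, ∑ j,
      fderiv ℝ ψ p.1 (bvec μ) i * fderiv ℝ ψ p.1 (bvec ν) j * p.2.2 m i j) (y, σ)
    exact ContDiffAt.sum fun i _ => ContDiffAt.sum fun j _ => ((k μ i).mul (k ν j)).mul (g2 _ _ _)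

theorem jetLift_contDiffAt {φ ψ : Base → Base} {s t : Set Base} (h : LocDiffeo φ ψ s t)
    {u : JCoord} (hu : u.1 ∈ s) : ContDiffAt ℝ ∞ (jetLift φ ψ) u := by
  have a1 : ContDiffAt ℝ ∞ (fun u : JCoord => φ u.1) u :=
    ContDiffAt.comp u (h.contDiffAt hu) contDiffAt_fst
  have a2 : ContDiffAt ℝ ∞ (fun p : JCoord × Base => ψ p.2) (u, φ u.1) :=
    ContDiffAt.comp (u, φ u.1) (h.symm.contDiffAt (h.ms hu)) contDiffAt_snd
  have a3 : ContDiffAt ℝ ∞ (fun p : JCoord × Base => affineRep p.1 (ψ p.2)) (u, φ u.1) := by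
    have e1 : ContDiffAt ℝ ∞ (fun p : JCoord × Base => p.1.2.2) (u, φ u.1) :=
      ContDiff.contDiffAt (by fun_prop)
    have e2 : ContDiffAt ℝ ∞ (fun p : JCoord × Base => p.1.1) (u, φ u.1) :=
      ContDiff.contDiffAt (by fun_prop)
    have e3 : ContDiffAt ℝ ∞ (fun p : JCoord × Base => p.1.2.1) (u, φ u.1) :=
      ContDiff.contDiffAt (by fun_prop)
    exact e3.add (e1.clm_apply (a2.sub e2))
  have a4 : ContDiffAt ℝ ∞ (fun p : JCoord × Base => push φ ψ p.2 (affineRep p.1 (ψ p.2)))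
      (u, φ u.1) :=
    ContDiffAt.comp (g := fun p : Base × Fiber => push φ ψ p.1 p.2)
      (f := fun p : JCoord × Base => (p.2, affineRep p.1 (ψ p.2))) (u, φ u.1)
      (push_contDiffAt h (h.ms hu) _) (contDiffAt_snd.prodMk a3)
  refine a1.prodMk (ContDiffAt.prodMk ?_ ?_)
  · exact ContDiffAt.comp u (f := fun u : JCoord => (u, φ u.1)) a4 (contDiffAt_id.prodMk a1)
  · exact ContDiffAt.fderiv (f := fun (u : JCoord) y => push φ ψ y (affineRep u (ψ y))) a4 a1
      (by simp)

theorem jetLift_comp {φ ψ φ' ψ' : Base → Base} {s t s' t' : Set Base} (h : LocDiffeo φ ψ s t)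
    (h' : LocDiffeo φ' ψ' s' t') {u : JCoord} (hu : u.1 ∈ s) (hu' : φ u.1 ∈ s') :
    jetLift φ' ψ' (jetLift φ ψ u) = jetLift (φ' ∘ φ) (ψ ∘ ψ') u := by
  have hb := h'.li _ hu'
  have hy := h'.ms hu'
  have ht : ψ' (φ' (φ u.1)) ∈ t := by rw [hb]; exact h.ms hu
  have hψ := h'.symm.contDiffAt hy
  set σ : Base → Fiber := fun y => push φ ψ y (affineRep u (ψ y)) with hσ
  have dσ : DifferentiableAt ℝ σ (ψ' (φ' (φ u.1))) := by
    have a3 : ContDiffAt ℝ ∞ (fun p : Base => affineRep u (ψ p)) (ψ' (φ' (φ u.1))) :=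
      contDiffAt_const.add (contDiffAt_const.clm_apply
        ((h.symm.contDiffAt ht).sub contDiffAt_const))
    exact (ContDiffAt.comp (g := fun p : Base × Fiber => push φ ψ p.1 p.2)
      (f := fun y => (y, affineRep u (ψ y))) _ (push_contDiffAt h ht _) (contDiffAt_id.prodMk a3)).differentiableAt
      (by simp)
  have dP := ((push_contDiffAt h' hy (σ (ψ' (φ' (φ u.1))))).differentiableAt
      (by simp)).hasFDerivAt
  have dψ := (hψ.differentiableAt (by simp)).hasFDerivAt
  have ev : (fun y => push (φ' ∘ φ) (ψ ∘ ψ') y (affineRep u ((ψ ∘ ψ') y)))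
      =ᶠ[𝓝 (φ' (φ u.1))] fun y => push φ' ψ' y (σ (ψ' y)) := by
    filter_upwards [h'.ot.mem_nhds hy, hψ.continuousAt.preimage_mem_nhds (h.ot.mem_nhds ht)]
      with z z1 z2
    exact (push_comp h h' z1 z2 _).symm
  have D1 : HasFDerivAt (fun y => push φ' ψ' y (σ (ψ' y))) _ (φ' (φ u.1)) :=
    HasFDerivAt.comp (g := fun p : Base × Fiber => push φ' ψ' p.1 p.2)
      (f := fun y => (y, σ (ψ' y))) (φ' (φ u.1)) dP
      ((hasFDerivAt_id _).prodMk (dσ.hasFDerivAt.comp _ dψ))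
  have val : affineRep (jetLift φ ψ u) (ψ' (φ' (φ u.1))) = σ (ψ' (φ' (φ u.1))) := by
    rw [hb]; simp [affineRep, jetLift, hσ]
  have dA : HasFDerivAt (affineRep (jetLift φ ψ u)) (fderiv ℝ σ (ψ' (φ' (φ u.1))))
      (ψ' (φ' (φ u.1))) := by
    rw [hb]
    have k : ∀ L : Base →L[ℝ] Fiber, HasFDerivAt (fun x => L (x - φ u.1)) L (φ u.1) := fun L =>
      HasFDerivAt.comp (g := L) (f := fun x => x - φ u.1) (φ u.1) L.hasFDerivAt
        ((hasFDerivAt_id _).sub_const _)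
    exact (k _).const_add (jetLift φ ψ u).2.1
  rw [← val] at dP
  have D2 : HasFDerivAt (fun y => push φ' ψ' y (affineRep (jetLift φ ψ u) (ψ' y))) _
      (φ' (φ u.1)) :=
    HasFDerivAt.comp (g := fun p : Base × Fiber => push φ' ψ' p.1 p.2)
      (f := fun y => (y, affineRep (jetLift φ ψ u) (ψ' y))) (φ' (φ u.1)) dP
      ((hasFDerivAt_id _).prodMk (dA.comp _ dψ))
  refine Prod.ext rfl (Prod.ext ?_ ?_)
  · change push φ' ψ' (φ' (φ u.1)) (affineRep (jetLift φ ψ u) (ψ' (φ' (φ u.1)))) = _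
    rw [val]
    exact ev.eq_of_nhds.symm
  · change fderiv ℝ (fun y => push φ' ψ' y (affineRep (jetLift φ ψ u) (ψ' y))) (φ' (φ u.1)) =
      fderiv ℝ (fun y => push (φ' ∘ φ) (ψ ∘ ψ') y (affineRep u ((ψ ∘ ψ') y))) (φ' (φ u.1))
    rw [D2.fderiv, ev.fderiv_eq, D1.fderiv, val]

theorem push_congr {φ ψ φ' ψ' : Base → Base} {y : Base} (h1 : ψ =ᶠ[𝓝 y] ψ')
    (h2 : φ =ᶠ[𝓝 (ψ y)] φ') (σ : Fiber) : push φ ψ y σ = push φ' ψ' y σ := by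
  unfold push
  rw [h1.fderiv_eq, h1.fderiv.fderiv_eq, h2.fderiv_eq, h1.eq_of_nhds]

theorem jetLift_congr {φ ψ φ' ψ' : Base → Base} {s t : Set Base} (h : LocDiffeo φ ψ s t)
    {u : JCoord} (hu : u.1 ∈ s) (h1 : φ =ᶠ[𝓝 u.1] φ') (h2 : ψ =ᶠ[𝓝 (φ u.1)] ψ') :
    jetLift φ ψ u = jetLift φ' ψ' u := by
  have hc := (h.symm.contDiffAt (h.ms hu)).continuousAt
  have h1' : ∀ᶠ y in 𝓝 (φ u.1), φ =ᶠ[𝓝 (ψ y)] φ' := by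
    have : ∀ᶠ x in 𝓝 (ψ (φ u.1)), φ =ᶠ[𝓝 x] φ' := by
      rw [h.li _ hu]; exact h1.eventuallyEq_nhds
    exact hc.eventually this
  have ev : (fun y => push φ ψ y (affineRep u (ψ y))) =ᶠ[𝓝 (φ u.1)]
      fun y => push φ' ψ' y (affineRep u (ψ' y)) := by
    filter_upwards [h1', h2.eventuallyEq_nhds] with y y1 y2
    rw [push_congr y2 y1, y2.eq_of_nhds]
  unfold jetLift
  rw [← h1.eq_of_nhds, ev.fderiv_eq]
  refine Prod.ext rfl (Prod.ext ?_ rfl)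
  exact ev.eq_of_nhds

theorem jetLift_id (u : JCoord) : jetLift id id u = u := by
  have hp : ∀ y σ, push id id y σ = σ := by
    intro y σ
    have : fderiv ℝ (id : Base → Base) = fun _ => ContinuousLinearMap.id ℝ Base := by
      ext1 x; exact fderiv_id
    simp only [push, this, fderiv_fun_const, id]
    exact transport_id σ
  refine Prod.ext rfl (Prod.ext ?_ ?_)
  · simp [jetLift, hp, affineRep]
  · simp only [jetLift, hp, id]
    have := (HasFDerivAt.comp (g := u.2.2) (f := fun x => x - u.1) u.1
      (u.2.2.hasFDerivAt (x := u.1 - u.1))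
      ((hasFDerivAt_id u.1).sub_const u.1)).const_add u.2.1
    exact this.fderiv

theorem exists_lorentzian : ∃ g : Sym2 (Fin 4) → ℝ, IsLorentzian g := by
  let g : Sym2 (Fin 4) → ℝ := Sym2.lift ⟨fun α β => if α = β then (if α = 0 then -1 else 1) else 0,
    fun α β => by
      by_cases h : α = β
      · subst h; rfl
      · simp [h, Ne.symm h]⟩
  have hg : ∀ v : Base, gform g v v = -(v 0) ^ 2 + (v 1) ^ 2 + (v 2) ^ 2 + (v 3) ^ 2 := by
    intro v
    simp only [gform, g, Sym2.lift_mk, Fin.sum_univ_four]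
    norm_num [Fin.ext_iff]
    ring
  let L : Base →ₗ[ℝ] ℝ := (EuclideanSpace.proj (0 : Fin 4) : Base →L[ℝ] ℝ)
  refine ⟨g, ⟨bvec 0, by rw [hg]; simp [bvec]⟩, LinearMap.ker L, ?_, ?_⟩
  · have h := L.finrank_range_add_finrank_ker
    have hs : LinearMap.range L = ⊤ := LinearMap.range_eq_top.2 fun r =>
      ⟨r • bvec 0, by simp [L, bvec]⟩
    rw [hs, finrank_top, finrank_euclideanSpace_fin, Module.finrank_self] at h
    omega
  · intro w hw h0
    have hw0 : w 0 = 0 := hw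
    rw [hg, hw0]
    by_contra hc
    have h1 : w 1 = 0 := by nlinarith [sq_nonneg (w 1), sq_nonneg (w 2), sq_nonneg (w 3)]
    have h2 : w 2 = 0 := by nlinarith [sq_nonneg (w 1), sq_nonneg (w 2), sq_nonneg (w 3)]
    have h3 : w 3 = 0 := by nlinarith [sq_nonneg (w 1), sq_nonneg (w 2), sq_nonneg (w 3)]
    exact h0 (by ext i; fin_cases i <;> assumption)

/-- The first jet bundle `J¹π` of `π : E = Σ ×_M C(LM) → M`, the bundle of pairs (Lorentzian metric,
linear connection) on the 4-manifold `M`. As for the tangent bundle in Mathlib, the fibre over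
`base` is identified with its coordinates in the preferred chart at `base`; the coordinates in any
other chart of `M` are given by `jetChart`, through the transformation law `jetLift`. -/
structure JetBundle (M : Type*) [TopologicalSpace M] [ChartedSpace Base M] where
  base : M
  fib : Fiber
  der : Base →L[ℝ] Fiber
  lorentz : IsLorentzian fib.1

section Charts

variable {M : Type*} [TopologicalSpace M] [ChartedSpace Base M]

/-- Change of jet coordinates from the chart `e` to the chart `e'` of `M`. -/
noncomputable def transition (e e' : OpenPartialHomeomorph M Base) : JCoord → JCoord :=
  jetLift (e' ∘ e.symm) (e ∘ e'.symm)

/-- Coordinates of a jet in the preferred chart at its base point. -/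
noncomputable def JetBundle.localCoord (p : JetBundle M) : JCoord :=
  (chartAt Base p.base p.base, p.fib, p.der)

open Classical in
/-- The jet over `x` with the given coordinates in the preferred chart at `x`. -/
noncomputable def JetBundle.ofCoord (x : M) (u : JCoord) : JetBundle M :=
  if h : IsLorentzian u.2.1.1 then ⟨x, u.2.1, u.2.2, h⟩
  else ⟨x, (exists_lorentzian.choose, 0), 0, exists_lorentzian.choose_spec⟩

theorem JetBundle.ofCoord_base (x : M) (u : JCoord) : (JetBundle.ofCoord x u).base = x := by
  unfold JetBundle.ofCoord; split_ifs <;> rfl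

theorem JetBundle.localCoord_ofCoord {x : M} {u : JCoord} (hx : u.1 = chartAt Base x x)
    (h : IsLorentzian u.2.1.1) : (JetBundle.ofCoord x u).localCoord = u := by
  unfold JetBundle.ofCoord
  rw [dif_pos h]
  exact Prod.ext hx.symm rfl

theorem JetBundle.ofCoord_localCoord (p : JetBundle M) :
    JetBundle.ofCoord p.base p.localCoord = p := by
  unfold JetBundle.ofCoord
  exact dif_pos p.lorentz

theorem locDiffeo_transition [IsManifold (𝓡 4) ∞ M] {e e' : OpenPartialHomeomorph M Base}
    (he : e ∈ IsManifold.maximalAtlas (𝓡 4) ∞ M) (he' : e' ∈ IsManifold.maximalAtlas (𝓡 4) ∞ M) :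
    LocDiffeo (e' ∘ e.symm) (e ∘ e'.symm) (e.symm ≫ₕ e').source (e.symm ≫ₕ e').target := by
  have h1 := (mem_groupoid_of_pregroupoid.1
    (StructureGroupoid.compatible_of_mem_maximalAtlas he he')).1
  have h2 := (mem_groupoid_of_pregroupoid.1
    (StructureGroupoid.compatible_of_mem_maximalAtlas he' he)).1
  have ht : (e.symm ≫ₕ e').target = (e'.symm ≫ₕ e).source := by
    rw [← OpenPartialHomeomorph.symm_source, OpenPartialHomeomorph.trans_symm_eq_symm_trans_symm,
      OpenPartialHomeomorph.symm_symm]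
  refine ⟨(e.symm ≫ₕ e').open_source, (e.symm ≫ₕ e').open_target, (e.symm ≫ₕ e').mapsTo,
    (e.symm ≫ₕ e').mapsTo_symm, fun x hx => (e.symm ≫ₕ e').left_inv hx,
    fun x hx => (e.symm ≫ₕ e').right_inv hx, ?_, ?_⟩
  · simpa [contDiffPregroupoid] using h1
  · rw [ht]; simpa [contDiffPregroupoid] using h2

theorem transition_fst (e e' : OpenPartialHomeomorph M Base) (u : JCoord) :
    (transition e e' u).1 = e' (e.symm u.1) := rfl

theorem transition_lorentz [IsManifold (𝓡 4) ∞ M] {e e' : OpenPartialHomeomorph M Base}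
    (he : e ∈ IsManifold.maximalAtlas (𝓡 4) ∞ M) (he' : e' ∈ IsManifold.maximalAtlas (𝓡 4) ∞ M)
    {u : JCoord} (hu : u.1 ∈ (e.symm ≫ₕ e').source) (h : IsLorentzian u.2.1.1) :
    IsLorentzian (transition e e' u).2.1.1 := by
  have hd := locDiffeo_transition he he'
  refine push_isLorentzian hd (hd.ms hu) ?_
  have : affineRep u ((e ∘ e'.symm) ((e' ∘ e.symm) u.1)) = u.2.1 := by
    rw [hd.li _ hu]; simp [affineRep]
  rw [this]; exact h

theorem transition_self [IsManifold (𝓡 4) ∞ M] {e : OpenPartialHomeomorph M Base}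
    (he : e ∈ IsManifold.maximalAtlas (𝓡 4) ∞ M) {u : JCoord} (hu : u.1 ∈ e.target) :
    transition e e u = u := by
  have hd := locDiffeo_transition he he
  have hu' : u.1 ∈ (e.symm ≫ₕ e).source := by
    simp [hu, e.map_target hu]
  have hev : (e ∘ e.symm) =ᶠ[𝓝 u.1] id :=
    Filter.eventuallyEq_of_mem (e.open_target.mem_nhds hu) fun x hx => e.right_inv hx
  rw [transition, jetLift_congr (φ' := id) (ψ' := id) hd hu' hev (by
    rw [Function.comp_apply, e.right_inv hu]; exact hev), jetLift_id]

theorem transition_comp [IsManifold (𝓡 4) ∞ M] {e e' e'' : OpenPartialHomeomorph M Base}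
    (he : e ∈ IsManifold.maximalAtlas (𝓡 4) ∞ M) (he' : e' ∈ IsManifold.maximalAtlas (𝓡 4) ∞ M)
    (he'' : e'' ∈ IsManifold.maximalAtlas (𝓡 4) ∞ M) {u : JCoord} (hu : u.1 ∈ e.target)
    (hu' : e.symm u.1 ∈ e'.source) (hu'' : e.symm u.1 ∈ e''.source) :
    transition e' e'' (transition e e' u) = transition e e'' u := by
  have s1 : u.1 ∈ (e.symm ≫ₕ e').source := by
    simp [hu, hu']
  have s2 : u.1 ∈ (e.symm ≫ₕ e'').source := by
    simp [hu, hu'']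
  have s3 : (e' ∘ e.symm) u.1 ∈ (e'.symm ≫ₕ e'').source := by
    simp [e'.map_source hu', e'.left_inv hu', hu'']
  unfold transition
  rw [jetLift_comp (locDiffeo_transition he he') (locDiffeo_transition he' he'') s1 s3]
  refine (jetLift_congr (locDiffeo_transition he he'') s2 ?_ ?_).symm
  · filter_upwards [e.symm.continuousAt (x := u.1) hu |>.preimage_mem_nhds
      (e'.open_source.mem_nhds hu')] with x hx
    have hx : e.symm x ∈ e'.source := hx
    simp [e'.left_inv hx]
  · have h1 : (e'' ∘ e.symm) u.1 ∈ e''.target := e''.map_source hu''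
    have h2 : e''.symm ((e'' ∘ e.symm) u.1) ∈ e'.source := by
      simpa [e''.left_inv hu''] using hu'
    filter_upwards [e''.symm.continuousAt (x := (e'' ∘ e.symm) u.1) h1 |>.preimage_mem_nhds
      (e'.open_source.mem_nhds h2)] with x hx
    have hx : e''.symm x ∈ e'.source := hx
    simp [e'.left_inv hx]

variable [IsManifold (𝓡 4) ∞ M]

theorem chartAt_mem (x : M) : chartAt Base x ∈ IsManifold.maximalAtlas (𝓡 4) ∞ M :=
  IsManifold.chart_mem_maximalAtlas x

/-- The adapted coordinates `(x^μ, g_{αβ}, Γ^α_{βγ}, g_{αβ,μ}, Γ^α_{βγ,μ})` of `J¹π` induced by a chart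
of `M`. -/
noncomputable def jetChart (e : OpenPartialHomeomorph M Base)
    (he : e ∈ IsManifold.maximalAtlas (𝓡 4) ∞ M) : PartialEquiv (JetBundle M) JCoord where
  toFun p := transition (chartAt Base p.base) e p.localCoord
  invFun u := JetBundle.ofCoord (e.symm u.1) (transition e (chartAt Base (e.symm u.1)) u)
  source := {p | p.base ∈ e.source}
  target := {u | u.1 ∈ e.target ∧ IsLorentzian u.2.1.1}
  map_source' p hp := by
    have hp : p.base ∈ e.source := hp
    have h0 : (chartAt Base p.base).symm p.localCoord.1 = p.base :=
      (chartAt Base p.base).left_inv (mem_chart_source _ _)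
    refine ⟨?_, transition_lorentz (chartAt_mem _) he ?_ p.lorentz⟩
    · rw [transition_fst, h0]; exact e.map_source hp
    · refine ⟨(chartAt Base p.base).map_source (mem_chart_source _ _), ?_⟩
      change (chartAt Base p.base).symm p.localCoord.1 ∈ e.source
      rw [h0]; exact hp
  map_target' u hu := by
    change (JetBundle.ofCoord _ _).base ∈ e.source
    rw [JetBundle.ofCoord_base]; exact e.map_target hu.1
  left_inv' p hp := by
    have hp : p.base ∈ e.source := hp
    have h0 : (chartAt Base p.base).symm p.localCoord.1 = p.base :=
      (chartAt Base p.base).left_inv (mem_chart_source _ _)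
    have hm := mem_chart_source Base p.base
    rw [transition_fst, h0, e.left_inv hp,
      transition_comp (chartAt_mem _) he (chartAt_mem _)
        ((chartAt Base p.base).map_source hm) (by rw [h0]; exact hp) (by rw [h0]; exact hm),
      transition_self (chartAt_mem _) ((chartAt Base p.base).map_source hm)]
    exact p.ofCoord_localCoord
  right_inv' u hu := by
    have hx := e.map_target hu.1
    have hm := mem_chart_source Base (e.symm u.1)
    have hs : u.1 ∈ (e.symm ≫ₕ chartAt Base (e.symm u.1)).source := ⟨hu.1, hm⟩
    rw [JetBundle.ofCoord_base, JetBundle.localCoord_ofCoord rfl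
      (transition_lorentz he (chartAt_mem _) hs hu.2),
      transition_comp he (chartAt_mem _) he hu.1 hm hx, transition_self he hu.1]

theorem jetChart_transition {e e' : OpenPartialHomeomorph M Base}
    (he : e ∈ IsManifold.maximalAtlas (𝓡 4) ∞ M) (he' : e' ∈ IsManifold.maximalAtlas (𝓡 4) ∞ M)
    {u : JCoord} (hu : u ∈ ((jetChart e he).symm.trans (jetChart e' he')).source) :
    ((jetChart e he).symm.trans (jetChart e' he')) u = transition e e' u := by
  obtain ⟨⟨h1, h2⟩, h3⟩ := hu
  have h3 : (JetBundle.ofCoord (e.symm u.1) (transition e (chartAt Base (e.symm u.1)) u)).base ∈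
    e'.source := h3
  rw [JetBundle.ofCoord_base] at h3
  have hm := mem_chart_source Base (e.symm u.1)
  have hs : u.1 ∈ (e.symm ≫ₕ chartAt Base (e.symm u.1)).source := ⟨h1, hm⟩
  change transition (chartAt Base (JetBundle.ofCoord (e.symm u.1)
    (transition e (chartAt Base (e.symm u.1)) u)).base) e' (JetBundle.localCoord _) = _
  rw [JetBundle.ofCoord_base]
  have h4 := JetBundle.localCoord_ofCoord rfl (transition_lorentz he (chartAt_mem _) hs h2)
  exact (congrArg _ h4).trans (transition_comp he (chartAt_mem _) he' h1 hm h3)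

theorem jetChart_trans_source {e e' : OpenPartialHomeomorph M Base}
    (he : e ∈ IsManifold.maximalAtlas (𝓡 4) ∞ M) (he' : e' ∈ IsManifold.maximalAtlas (𝓡 4) ∞ M) :
    ((jetChart e he).symm.trans (jetChart e' he')).source =
      {u | u.1 ∈ (e.symm ≫ₕ e').source ∧ IsLorentzian u.2.1.1} := by
  ext u
  have : (jetChart e he).symm u ∈ (jetChart e' he').source ↔ e.symm u.1 ∈ e'.source := by
    change (JetBundle.ofCoord _ _).base ∈ e'.source ↔ _
    rw [JetBundle.ofCoord_base]
  change ((u.1 ∈ e.target ∧ IsLorentzian u.2.1.1) ∧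
    (jetChart e he).symm u ∈ (jetChart e' he').source) ↔
      ((u.1 ∈ e.target ∧ e.symm u.1 ∈ e'.source) ∧ _)
  rw [this]
  exact ⟨fun h => ⟨⟨h.1.1, h.2⟩, h.1.2⟩, fun h => ⟨⟨h.1.1, h.2⟩, h.1.2⟩⟩

theorem jetChart_contDiffOn {e e' : OpenPartialHomeomorph M Base}
    (he : e ∈ IsManifold.maximalAtlas (𝓡 4) ∞ M) (he' : e' ∈ IsManifold.maximalAtlas (𝓡 4) ∞ M) :
    ContDiffOn ℝ ∞ ((jetChart e he).symm.trans (jetChart e' he'))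
      ((jetChart e he).symm.trans (jetChart e' he')).source := by
  have : ContDiffOn ℝ ∞ (transition e e')
      ((jetChart e he).symm.trans (jetChart e' he')).source := by
    rw [jetChart_trans_source]
    exact fun u hu => (jetLift_contDiffAt (locDiffeo_transition he he') hu.1).contDiffWithinAt
  exact this.congr fun u hu => jetChart_transition he he' hu

variable (M) in
/-- The smooth atlas of `J¹π` formed by all adapted coordinate systems. -/
noncomputable def jetCore : ChartedSpaceCore JCoord (JetBundle M) where
  atlas := {c | ∃ e he, c = jetChart e he}
  chartAt p := jetChart (chartAt Base p.base) (chartAt_mem p.base)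
  mem_chart_source p := mem_chart_source Base p.base
  chart_mem_atlas p := ⟨_, _, rfl⟩
  open_source := by
    rintro _ _ ⟨e, he, rfl⟩ ⟨e', he', rfl⟩
    rw [jetChart_trans_source]
    exact ((e.symm ≫ₕ e').open_source.preimage continuous_fst).inter
      (isOpen_isLorentzian.preimage
        (continuous_fst.comp (continuous_fst.comp continuous_snd)))
  continuousOn_toFun := by
    rintro _ _ ⟨e, he, rfl⟩ ⟨e', he', rfl⟩
    exact (jetChart_contDiffOn he he').continuousOn

noncomputable instance : TopologicalSpace (JetBundle M) := (jetCore M).toTopologicalSpace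

noncomputable instance : ChartedSpace JCoord (JetBundle M) := (jetCore M).toChartedSpace

instance : IsManifold 𝓘(ℝ, JCoord) ∞ (JetBundle M) := by
  refine isManifold_of_contDiffOn _ _ _ ?_
  rintro e e' he he'
  obtain ⟨c, hc, rfl⟩ : ∃ c, ∃ h : c ∈ (jetCore M).atlas,
    (jetCore M).openPartialHomeomorph c h = e := by
    have he : e ∈ ⋃ (c : PartialEquiv (JetBundle M) JCoord) (h : c ∈ (jetCore M).atlas),
      {(jetCore M).openPartialHomeomorph c h} := he
    simp only [Set.mem_iUnion, Set.mem_singleton_iff] at he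
    obtain ⟨c, h, rfl⟩ := he
    exact ⟨c, h, rfl⟩
  obtain ⟨c', hc', rfl⟩ : ∃ c, ∃ h : c ∈ (jetCore M).atlas,
    (jetCore M).openPartialHomeomorph c h = e' := by
    have he' : e' ∈ ⋃ (c : PartialEquiv (JetBundle M) JCoord) (h : c ∈ (jetCore M).atlas),
      {(jetCore M).openPartialHomeomorph c h} := he'
    simp only [Set.mem_iUnion, Set.mem_singleton_iff] at he'
    obtain ⟨c, h, rfl⟩ := he'
    exact ⟨c, h, rfl⟩
  obtain ⟨f, hf, rfl⟩ := hc
  obtain ⟨f', hf', rfl⟩ := hc'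
  refine (jetChart_contDiffOn hf hf').mono ?_
  intro x hx
  exact hx.1

end Charts

section Coordinates

/-- The coordinate function `g_{αβ}`. -/
def gC (u : JCoord) (α β : Fin 4) : ℝ := u.2.1.1 s(α, β)

/-- The coordinate function `Γ^α_{βγ}`. -/
def gamC (u : JCoord) (α β γ : Fin 4) : ℝ := u.2.1.2 α β γ

/-- The coordinate function `g_{αβ,μ}`. -/
noncomputable def gJ (u : JCoord) (α β μ : Fin 4) : ℝ := (u.2.2 (bvec μ)).1 s(α, β)

/-- The coordinate function `Γ^α_{βγ,μ}`. -/
noncomputable def gamJ (u : JCoord) (α β γ μ : Fin 4) : ℝ := (u.2.2 (bvec μ)).2 α β γ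

/-- The one-form `dx^μ`. -/
noncomputable def dx (μ : Fin 4) : JCoord →L[ℝ] ℝ :=
  (EuclideanSpace.proj μ : Base →L[ℝ] ℝ).comp (ContinuousLinearMap.fst ℝ Base _)

/-- The coordinate vector `∂/∂g_{αβ}`. -/
noncomputable def dirG (α β : Fin 4) : JCoord := (0, (Pi.single s(α, β) 1, 0), 0)

/-- The vertical vector of `J¹π → E` with components `w^a` along `∂/∂y^a_μ`, where `y^a` are the
fibre coordinates of `E`. -/
noncomputable def dirJ (μ : Fin 4) : Fiber →L[ℝ] JCoord :=
  (ContinuousLinearMap.inr ℝ Base (Fiber × (Base →L[ℝ] Fiber))).comp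
    ((ContinuousLinearMap.inr ℝ Fiber (Base →L[ℝ] Fiber)).comp
      (ContinuousLinearMap.smulRightL ℝ Base Fiber (EuclideanSpace.proj μ : Base →L[ℝ] ℝ)))

theorem dirJ_apply (μ : Fin 4) (w : Fiber) :
    dirJ μ w = (0, 0, (EuclideanSpace.proj μ : Base →L[ℝ] ℝ).smulRight w) := rfl

/-- The coordinate vector `∂/∂Γ^α_{βγ,μ}`. -/
noncomputable def dirGamJ (α β γ μ : Fin 4) : JCoord :=
  dirJ μ (0, Pi.single α (Pi.single β (Pi.single γ 1)))

/-- The matrix `(g_{αβ})`. -/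
def gMat (u : JCoord) : Matrix (Fin 4) (Fin 4) ℝ := Matrix.of (gC u)

/-- `ϱ = √|det g|`. -/
noncomputable def rho (u : JCoord) : ℝ := √|(gMat u).det|

/-- The Ricci tensor `R_{αβ}` of the connection. -/
noncomputable def ricci (u : JCoord) (α β : Fin 4) : ℝ :=
  ∑ γ, (gamJ u γ β α γ - gamJ u γ γ α β) +
    ∑ γ, ∑ σ, (gamC u γ β α * gamC u σ σ γ - gamC u γ β σ * gamC u σ γ α)

/-- The Einstein–Palatini Lagrangian function `L_EP = ϱ g^{αβ} R_{αβ}`. -/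
noncomputable def lagrangian (u : JCoord) : ℝ :=
  rho u * ∑ α, ∑ β, (gMat u)⁻¹ α β * ricci u α β

/-- `L_α^{βγ,μ} = ∂L_EP/∂Γ^α_{βγ,μ}`. -/
noncomputable def momentum (α β γ μ : Fin 4) (u : JCoord) : ℝ :=
  fderiv ℝ lagrangian u (dirGamJ α β γ μ)

/-- `H = L_α^{βγ,μ} Γ^α_{βγ,μ} - L_EP`. -/
noncomputable def energy (u : JCoord) : ℝ :=
  ∑ α, ∑ β, ∑ γ, ∑ μ, momentum α β γ μ u * gamJ u α β γ μ - lagrangian u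

/-- Torsion components `T^α_{βγ}`. -/
def torsion (u : JCoord) (α β γ : Fin 4) : ℝ := gamC u α β γ - gamC u α γ β

/-- `T^α_{βγ,ν} = Γ^α_{βγ,ν} - Γ^α_{γβ,ν}`. -/
noncomputable def torsionJ (u : JCoord) (α β γ ν : Fin 4) : ℝ := gamJ u α β γ ν - gamJ u α γ β ν

/-- Kronecker's delta. -/
def delta (α β : Fin 4) : ℝ := if α = β then 1 else 0

/-- The connection constraints `c^{μν}`. -/
noncomputable def connectionConstraint (u : JCoord) (μ ν : Fin 4) : ℝ :=
  fderiv ℝ energy u (dirG μ ν) -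
    ∑ α, ∑ β, ∑ γ, ∑ σ, fderiv ℝ (momentum α β γ σ) u (dirG μ ν) * gamJ u α β γ σ

/-- The pre-metricity constraints `m_{ρσ,μ}`. -/
noncomputable def premetricityConstraint (u : JCoord) (ρ σ μ : Fin 4) : ℝ :=
  gJ u ρ σ μ - ∑ l, gC u σ l * gamC u l μ ρ - ∑ l, gC u ρ l * gamC u l μ σ -
    2 / 3 * gC u ρ σ * ∑ l, torsion u l l μ

/-- The torsion constraints `t^α_{βγ}`. -/
noncomputable def torsionConstraint (u : JCoord) (α β γ : Fin 4) : ℝ :=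
  torsion u α β γ - 1 / 3 * delta α β * ∑ μ, torsion u μ μ γ +
    1 / 3 * delta α γ * ∑ μ, torsion u μ μ β

/-- The constraints `r^α_{βγ,ν}`. -/
noncomputable def torsionJetConstraint (u : JCoord) (α β γ ν : Fin 4) : ℝ :=
  torsionJ u α β γ ν - 1 / 3 * delta α β * ∑ μ, torsionJ u μ μ γ ν +
    1 / 3 * delta α γ * ∑ μ, torsionJ u μ μ β ν

/-- The coordinate vectors where all four families of constraints vanish. -/
def constraintSet : Set JCoord :=
  {u | (∀ μ ν, connectionConstraint u μ ν = 0) ∧ (∀ ρ σ μ, premetricityConstraint u ρ σ μ = 0) ∧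
    (∀ α β γ, torsionConstraint u α β γ = 0) ∧ ∀ α β γ ν, torsionJetConstraint u α β γ ν = 0}

/-- The determinant, as a continuous alternating form of its rows. -/
noncomputable def detForm : (Fin 4 → ℝ) [⋀^Fin 4]→L[ℝ] ℝ :=
  { (Matrix.detRowAlternating : (Fin 4 → ℝ) [⋀^Fin 4]→ₗ[ℝ] ℝ) with
    cont := Continuous.matrix_det (A := fun v : Fin 4 → Fin 4 → ℝ => Matrix.of v) continuous_id }

/-- The form `a_0 ∧ a_1 ∧ a_2 ∧ a_3`, with value `det (a_j (v_i))` on `v_0, v_1, v_2, v_3`. -/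
noncomputable def wedge (a : Fin 4 → (JCoord →L[ℝ] ℝ)) : JCoord [⋀^Fin 4]→L[ℝ] ℝ :=
  detForm.compContinuousLinearMap (ContinuousLinearMap.pi a)

/-- The contact forms `θ^a = dy^a - y^a_ν dx^ν`, where `y^a` are the fibre coordinates of `E`. -/
noncomputable def contactForm (u : JCoord) : JCoord →L[ℝ] Fiber :=
  (ContinuousLinearMap.fst ℝ Fiber _).comp (ContinuousLinearMap.snd ℝ Base _) -
    u.2.2.comp (ContinuousLinearMap.fst ℝ Base _)

/-- The covector with components `∂L_EP/∂y^a_μ`. -/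
noncomputable def fiberDeriv (μ : Fin 4) (u : JCoord) : Fiber →L[ℝ] ℝ :=
  (fderiv ℝ lagrangian u).comp (dirJ μ)

/-- The Poincaré–Cartan 4-form
`Θ_L = i(V) (L_EP d⁴x) + L_EP d⁴x = (∂L_EP/∂y^a_μ) θ^a ∧ d³x_μ + L_EP d⁴x` in adapted coordinates,
where `V = θ^a ⊗ ∂/∂y^a_μ ⊗ ∂/∂x^μ` is the vertical endomorphism and `d³x_μ = i(∂/∂x^μ) d⁴x`.
Note that `θ ∧ d³x_μ` is `dx^0 ∧ dx^1 ∧ dx^2 ∧ dx^3` with the factor `dx^μ` replaced by `θ`. -/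
noncomputable def poincareCartanPotential (u : JCoord) : JCoord [⋀^Fin 4]→L[ℝ] ℝ :=
  ∑ μ, wedge (Function.update dx μ ((fiberDeriv μ u).comp (contactForm u))) +
    lagrangian u • wedge dx

/-- The Poincaré–Cartan 5-form `Ω_L = -dΘ_L` in adapted coordinates. -/
noncomputable def poincareCartan (u : JCoord) : JCoord [⋀^Fin 5]→L[ℝ] ℝ :=
  -extDeriv poincareCartanPotential u

/-- The contraction `i(X)Ω` of a 4-vector and a 5-form; for `X = X_0 ∧ X_1 ∧ X_2 ∧ X_3` it is
`w ↦ Ω(X_0, X_1, X_2, X_3, w) = Ω(w, X_0, X_1, X_2, X_3)`. -/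
noncomputable def contraction (X : ⋀[ℝ]^4 JCoord) (Ω : JCoord [⋀^Fin 5]→L[ℝ] ℝ) (w : JCoord) : ℝ :=
  exteriorPower.alternatingMapLinearEquiv (Ω.toAlternatingMap.curryLeft w) X

end Coordinates

section Geometry

variable {M : Type*} [TopologicalSpace M] [ChartedSpace Base M] [IsManifold (𝓡 4) ∞ M]

/-- `η` is a volume form: a smooth, nowhere vanishing 4-form on `M`. -/
structure IsVolumeForm (η : ∀ x : M, TangentSpace (𝓡 4) x [⋀^Fin 4]→ₗ[ℝ] ℝ) : Prop where
  ne_zero : ∀ x, η x ≠ 0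
  smooth : ∀ e ∈ IsManifold.maximalAtlas (𝓡 4) ∞ M, ContDiffOn ℝ ∞
    (fun y : Base => η (e.symm y) fun i => mfderiv (𝓡 4) (𝓡 4) e.symm y (bvec i)) e.target

/-- The chart `e` of `M` satisfies `η = dx^0 ∧ dx^1 ∧ dx^2 ∧ dx^3` on its domain. -/
def IsAdapted (η : ∀ x : M, TangentSpace (𝓡 4) x [⋀^Fin 4]→ₗ[ℝ] ℝ)
    (e : OpenPartialHomeomorph M Base) : Prop :=
  ∀ x ∈ e.source, ∀ v : Fin 4 → TangentSpace (𝓡 4) x,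
    η x v = detForm fun i => WithLp.ofLp (mfderiv (𝓡 4) (𝓡 4) e x (v i) : Base)

variable (M) in
/-- Fields of 4-vectors on `J¹π`. -/
abbrev MultivectorField := ∀ p : JetBundle M, ⋀[ℝ]^4 (TangentSpace 𝓘(ℝ, JCoord) p)

/-- The differential at `p` of the adapted coordinates induced by `e`. -/
noncomputable def jetChartDeriv (e : OpenPartialHomeomorph M Base)
    (he : e ∈ IsManifold.maximalAtlas (𝓡 4) ∞ M) (p : JetBundle M) :
    TangentSpace 𝓘(ℝ, JCoord) p →ₗ[ℝ] JCoord :=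
  (mfderiv 𝓘(ℝ, JCoord) 𝓘(ℝ, JCoord) (jetChart e he) p).toLinearMap

/-- The expression of a 4-vector at `p` in the adapted coordinates induced by `e`. -/
noncomputable def inCoord (e : OpenPartialHomeomorph M Base)
    (he : e ∈ IsManifold.maximalAtlas (𝓡 4) ∞ M) (p : JetBundle M)
    (X : ⋀[ℝ]^4 (TangentSpace 𝓘(ℝ, JCoord) p)) : ⋀[ℝ]^4 JCoord :=
  exteriorPower.map 4 (jetChartDeriv e he p) X

/-- Smooth, decomposable, transverse and semiholonomic 4-vector fields: in adapted coordinates,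
`X = f ⋀_ν (∂/∂x^ν + y^a_ν ∂/∂y^a + F^a_{μ,ν} ∂/∂y^a_μ)` with `f` nowhere zero and with smooth
coefficients, where `y^a` are the fibre coordinates `g_{ρσ}`, `Γ^α_{βγ}` of `E`. -/
def IsSemiholonomic (η : ∀ x : M, TangentSpace (𝓡 4) x [⋀^Fin 4]→ₗ[ℝ] ℝ)
    (X : MultivectorField M) : Prop :=
  ∀ (e : OpenPartialHomeomorph M Base) (he : e ∈ IsManifold.maximalAtlas (𝓡 4) ∞ M),
    IsAdapted η e → ∃ (f : JCoord → ℝ) (F : Fin 4 → JCoord → (Base →L[ℝ] Fiber)),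
      ContDiffOn ℝ ∞ f (jetChart e he).target ∧
      (∀ ν, ContDiffOn ℝ ∞ (F ν) (jetChart e he).target) ∧
      (∀ u ∈ (jetChart e he).target, f u ≠ 0) ∧
      ∀ p : JetBundle M, p.base ∈ e.source →
        inCoord e he p (X p) = f (jetChart e he p) • exteriorPower.ιMulti ℝ 4 fun ν : Fin 4 =>
          ((bvec ν, (jetChart e he p).2.2 (bvec ν), F ν (jetChart e he p)) : JCoord)

/-- The field equation `i(X) Ω_L = 0` at the point `p`. -/
def SolvesFieldEquation (η : ∀ x : M, TangentSpace (𝓡 4) x [⋀^Fin 4]→ₗ[ℝ] ℝ)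
    (X : MultivectorField M) (p : JetBundle M) : Prop :=
  ∀ (e : OpenPartialHomeomorph M Base) (he : e ∈ IsManifold.maximalAtlas (𝓡 4) ∞ M),
    IsAdapted η e → p.base ∈ e.source →
      contraction (inCoord e he p (X p)) (poincareCartan (jetChart e he p)) = 0

/-- `S` is an embedded submanifold of dimension `d`: near each of its points it is a linear
`d`-dimensional slice in some smooth chart. -/
def IsEmbeddedSubmanifold (d : ℕ) (S : Set (JetBundle M)) : Prop :=
  ∀ p ∈ S, ∃ Φ ∈ IsManifold.maximalAtlas 𝓘(ℝ, JCoord) ∞ (JetBundle M), p ∈ Φ.source ∧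
    ∃ W : Submodule ℝ JCoord, Module.finrank ℝ W = d ∧ ∀ q ∈ Φ.source, q ∈ S ↔ Φ q ∈ W

/-- The tangent space of `S` at `p`, spanned by the velocities of smooth curves in `S`. -/
noncomputable def tangentSubspace (S : Set (JetBundle M)) (p : JetBundle M) :
    Submodule ℝ (TangentSpace 𝓘(ℝ, JCoord) p) :=
  Submodule.span ℝ {v | ∃ c : ℝ → JetBundle M, ContMDiffAt 𝓘(ℝ, ℝ) 𝓘(ℝ, JCoord) ∞ c 0 ∧
    c 0 = p ∧ (∀ᶠ t in 𝓝 0, c t ∈ S) ∧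
      (mfderiv 𝓘(ℝ, ℝ) 𝓘(ℝ, JCoord) c 0 (1 : ℝ) : JCoord) = v}

/-- `X` is tangent to `S`: at the points of `S` it is a 4-vector of the tangent space of `S`. -/
def IsTangentTo (X : MultivectorField M) (S : Set (JetBundle M)) : Prop :=
  ∀ p ∈ S, X p ∈ LinearMap.range (exteriorPower.map 4 (tangentSubspace S p).subtype)

end Geometry

end EinsteinPalatini

/-! The Lagrangian `L = ϱ g^{αβ} R_{αβ}` is affine in the jet coordinates, and its momenta
`∂L/∂y^a_μ` depend on the metric alone. Contracting `Ω_L` with a semiholonomic 4-vector therefore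
leaves the Euler–Lagrange expressions, and these contain no second derivatives: the coefficients `F`
of the 4-vector drop out. The equation for `g` says that the symmetrised Ricci tensor vanishes,
which is what the constraints `c` amount to in dimension four (`connectionConstraint_iff`). The
Palatini equation for `Γ` follows from `m = 0` and `t = 0`: these give the derivative of the density
`ϱ g^{αβ}` in terms of `Γ` and the torsion trace, and the equation becomes an algebraic identity
(`palatini_identity`). So every semiholonomic 4-vector solves the field equation at every point of
the constraint set (`contraction_poincareCartan`).

It remains to find a semiholonomic 4-vector tangent to that set. Over a fixed value `y = (g, Γ)` the
constraints on the jet part are affine, and `particularJet y` solves all of them except `t`, which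
involves only `y`. Subtracting it from the jet part (`shear`) turns the constraint set into a linear
subspace, so the set is embedded. The lift `v ↦ (v, y_v, D(particularJet)(y_v))` becomes `(v, y_v,
0)` under the differential of the shear; it is tangent as soon as `y_v` satisfies the linear
equations `t`, and this is what `r`, the total derivative of `t`, expresses
(`fderiv_shear_localLift`).

For globalisation the constraints are restated for multilinear maps: torsion of pure trace, its
derivative, premetricity, and symmetrised Ricci tensor zero. In this form they are preserved by
every coordinate change of the base (`JetTransform.tensorConstraint`), so the local sets agree on
overlaps. Semiholonomic lifts at a jet form an affine space, and tangency is a linear condition; a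
partition of unity thus glues the local lifts to one horizontal lift (`globalLift`). The wedge of
the lifts of a frame of `M`, divided by the value of `η` on that frame, does not depend on the frame
and has `f = 1` in adapted coordinates. -/

namespace EinsteinPalatini

/-! ### The metric density `ϱ g^{αβ}` and its derivative. -/

section Density

/-- The symmetric matrix `(g_{αβ})`. -/
def mat (g : Sym2 (Fin 4) → ℝ) : Matrix (Fin 4) (Fin 4) ℝ := Matrix.of fun α β => g s(α, β)

theorem mat_apply (g : Sym2 (Fin 4) → ℝ) (α β : Fin 4) : mat g α β = g s(α, β) := rfl

theorem mat_transpose (g : Sym2 (Fin 4) → ℝ) : (mat g).transpose = mat g := by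
  ext α β; exact congrArg g Sym2.eq_swap

/-- The metric density `ϱ g^{αβ}`. -/
noncomputable def dens (g : Sym2 (Fin 4) → ℝ) : Matrix (Fin 4) (Fin 4) ℝ :=
  √|(mat g).det| • (mat g)⁻¹

theorem mat_inv_symm (g : Sym2 (Fin 4) → ℝ) (α β : Fin 4) :
    (mat g)⁻¹ α β = (mat g)⁻¹ β α := by
  conv_lhs => rw [← mat_transpose g, ← Matrix.transpose_nonsing_inv]
  rfl

theorem dens_symm (g : Sym2 (Fin 4) → ℝ) (α β : Fin 4) : dens g α β = dens g β α := by
  simp only [dens, Matrix.smul_apply, mat_inv_symm g α β]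

theorem lagrangian_eq (u : JCoord) :
    lagrangian u = ∑ α, ∑ β, dens u.2.1.1 α β * ricci u α β := by
  simp only [lagrangian, Finset.mul_sum, dens, Matrix.smul_apply, smul_eq_mul, mul_assoc]
  rfl

theorem contDiffAt_det {E : Type*} [NormedAddCommGroup E] [NormedSpace ℝ E]
    {M : E → Matrix (Fin 4) (Fin 4) ℝ} {x : E}
    (h : ∀ i j, ContDiffAt ℝ ∞ (fun y => M y i j) x) :
    ContDiffAt ℝ ∞ (fun y => (M y).det) x := by
  simp only [Matrix.det_apply]
  refine ContDiffAt.sum fun σ _ => ?_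
  simp only [Units.smul_def, zsmul_eq_mul]
  exact contDiffAt_const.mul (contDiffAt_prod fun i _ => h _ _)

theorem contDiffAt_inv {E : Type*} [NormedAddCommGroup E] [NormedSpace ℝ E]
    {M : E → Matrix (Fin 4) (Fin 4) ℝ} {x : E}
    (h : ∀ i j, ContDiffAt ℝ ∞ (fun y => M y i j) x) (hx : (M x).det ≠ 0) (i j : Fin 4) :
    ContDiffAt ℝ ∞ (fun y => (M y)⁻¹ i j) x := by
  simp only [Matrix.inv_def, Ring.inverse_eq_inv', Matrix.smul_apply, smul_eq_mul]
  refine ((contDiffAt_det h).inv hx).mul ?_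
  simp only [Matrix.adjugate_apply]
  refine contDiffAt_det fun a b => ?_
  simp only [Matrix.updateRow_apply]
  split_ifs
  · exact contDiffAt_const
  · exact h a b

theorem contDiffAt_dens {g : Sym2 (Fin 4) → ℝ} (hg : (mat g).det ≠ 0) (α β : Fin 4) :
    ContDiffAt ℝ ∞ (fun g => dens g α β) g := by
  have h : ∀ i j, ContDiffAt ℝ ∞ (fun g => mat g i j) g := fun i j =>
    (contDiff_apply ℝ ℝ s(i, j)).contDiffAt
  exact (((contDiffAt_det h).abs hg).sqrt (abs_ne_zero.2 hg)).mul (contDiffAt_inv h hg α β)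

/-- Jacobi's formula. The determinant is multilinear in the rows, so its derivative sums over the
replacement of row `i` by `M' i`; Cramer's rule evaluates each term through the adjugate. -/
theorem hasDerivAt_det {M : ℝ → Matrix (Fin 4) (Fin 4) ℝ} {M' : Matrix (Fin 4) (Fin 4) ℝ} {t : ℝ}
    (h : ∀ i j, HasDerivAt (fun s => M s i j) (M' i j) t) :
    HasDerivAt (fun s => (M s).det) (((M t).adjugate * M').trace) t := by
  have h1 : HasDerivAt (fun s => (M s : Fin 4 → Fin 4 → ℝ)) (M' : Fin 4 → Fin 4 → ℝ) t :=
    hasDerivAt_pi.2 fun i => hasDerivAt_pi.2 fun j => h i j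
  have h2 := (detForm.toContinuousMultilinearMap.hasFDerivAt (M t)).comp_hasDerivAt t h1
  refine h2.congr_deriv ((ContinuousMultilinearMap.linearDeriv_apply _ _ _).trans ?_)
  have h3 : ∀ i, detForm.toContinuousMultilinearMap (Function.update (M t) i (M' i)) =
      ∑ j, (M t).adjugate j i * M' i j := by
    intro i
    change ((M t).updateRow i (M' i)).det = _
    rw [← Matrix.cramer_transpose_apply, Matrix.cramer_eq_adjugate_mulVec,
      ← Matrix.adjugate_transpose]
    rfl
  rw [Finset.sum_congr rfl fun i _ => h3 i, Matrix.trace, Finset.sum_comm]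
  rfl

theorem hasDerivAt_inv {M : ℝ → Matrix (Fin 4) (Fin 4) ℝ} {M' : Matrix (Fin 4) (Fin 4) ℝ} {t : ℝ}
    (h : ∀ i j, HasDerivAt (fun s => M s i j) (M' i j) t)
    (hM : ∀ i j, ContDiffAt ℝ ∞ (fun s => M s i j) t) (ht : (M t).det ≠ 0) (i j : Fin 4) :
    HasDerivAt (fun s => (M s)⁻¹ i j) (-((M t)⁻¹ * M' * (M t)⁻¹) i j) t := by
  have hd : ∀ i j, HasDerivAt (fun s => (M s)⁻¹ i j) (deriv (fun s => (M s)⁻¹ i j) t) t :=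
    fun i j => ((contDiffAt_inv hM ht i j).differentiableAt (by simp)).hasDerivAt
  set N' : Matrix (Fin 4) (Fin 4) ℝ := Matrix.of fun i j => deriv (fun s => (M s)⁻¹ i j) t
  -- Differentiability of the inverse is known from Cramer's formula; its value comes from
  -- differentiating `M M⁻¹ = 1`, valid near `t`.
  have key : M' * (M t)⁻¹ + M t * N' = 0 := by
    ext a b
    have h1 : HasDerivAt (fun s => (M s * (M s)⁻¹) a b)
        (∑ c, (M' a c * (M t)⁻¹ c b + M t a c * N' c b)) t := by
      simp only [Matrix.mul_apply]
      exact HasDerivAt.fun_sum fun c _ => (h a c).mul (hd c b)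
    have h2 : (fun s => (M s * (M s)⁻¹) a b) =ᶠ[𝓝 t] fun _ => (1 : Matrix _ _ ℝ) a b := by
      filter_upwards [(contDiffAt_det hM).continuousAt.eventually_ne ht] with s hs
      rw [Matrix.mul_nonsing_inv _ (isUnit_iff_ne_zero.2 hs)]
    have h3 := h1.unique ((hasDerivAt_const t _).congr_of_eventuallyEq h2)
    rw [Finset.sum_add_distrib] at h3
    exact h3
  have h4 : N' = -((M t)⁻¹ * M' * (M t)⁻¹) := by
    have h5 : (M t)⁻¹ * (M t * N') = N' :=
      Matrix.nonsing_inv_mul_cancel_left _ _ (isUnit_iff_ne_zero.2 ht)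
    rw [← h5, eq_neg_of_add_eq_zero_right key, Matrix.mul_neg, Matrix.mul_assoc]
  exact (hd i j).congr_deriv (congrFun (congrFun h4 i) j)

/-- The derivative of the metric density in the direction `h`. -/
noncomputable def densDeriv (g h : Sym2 (Fin 4) → ℝ) : Matrix (Fin 4) (Fin 4) ℝ :=
  √|(mat g).det| • ((1 / 2 * ((mat g)⁻¹ * mat h).trace) • (mat g)⁻¹ -
    (mat g)⁻¹ * mat h * (mat g)⁻¹)

theorem fderiv_dens {g : Sym2 (Fin 4) → ℝ} (hg : (mat g).det ≠ 0) (h : Sym2 (Fin 4) → ℝ)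
    (α β : Fin 4) : fderiv ℝ (fun g => dens g α β) g h = densDeriv g h α β := by
  have hl : HasDerivAt (fun t : ℝ => g + t • h) h 0 := by
    simpa using ((hasDerivAt_id (0 : ℝ)).smul_const h).const_add g
  have h1 : HasDerivAt (fun t : ℝ => dens (g + t • h) α β)
      (fderiv ℝ (fun g => dens g α β) g h) 0 := by
    have := (contDiffAt_dens hg α β).differentiableAt (by simp) |>.hasFDerivAt
    refine HasFDerivAt.comp_hasDerivAt (f := fun t : ℝ => g + t • h)
      (l := fun g => dens g α β) 0 ?_ hl
    simpa using this
  refine h1.unique ?_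
  have hm : ∀ i j, HasDerivAt (fun t : ℝ => mat (g + t • h) i j) (mat h i j) 0 := fun i j =>
    hasDerivAt_pi.1 hl s(i, j)
  have hc : ∀ i j, ContDiffAt ℝ ∞ (fun t : ℝ => mat (g + t • h) i j) 0 := fun i j => by
    simp only [mat_apply, Pi.add_apply, Pi.smul_apply, smul_eq_mul]; fun_prop
  have hg' : (mat (g + (0 : ℝ) • h)).det ≠ 0 := by simpa using hg
  have ha : HasDerivAt (fun t : ℝ => |(mat (g + t • h)).det|) _ 0 :=
    HasDerivAt.comp (h₂ := fun x : ℝ => |x|) (0 : ℝ) (hasDerivAt_abs hg') (hasDerivAt_det hm)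
  have h2 := (ha.sqrt (abs_ne_zero.2 hg')).mul
    (hasDerivAt_inv hm hc hg' α β)
  simp only [zero_smul, add_zero] at h2
  refine h2.congr_deriv ?_
  have h3 : (mat g).adjugate = (mat g).det • (mat g)⁻¹ := by
    rw [Matrix.inv_def, smul_smul, Ring.inverse_eq_inv', mul_inv_cancel₀ hg, one_smul]
  rw [h3, Matrix.smul_mul, Matrix.trace_smul]
  simp only [densDeriv, Matrix.smul_apply, Matrix.sub_apply, smul_eq_mul]
  -- The chain rule yields `sgn(det g) · det g · tr(g⁻¹h) / (2√|det g|)`, which `h4` and `h6` turn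
  -- into `½ √|det g| tr(g⁻¹h)`.
  have h4 : (SignType.sign (mat g).det : ℝ) * (mat g).det = |(mat g).det| :=
    sign_mul_self _
  have h5 : √|(mat g).det| ≠ 0 := (Real.sqrt_pos.2 (abs_pos.2 hg)).ne'
  have h6 : √|(mat g).det| * √|(mat g).det| = |(mat g).det| := Real.mul_self_sqrt (abs_nonneg _)
  rw [← mul_assoc (SignType.sign (mat g).det : ℝ), h4]
  nth_rewrite 1 [← h6]
  field_simp
  ring

/-- A Lorentzian metric is nondegenerate. -/
theorem IsLorentzian.det_ne_zero {g : Sym2 (Fin 4) → ℝ} (hg : IsLorentzian g) :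
    (mat g).det ≠ 0 := by
  intro h0
  obtain ⟨⟨v, hv⟩, W, hW, hpos⟩ := hg
  obtain ⟨n', hn', hn⟩ := Matrix.exists_mulVec_eq_zero_iff.2 h0
  set n : Base := WithLp.toLp 2 n'
  have hn0 : n ≠ 0 := fun h => hn' (by simpa [n] using h)
  have hrad : ∀ w, gform g w n = 0 := by
    intro w
    have : gform g w n = ∑ μ, w μ * (mat g).mulVec n' μ := by
      simp only [gform, Matrix.mulVec, dotProduct, Finset.mul_sum, mat_apply, n]
      exact Finset.sum_congr rfl fun _ _ => Finset.sum_congr rfl fun _ _ => by ring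
    rw [this, hn]; simp
  -- A radical vector `n` lies outside the positive subspace `W`, hence spans a complement of it.
  -- Every vector is then `w + c n` with `w ∈ W`, and its square is that of `w`, so no negative
  -- vector could exist.
  have hnW : n ∉ W := fun h => (hpos n h hn0).ne' (hrad n)
  have hdisj : W ⊓ Submodule.span ℝ {n} = ⊥ := by
    rw [Submodule.eq_bot_iff]
    rintro x ⟨hx, hx'⟩
    obtain ⟨c, rfl⟩ := Submodule.mem_span_singleton.1 hx'
    by_contra hc
    exact hnW ((W.smul_mem_iff (by rintro rfl; simp at hc)).1 hx)
  have htop : W ⊔ Submodule.span ℝ {n} = ⊤ := by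
    apply Submodule.eq_top_of_finrank_eq
    have := Submodule.finrank_sup_add_finrank_inf_eq W (Submodule.span ℝ {n})
    rw [hdisj, finrank_bot, finrank_span_singleton hn0, hW] at this
    rw [finrank_euclideanSpace_fin]; omega
  obtain ⟨w, hw, z, hz, rfl⟩ := Submodule.mem_sup.1 (htop ▸ Submodule.mem_top (x := v))
  obtain ⟨c, rfl⟩ := Submodule.mem_span_singleton.1 hz
  have e : gform g (w + c • n) (w + c • n) = gform g w w := by
    have e1 : ∀ x, gform g x (w + c • n) = gform g x w + c * gform g x n := by
      intro x
      simp only [gform, Finset.mul_sum, PiLp.add_apply, PiLp.smul_apply, smul_eq_mul,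
        ← Finset.sum_add_distrib]
      exact Finset.sum_congr rfl fun _ _ => Finset.sum_congr rfl fun _ _ => by ring
    rw [e1, hrad, gform_comm, e1, hrad]; ring
  rw [e] at hv
  rcases eq_or_ne w 0 with rfl | h
  · simp [gform] at hv
  · exact absurd (hpos w hw h) (by linarith)

end Density

/-! ### Derivatives of the Lagrangian and the metric equation. -/

section Lagrangian

/-- The part of the Ricci tensor which is linear in the derivatives of the connection. -/
noncomputable def ricLin (j : Base →L[ℝ] Fiber) (α β : Fin 4) : ℝ :=
  ∑ γ, ((j (bvec γ)).2 γ β α - (j (bvec β)).2 γ γ α)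

/-- The part of the Ricci tensor which is quadratic in the connection. -/
noncomputable def ricQuad (Γ : Fin 4 → Fin 4 → Fin 4 → ℝ) (α β : Fin 4) : ℝ :=
  ∑ γ, ∑ σ, (Γ γ β α * Γ σ σ γ - Γ γ β σ * Γ σ γ α)

/-- The derivative of `ricQuad` at `Γ` in the direction `k`. -/
noncomputable def ricQuadDeriv (Γ k : Fin 4 → Fin 4 → Fin 4 → ℝ) (α β : Fin 4) : ℝ :=
  ∑ γ, ∑ σ, (k γ β α * Γ σ σ γ + Γ γ β α * k σ σ γ - (k γ β σ * Γ σ γ α + Γ γ β σ * k σ γ α))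

theorem ricci_eq (u : JCoord) (α β : Fin 4) :
    ricci u α β = ricLin u.2.2 α β + ricQuad u.2.1.2 α β := rfl

theorem contDiff_ricci (α β : Fin 4) : ContDiff ℝ ∞ fun u => ricci u α β := by
  unfold ricci gamJ gamC; fun_prop

theorem contDiffAt_dens_fiber {u : JCoord} (hu : (mat u.2.1.1).det ≠ 0) (α β : Fin 4) :
    ContDiffAt ℝ ∞ (fun u : JCoord => dens u.2.1.1 α β) u :=
  ContDiffAt.comp (g := fun g => dens g α β) (f := fun u : JCoord => u.2.1.1) u
    (contDiffAt_dens hu α β) (ContDiff.contDiffAt (by fun_prop))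

theorem contDiffAt_lagrangian {u : JCoord} (hu : (mat u.2.1.1).det ≠ 0) :
    ContDiffAt ℝ ∞ lagrangian u := by
  rw [show lagrangian = _ from funext lagrangian_eq]
  exact ContDiffAt.sum fun α _ => ContDiffAt.sum fun β _ =>
    (contDiffAt_dens_fiber hu α β).mul (contDiff_ricci α β).contDiffAt

theorem hasDerivAt_line {E F : Type*} [NormedAddCommGroup E] [NormedSpace ℝ E]
    [NormedAddCommGroup F] [NormedSpace ℝ F] {f : E → F} {u : E} (h : ContDiffAt ℝ ∞ f u) (k : E) :
    HasDerivAt (fun t : ℝ => f (u + t • k)) (fderiv ℝ f u k) 0 :=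
  (h.differentiableAt (by simp)).hasFDerivAt.hasLineDerivAt k

theorem fderiv_dens_fiber {u : JCoord} (hu : (mat u.2.1.1).det ≠ 0) (k : JCoord) (α β : Fin 4) :
    fderiv ℝ (fun u : JCoord => dens u.2.1.1 α β) u k = densDeriv u.2.1.1 k.2.1.1 α β := by
  rw [← fderiv_dens hu]
  exact (hasDerivAt_line (contDiffAt_dens_fiber hu α β) k).unique
    (hasDerivAt_line (contDiffAt_dens hu α β) k.2.1.1)

theorem fderiv_lagrangian {u : JCoord} (hu : (mat u.2.1.1).det ≠ 0) (k : JCoord) :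
    fderiv ℝ lagrangian u k = ∑ α, ∑ β, (densDeriv u.2.1.1 k.2.1.1 α β * ricci u α β +
      dens u.2.1.1 α β * (ricLin k.2.2 α β + ricQuadDeriv u.2.1.2 k.2.1.2 α β)) := by
  refine (hasDerivAt_line (contDiffAt_lagrangian hu) k).unique ?_
  simp only [lagrangian_eq]
  refine HasDerivAt.fun_sum fun α _ => HasDerivAt.fun_sum fun β _ => ?_
  have h1 := hasDerivAt_line (contDiffAt_dens_fiber hu α β) k
  rw [fderiv_dens_fiber hu] at h1
  have hJ : ∀ a b c μ, HasDerivAt (fun t : ℝ => gamJ (u + t • k) a b c μ) (gamJ k a b c μ) 0 := by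
    intro a b c μ
    have : (fun t : ℝ => gamJ (u + t • k) a b c μ) =
        fun t => gamJ u a b c μ + t * gamJ k a b c μ := by ext t; simp [gamJ]
    rw [this]
    simpa using ((hasDerivAt_id (0 : ℝ)).mul_const (gamJ k a b c μ)).const_add (gamJ u a b c μ)
  have hC : ∀ a b c, HasDerivAt (fun t : ℝ => gamC (u + t • k) a b c) (gamC k a b c) 0 := by
    intro a b c
    have : (fun t : ℝ => gamC (u + t • k) a b c) =
        fun t => gamC u a b c + t * gamC k a b c := by ext t; simp [gamC]
    rw [this]
    simpa using ((hasDerivAt_id (0 : ℝ)).mul_const (gamC k a b c)).const_add (gamC u a b c)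
  have h2 : HasDerivAt (fun t : ℝ => ricci (u + t • k) α β)
      (ricLin k.2.2 α β + ricQuadDeriv u.2.1.2 k.2.1.2 α β) 0 := by
    unfold ricci
    refine HasDerivAt.add (HasDerivAt.fun_sum fun γ _ => (hJ _ _ _ _).sub (hJ _ _ _ _))
      (HasDerivAt.fun_sum fun γ _ => HasDerivAt.fun_sum fun σ _ => ?_)
    exact (((hC γ β α).mul (hC σ σ γ)).sub ((hC γ β σ).mul (hC σ γ α))).congr_deriv (by
      simp only [zero_smul, add_zero]; rfl)
  exact (h1.mul h2).congr_deriv (by simp only [zero_smul, add_zero])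

theorem densDeriv_zero (g : Sym2 (Fin 4) → ℝ) : densDeriv g 0 = 0 := by
  have : mat 0 = 0 := rfl
  simp [densDeriv, this]

theorem ricLin_zero (α β : Fin 4) : ricLin 0 α β = 0 := by simp [ricLin]

theorem ricQuadDeriv_zero (Γ : Fin 4 → Fin 4 → Fin 4 → ℝ) (α β : Fin 4) :
    ricQuadDeriv Γ 0 α β = 0 := by simp [ricQuadDeriv]

/-- Only the linear part of the Ricci tensor sees a jet direction, so the momenta have coefficients
`ϱ g^{αβ}` and do not depend on `Γ` or on the jet coordinates. This is what keeps second derivatives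
out of the field equations. -/
theorem fiberDeriv_eq {u : JCoord} (hu : (mat u.2.1.1).det ≠ 0) (μ : Fin 4) (w : Fiber) :
    fiberDeriv μ u w = ∑ α, ∑ β, dens u.2.1.1 α β *
      ricLin ((EuclideanSpace.proj μ : Base →L[ℝ] ℝ).smulRight w) α β := by
  change fderiv ℝ lagrangian u (dirJ μ w) = _
  rw [fderiv_lagrangian hu, dirJ_apply]
  simp only [Prod.fst_zero, Prod.snd_zero, densDeriv_zero, ricQuadDeriv_zero, Matrix.zero_apply,
    zero_mul, zero_add, add_zero]

/-- The formulas for the momenta hold only where `g` is nondegenerate; openness of that condition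
allows them to be differentiated. -/
theorem eventually_det_ne_zero {u : JCoord} (hu : (mat u.2.1.1).det ≠ 0) :
    ∀ᶠ v in 𝓝 u, (mat v.2.1.1).det ≠ 0 := by
  refine ContinuousAt.eventually_ne (g := fun v : JCoord => (mat v.2.1.1).det) ?_ hu
  refine (contDiffAt_det fun i j => ?_).continuousAt
  simp only [mat_apply]
  exact ContDiff.contDiffAt (by fun_prop)

theorem contDiffAt_fiberDeriv_apply {u : JCoord} (hu : (mat u.2.1.1).det ≠ 0) (μ : Fin 4)
    (w : Fiber) : ContDiffAt ℝ ∞ (fun u => fiberDeriv μ u w) u := by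
  have h : (fun u => fiberDeriv μ u w) =ᶠ[𝓝 u] _ :=
    (eventually_det_ne_zero hu).mono fun v hv => fiberDeriv_eq hv μ w
  refine ContDiffAt.congr_of_eventuallyEq ?_ h
  exact ContDiffAt.sum fun α _ => ContDiffAt.sum fun β _ =>
    (contDiffAt_dens_fiber hu α β).mul contDiffAt_const

theorem fderiv_fiberDeriv_apply {u : JCoord} (hu : (mat u.2.1.1).det ≠ 0) (μ : Fin 4)
    (w : Fiber) (k : JCoord) : fderiv ℝ (fun u => fiberDeriv μ u w) u k =
      ∑ α, ∑ β, densDeriv u.2.1.1 k.2.1.1 α β *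
        ricLin ((EuclideanSpace.proj μ : Base →L[ℝ] ℝ).smulRight w) α β := by
  have h : (fun u => fiberDeriv μ u w) =ᶠ[𝓝 u] _ :=
    (eventually_det_ne_zero hu).mono fun v hv => fiberDeriv_eq hv μ w
  rw [h.fderiv_eq]
  have hd : ∀ α β, DifferentiableAt ℝ (fun u : JCoord => dens u.2.1.1 α β) u := fun α β =>
    (contDiffAt_dens_fiber hu α β).differentiableAt (by simp)
  rw [fderiv_fun_sum fun α _ => DifferentiableAt.fun_sum fun β _ => (hd α β).mul_const _,
    sum_apply]
  refine Finset.sum_congr rfl fun α _ => ?_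
  rw [fderiv_fun_sum fun β _ => (hd α β).mul_const _, sum_apply]
  refine Finset.sum_congr rfl fun β _ => ?_
  rw [fderiv_mul_const (hd α β), smul_apply, fderiv_dens_fiber hu, smul_eq_mul,
    mul_comm]

/-- The jet coordinates are constant along `∂/∂g_{μν}`, so the derivative of the first part of `H`
is exactly the sum subtracted in `c^{μν}`. -/
theorem connectionConstraint_eq {u : JCoord} (hu : (mat u.2.1.1).det ≠ 0) (μ ν : Fin 4) :
    connectionConstraint u μ ν = -fderiv ℝ lagrangian u (dirG μ ν) := by
  have hm : ∀ a b c d, ContDiffAt ℝ ∞ (momentum a b c d) u := fun a b c d =>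
    contDiffAt_fiberDeriv_apply hu d _
  have hJ : ∀ a b c d, ContDiffAt ℝ ∞ (fun u => gamJ u a b c d) u := fun a b c d =>
    ContDiff.contDiffAt (by unfold gamJ; fun_prop)
  have hE : ContDiffAt ℝ ∞ energy u := by
    refine ContDiffAt.sub ?_ (contDiffAt_lagrangian hu)
    exact ContDiffAt.sum fun a _ => ContDiffAt.sum fun b _ => ContDiffAt.sum fun c _ =>
      ContDiffAt.sum fun d _ => (hm a b c d).mul (hJ a b c d)
  have hJ0 : ∀ (t : ℝ) a b c d, gamJ (u + t • dirG μ ν) a b c d = gamJ u a b c d := by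
    intro t a b c d; simp [gamJ, dirG]
  have h2 : HasDerivAt (fun t : ℝ => energy (u + t • dirG μ ν))
      (∑ α, ∑ β, ∑ γ, ∑ σ, fderiv ℝ (momentum α β γ σ) u (dirG μ ν) * gamJ u α β γ σ -
        fderiv ℝ lagrangian u (dirG μ ν)) 0 := by
    simp only [energy, hJ0]
    refine HasDerivAt.sub ?_ (hasDerivAt_line (contDiffAt_lagrangian hu) _)
    exact HasDerivAt.fun_sum fun a _ => HasDerivAt.fun_sum fun b _ => HasDerivAt.fun_sum fun c _ =>
      HasDerivAt.fun_sum fun d _ => (hasDerivAt_line (hm a b c d) _).mul_const _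
  rw [connectionConstraint, (hasDerivAt_line hE (dirG μ ν)).unique h2]
  ring

theorem fderiv_lagrangian_dirG {u : JCoord} (hu : (mat u.2.1.1).det ≠ 0) (μ ν : Fin 4) :
    fderiv ℝ lagrangian u (dirG μ ν) =
      ∑ α, ∑ β, densDeriv u.2.1.1 (Pi.single s(μ, ν) 1) α β * ricci u α β := by
  rw [fderiv_lagrangian hu]
  simp only [dirG, ricLin_zero, ricQuadDeriv_zero, add_zero, mul_zero]

theorem densDeriv_add (g h k : Sym2 (Fin 4) → ℝ) :
    densDeriv g (h + k) = densDeriv g h + densDeriv g k := by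
  have : mat (h + k) = mat h + mat k := rfl
  simp only [densDeriv, this, Matrix.add_mul, Matrix.trace_add, mul_add, add_smul,
    ← smul_add]
  congr 1; abel

theorem densDeriv_smul (g h : Sym2 (Fin 4) → ℝ) (c : ℝ) :
    densDeriv g (c • h) = c • densDeriv g h := by
  have : mat (c • h) = c • mat h := rfl
  simp only [densDeriv, this, Matrix.mul_smul, Matrix.smul_mul, Matrix.trace_smul, smul_eq_mul,
    smul_sub, smul_smul]
  congr 2 <;> ring

theorem densDeriv_symm (g h : Sym2 (Fin 4) → ℝ) (α β : Fin 4) :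
    densDeriv g h α β = densDeriv g h β α := by
  have h1 : ((mat g)⁻¹).transpose = (mat g)⁻¹ := by ext a b; exact mat_inv_symm g b a
  have : (densDeriv g h).transpose = densDeriv g h := by
    simp only [densDeriv, Matrix.transpose_smul, Matrix.transpose_sub, Matrix.transpose_mul, h1,
      mat_transpose, Matrix.mul_assoc]
  exact congrFun (congrFun this.symm α) β

theorem sum_symm_mul_eq_zero {A R : Fin 4 → Fin 4 → ℝ} (hA : ∀ α β, A α β = A β α)
    (hR : ∀ α β, R α β + R β α = 0) : ∑ α, ∑ β, A α β * R α β = 0 := by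
  have h1 : ∑ α, ∑ β, A α β * R α β = ∑ α, ∑ β, A α β * R β α := by
    rw [Finset.sum_comm]
    exact Finset.sum_congr rfl fun α _ => Finset.sum_congr rfl fun β _ => by rw [hA]
  have h2 : ∑ α, ∑ β, A α β * R α β + ∑ α, ∑ β, A α β * R β α = 0 := by
    simp only [← Finset.sum_add_distrib, ← mul_add, hR, mul_zero, Finset.sum_const_zero]
  linarith

/-- The connection constraints are the Einstein equations in vacuum. -/
theorem connectionConstraint_iff {u : JCoord} (hu : (mat u.2.1.1).det ≠ 0) :
    (∀ μ ν, connectionConstraint u μ ν = 0) ↔ ∀ α β, ricci u α β + ricci u β α = 0 := by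
  have hrw : ∀ μ ν, connectionConstraint u μ ν =
      -∑ α, ∑ β, densDeriv u.2.1.1 (Pi.single s(μ, ν) 1) α β * ricci u α β := fun μ ν => by
    rw [connectionConstraint_eq hu, fderiv_lagrangian_dirG hu]
  simp only [hrw, neg_eq_zero]
  refine ⟨fun h => ?_, fun h μ ν => sum_symm_mul_eq_zero (densDeriv_symm _ _) h⟩
  set g := u.2.1.1
  set R : Matrix (Fin 4) (Fin 4) ℝ := Matrix.of (ricci u) with hR
  let φ : (Sym2 (Fin 4) → ℝ) →ₗ[ℝ] ℝ :=
    { toFun := fun k => ∑ α, ∑ β, densDeriv g k α β * ricci u α β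
      map_add' := fun k l => by
        simp only [densDeriv_add, Matrix.add_apply, add_mul, Finset.sum_add_distrib]
      map_smul' := fun c k => by
        simp only [densDeriv_smul, Matrix.smul_apply, smul_eq_mul, mul_assoc, ← Finset.mul_sum,
          RingHom.id_apply] }
  have hφ : φ = 0 := by
    refine LinearMap.pi_ext' fun p => LinearMap.ext_ring ?_
    induction p with
    | h μ ν => exact h μ ν
  have hun := isUnit_iff_ne_zero.2 hu
  have hρ : √|(mat g).det| ≠ 0 := (Real.sqrt_pos.2 (abs_pos.2 hu)).ne'
  set r := ∑ α, ∑ β, (mat g)⁻¹ α β * R α β with hr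
  -- The functional `φ` is tested on the symmetric `k = g B g`, with `B` the sum of the matrix units
  -- at `(a, b)` and `(b, a)`. Then `g⁻¹ k g⁻¹ = B` isolates `R a b + R b a`, and the trace term of
  -- the density derivative gives `r g_{ab}`.
  have key : ∀ a b, R a b + R b a = r * mat g a b := by
    intro a b
    let B : Matrix (Fin 4) (Fin 4) ℝ := Matrix.of fun α β =>
      (if α = a ∧ β = b then 1 else 0) + (if β = a ∧ α = b then 1 else 0)
    have hBs : B.transpose = B := by ext α β; simp [B, add_comm]
    have hBsum : ∀ X : Matrix (Fin 4) (Fin 4) ℝ, ∑ α, ∑ β, B α β * X α β = X a b + X b a := by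
      intro X
      simp [B, add_mul, Finset.sum_add_distrib, ite_and]
    have hs : (mat g * B * mat g).transpose = mat g * B * mat g := by
      rw [Matrix.transpose_mul, Matrix.transpose_mul, mat_transpose, hBs, Matrix.mul_assoc]
    let k : Sym2 (Fin 4) → ℝ := Sym2.lift ⟨fun α β => (mat g * B * mat g) α β,
      fun α β => congrFun (congrFun hs.symm α) β⟩
    have hk : mat k = mat g * B * mat g := rfl
    have h1 : (mat g)⁻¹ * mat k * (mat g)⁻¹ = B := by
      rw [hk, Matrix.mul_assoc (mat g), Matrix.nonsing_inv_mul_cancel_left _ _ hun,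
        Matrix.mul_nonsing_inv_cancel_right _ _ hun]
    have h2 : ((mat g)⁻¹ * mat k).trace = 2 * mat g a b := by
      rw [hk, Matrix.mul_assoc (mat g), Matrix.nonsing_inv_mul_cancel_left _ _ hun]
      have : (B * mat g).trace = ∑ α, ∑ β, B α β * mat g α β := by
        simp only [Matrix.trace, Matrix.diag, Matrix.mul_apply]
        exact Finset.sum_congr rfl fun α _ => Finset.sum_congr rfl fun β _ =>
          congrArg _ (congrFun (congrFun (mat_transpose g) α) β)
      rw [this, hBsum, show mat g b a = mat g a b from congrFun (congrFun (mat_transpose g) a) b]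
      ring
    have h3 : φ k = 0 := by rw [hφ]; rfl
    have h4 : φ k = √|(mat g).det| * (mat g a b * r - (R a b + R b a)) := by
      change ∑ α, ∑ β, densDeriv g k α β * R α β = _
      rw [← hBsum, hr, mul_sub, Finset.mul_sum, Finset.mul_sum, Finset.mul_sum,
        ← Finset.sum_sub_distrib]
      refine Finset.sum_congr rfl fun α _ => ?_
      rw [Finset.mul_sum, Finset.mul_sum, Finset.mul_sum, ← Finset.sum_sub_distrib]
      refine Finset.sum_congr rfl fun β _ => ?_
      rw [densDeriv, h1, h2]
      simp only [Matrix.smul_apply, Matrix.sub_apply, smul_eq_mul]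
      ring
    rw [h4] at h3
    have := (mul_eq_zero.1 h3).resolve_left hρ
    linarith
  -- Contracting `key` with `g⁻¹` gives `2 r = 4 r`.
  have hr0 : r = 0 := by
    have h1 : ∑ α, ∑ β, (mat g)⁻¹ α β * (R α β + R β α) = 2 * r := by
      simp only [mul_add, Finset.sum_add_distrib, ← hr]
      have : ∑ α, ∑ β, (mat g)⁻¹ α β * R β α = r := by
        rw [Finset.sum_comm, hr]
        exact Finset.sum_congr rfl fun α _ => Finset.sum_congr rfl fun β _ => by
          rw [mat_inv_symm]
      rw [this]; ring
    have h2 : ∑ α, ∑ β, (mat g)⁻¹ α β * mat g α β = 4 := by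
      have : ∑ α, ∑ β, (mat g)⁻¹ α β * mat g α β = ((mat g)⁻¹ * mat g).trace := by
        simp only [Matrix.trace, Matrix.diag, Matrix.mul_apply]
        exact Finset.sum_congr rfl fun α _ => Finset.sum_congr rfl fun β _ =>
          congrArg _ (congrFun (congrFun (mat_transpose g) β) α)
      rw [this, Matrix.nonsing_inv_mul _ hun]; simp
    have h3 : ∑ α, ∑ β, (mat g)⁻¹ α β * (R α β + R β α) = 4 * r := by
      simp only [key, mul_left_comm _ r, ← Finset.mul_sum, h2]; ring
    linarith
  intro α β
  have := key α β
  rw [hr0, zero_mul] at this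
  exact this

end Lagrangian

/-! ### The Palatini equations from premetricity and pure-trace torsion. -/

section Palatini

/-- Here `h` stands for `∂_μ g`, `N` for the matrix `Γ^l_{μρ}` and `a` for a third of the torsion
trace. In dimension four the scalar coefficient is `½(2 tr N + 8a) − 2a = tr N + 2a`. -/
theorem densDeriv_of_premetricity {g h : Sym2 (Fin 4) → ℝ} (hg : (mat g).det ≠ 0)
    {N : Matrix (Fin 4) (Fin 4) ℝ} {a : ℝ}
    (hh : mat h = mat g * N + N.transpose * mat g + (2 * a) • mat g) (α β : Fin 4) :
    densDeriv g h α β = dens g α β * (N.trace + 2 * a) - ∑ l, dens g β l * N α l -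
      ∑ l, dens g α l * N β l := by
  have hun := isUnit_iff_ne_zero.2 hg
  have h1 : (mat g)⁻¹ * mat h = N + (mat g)⁻¹ * N.transpose * mat g + (2 * a) • 1 := by
    rw [hh, Matrix.mul_add, Matrix.mul_add, Matrix.nonsing_inv_mul_cancel_left _ _ hun,
      Matrix.mul_smul, Matrix.nonsing_inv_mul _ hun, Matrix.mul_assoc]
  have h2 : ((mat g)⁻¹ * mat h).trace = 2 * N.trace + 8 * a := by
    rw [h1, Matrix.trace_add, Matrix.trace_add, Matrix.trace_mul_comm,
      Matrix.mul_nonsing_inv_cancel_left _ _ hun, Matrix.trace_transpose, Matrix.trace_smul,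
      Matrix.trace_one]
    norm_num; ring
  have h3 : (mat g)⁻¹ * mat h * (mat g)⁻¹ = N * (mat g)⁻¹ + (mat g)⁻¹ * N.transpose +
      (2 * a) • (mat g)⁻¹ := by
    rw [h1, Matrix.add_mul, Matrix.add_mul, Matrix.mul_nonsing_inv_cancel_right _ _ hun,
      Matrix.smul_mul, Matrix.one_mul]
  have h4 : ∑ l, dens g β l * N α l = √|(mat g).det| * (N * (mat g)⁻¹) α β := by
    rw [Matrix.mul_apply, Finset.mul_sum]
    refine Finset.sum_congr rfl fun l _ => ?_
    rw [dens_symm, dens, Matrix.smul_apply, smul_eq_mul]; ring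
  have h5 : ∑ l, dens g α l * N β l = √|(mat g).det| * ((mat g)⁻¹ * N.transpose) α β := by
    rw [Matrix.mul_apply, Finset.mul_sum]
    refine Finset.sum_congr rfl fun l _ => ?_
    rw [Matrix.transpose_apply, dens, Matrix.smul_apply, smul_eq_mul]; ring
  rw [h4, h5, densDeriv, h2, h3]
  simp only [dens, Matrix.smul_apply, Matrix.sub_apply, Matrix.add_apply, smul_eq_mul]
  ring

theorem sum_comm_outer_inner (f : Fin 4 → Fin 4 → Fin 4 → Fin 4 → ℝ) :
    ∑ a, ∑ b, ∑ c, ∑ d, f a b c d = ∑ d, ∑ b, ∑ c, ∑ a, f a b c d := by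
  have h : ∀ F : Fin 4 → Fin 4 → Fin 4 → ℝ,
      ∑ b, ∑ c, ∑ d, F b c d = ∑ d, ∑ b, ∑ c, F b c d := fun F => by
    rw [Finset.sum_congr rfl fun b _ => Finset.sum_comm, Finset.sum_comm]
  rw [Finset.sum_congr rfl fun a _ => h (f a), Finset.sum_comm]
  refine Finset.sum_congr rfl fun d _ => ?_
  exact (h fun b c a => f a b c d).symm

theorem sum_rotate (f : Fin 4 → Fin 4 → Fin 4 → ℝ) :
    ∑ a, ∑ b, ∑ c, f a b c = ∑ b, ∑ c, ∑ a, f a b c := by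
  rw [Finset.sum_comm]
  exact Finset.sum_congr rfl fun b _ => Finset.sum_comm

theorem ricLin_smulRight (ν : Fin 4) (w : Fiber) (α β : Fin 4) :
    ricLin ((EuclideanSpace.proj ν : Base →L[ℝ] ℝ).smulRight w) α β =
      w.2 ν β α - delta ν β * ∑ γ, w.2 γ γ α := by
  simp only [ricLin, ContinuousLinearMap.smulRight_apply, Finset.sum_sub_distrib, Prod.smul_snd,
    Pi.smul_apply, smul_eq_mul, ← Finset.mul_sum]
  simp [bvec, delta]

/-- The algebraic form of the Palatini equations: the metric density `P` is parallel, in the sense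
expressed by `hD`, for a connection `Γ` whose torsion is pure trace. -/
theorem palatini_identity {P : Fin 4 → Fin 4 → ℝ} (hP : ∀ α β, P α β = P β α)
    {Γ k : Fin 4 → Fin 4 → Fin 4 → ℝ} {a : Fin 4 → ℝ}
    (hT : ∀ l μ ν, Γ l μ ν = Γ l ν μ + delta l μ * a ν - delta l ν * a μ)
    {D : Fin 4 → Fin 4 → Fin 4 → ℝ}
    (hD : ∀ μ α β, D μ α β = P α β * (∑ l, Γ l μ l + 2 * a μ) - ∑ l, P β l * Γ α μ l -
      ∑ l, P α l * Γ β μ l) :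
    ∑ α, ∑ β, P α β * ricQuadDeriv Γ k α β =
      ∑ ν, ∑ α, ∑ β, D ν α β * (k ν β α - delta ν β * ∑ γ, k γ γ α) := by
  set W : Fin 4 → ℝ := fun α => ∑ l, P α l * a l with hW
  set Q : Fin 4 → ℝ := fun γ => ∑ α, ∑ β, P α β * Γ γ β α with hQ
  -- The two traces of the connection differ by the torsion trace; the factor 3 is `4 − 1`.
  have htr : ∀ μ, ∑ l, Γ l l μ = ∑ l, Γ l μ l + 3 * a μ := by
    intro μ
    rw [Finset.sum_congr rfl fun l _ => hT l l μ, Finset.sum_sub_distrib, Finset.sum_add_distrib]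
    simp [delta]; ring
  -- The divergence of the density is needed for the term with `delta ν β`. The connection traces
  -- cancel, and `2W − 3W − Q` is left.
  have hdiv : ∀ α, ∑ β, D β α β = -(W α + Q α) := by
    intro α
    have e1 : ∑ β, ∑ l, P β l * Γ α β l = Q α := by
      rw [Finset.sum_comm]
      exact Finset.sum_congr rfl fun β _ => Finset.sum_congr rfl fun l _ => by rw [hP]
    have e2 : ∑ β, ∑ l, P α l * Γ β β l = ∑ l, P α l * (∑ b, Γ b l b) + 3 * W α := by
      rw [Finset.sum_comm, hW, Finset.mul_sum, ← Finset.sum_add_distrib]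
      refine Finset.sum_congr rfl fun l _ => ?_
      rw [← Finset.mul_sum, htr]; ring
    have e3 : ∑ β, P α β * (∑ l, Γ l β l + 2 * a β) =
        ∑ l, P α l * (∑ b, Γ b l b) + 2 * W α := by
      rw [hW, Finset.mul_sum, ← Finset.sum_add_distrib]
      exact Finset.sum_congr rfl fun l _ => by ring
    rw [Finset.sum_congr rfl fun β _ => hD β α β, Finset.sum_sub_distrib, Finset.sum_sub_distrib,
      e1, e2, e3]
    ring
  -- `t1` to `t4` rewrite the four terms of the varied quadratic part so that `k γ β α`, or its
  -- trace `k γ γ α` in `t2`, appears as a factor; coefficients can then be compared.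
  have t1 : ∑ α, ∑ β, ∑ γ, ∑ σ, P α β * (k γ β α * Γ σ σ γ) =
      ∑ α, ∑ β, ∑ γ, k γ β α * (P α β * (∑ l, Γ l γ l + 3 * a γ)) := by
    refine Finset.sum_congr rfl fun α _ => Finset.sum_congr rfl fun β _ =>
      Finset.sum_congr rfl fun γ _ => ?_
    rw [← htr, Finset.mul_sum, Finset.mul_sum]
    exact Finset.sum_congr rfl fun σ _ => by ring
  have t2 : ∑ α, ∑ β, ∑ γ, ∑ σ, P α β * (Γ γ β α * k σ σ γ) =
      ∑ α, ∑ γ, k γ γ α * Q α := by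
    have e : ∀ γ, ∑ α, ∑ β, ∑ σ, P α β * (Γ γ β α * k σ σ γ) = ∑ σ, k σ σ γ * Q γ := by
      intro γ
      rw [← Finset.sum_mul, hQ, Finset.mul_sum]
      refine Finset.sum_congr rfl fun α _ => ?_
      rw [Finset.mul_sum]
      refine Finset.sum_congr rfl fun β _ => ?_
      rw [Finset.sum_mul]
      exact Finset.sum_congr rfl fun σ _ => by ring
    exact (sum_rotate fun γ α β => ∑ σ, P α β * (Γ γ β α * k σ σ γ)).symm.trans
      (Finset.sum_congr rfl fun γ _ => e γ)
  have t3 : ∑ α, ∑ β, ∑ γ, ∑ σ, P α β * (k γ β σ * Γ σ γ α) =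
      ∑ α, ∑ β, ∑ γ, k γ β α * ∑ l, P β l * Γ α γ l := by
    rw [sum_comm_outer_inner]
    refine Finset.sum_congr rfl fun α _ => Finset.sum_congr rfl fun β _ =>
      Finset.sum_congr rfl fun γ _ => ?_
    rw [Finset.mul_sum]
    exact Finset.sum_congr rfl fun l _ => by rw [hP β l]; ring
  -- Only this term carries `Γ` with its lower indices in the wrong order; exchanging them by `hT`
  -- produces `P α β * a γ` and the trace correction `W`.
  have t4 : ∑ α, ∑ β, ∑ γ, ∑ σ, P α β * (Γ γ β σ * k σ γ α) =
      ∑ α, ∑ β, ∑ γ, k γ β α * (∑ l, P α l * Γ β γ l + P α β * a γ - delta β γ * W α) := by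
    refine Finset.sum_congr rfl fun α _ => ?_
    rw [sum_rotate]
    refine Finset.sum_congr rfl fun β _ => Finset.sum_congr rfl fun γ _ => ?_
    have e : ∑ l, P α l * Γ β l γ =
        ∑ l, P α l * Γ β γ l + P α β * a γ - delta β γ * W α := by
      have e1 : ∀ l, P α l * Γ β l γ = P α l * Γ β γ l + P α l * (delta β l * a γ) -
          delta β γ * (P α l * a l) := fun l => by rw [hT β l γ]; ring
      rw [Finset.sum_congr rfl fun l _ => e1 l, Finset.sum_sub_distrib, Finset.sum_add_distrib,
        ← Finset.mul_sum]
      simp [delta, hW]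
    rw [← e, Finset.mul_sum]
    exact Finset.sum_congr rfl fun l _ => by ring
  have tδ : ∑ α, ∑ β, ∑ γ, k γ β α * (delta β γ * W α) = ∑ α, ∑ γ, k γ γ α * W α := by
    simp [delta]
  have rhs : ∑ ν, ∑ α, ∑ β, D ν α β * (k ν β α - delta ν β * ∑ γ, k γ γ α) =
      ∑ α, ∑ β, ∑ γ, k γ β α * D γ α β + ∑ α, ∑ γ, k γ γ α * (W α + Q α) := by
    rw [sum_rotate (fun ν α β => D ν α β * (k ν β α - delta ν β * ∑ γ, k γ γ α)),
      ← Finset.sum_add_distrib]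
    refine Finset.sum_congr rfl fun α _ => ?_
    rw [← Finset.sum_mul]
    have : W α + Q α = -∑ β, D β α β := by rw [hdiv]; ring
    rw [this, mul_neg, Finset.mul_sum, ← sub_eq_add_neg, ← Finset.sum_sub_distrib]
    refine Finset.sum_congr rfl fun β _ => ?_
    simp only [mul_sub, Finset.sum_sub_distrib]
    congr 1
    · exact Finset.sum_congr rfl fun γ _ => by ring
    · simp [delta, mul_comm]
  have lhs : ∑ α, ∑ β, P α β * ricQuadDeriv Γ k α β =
      ∑ α, ∑ β, ∑ γ, ∑ σ, P α β * (k γ β α * Γ σ σ γ) +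
      ∑ α, ∑ β, ∑ γ, ∑ σ, P α β * (Γ γ β α * k σ σ γ) -
      ∑ α, ∑ β, ∑ γ, ∑ σ, P α β * (k γ β σ * Γ σ γ α) -
      ∑ α, ∑ β, ∑ γ, ∑ σ, P α β * (Γ γ β σ * k σ γ α) := by
    simp only [ricQuadDeriv, Finset.mul_sum, mul_add, mul_sub, Finset.sum_add_distrib,
      Finset.sum_sub_distrib]
    ring
  rw [lhs, t1, t2, t3, t4, rhs]
  -- The coefficient `3a` from `t1` minus the `a` from `t4` gives the `2a` of `hD`; the `delta`
  -- terms cancel.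
  have hDs : ∑ α, ∑ β, ∑ γ, k γ β α * D γ α β =
      ∑ α, ∑ β, ∑ γ, k γ β α * (P α β * (∑ l, Γ l γ l + 3 * a γ)) -
      ∑ α, ∑ β, ∑ γ, k γ β α * ∑ l, P β l * Γ α γ l -
      ∑ α, ∑ β, ∑ γ, k γ β α * (∑ l, P α l * Γ β γ l + P α β * a γ - delta β γ * W α) -
      ∑ α, ∑ β, ∑ γ, k γ β α * (delta β γ * W α) := by
    simp only [← Finset.sum_sub_distrib]
    refine Finset.sum_congr rfl fun α _ => Finset.sum_congr rfl fun β _ =>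
      Finset.sum_congr rfl fun γ _ => ?_
    rw [hD]; ring
  rw [hDs, tδ]
  simp only [mul_add, Finset.sum_add_distrib]
  ring

theorem torsion_of_constraint {u : JCoord} (h : ∀ α β γ, torsionConstraint u α β γ = 0)
    (l μ ν : Fin 4) : gamC u l μ ν = gamC u l ν μ + delta l μ * (1 / 3 * ∑ σ, torsion u σ σ ν) -
      delta l ν * (1 / 3 * ∑ σ, torsion u σ σ μ) := by
  have := h l μ ν
  rw [torsionConstraint, torsion] at this
  linarith

theorem densDeriv_of_constraint {u : JCoord} (hu : (mat u.2.1.1).det ≠ 0)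
    (h : ∀ ρ σ μ, premetricityConstraint u ρ σ μ = 0) (μ α β : Fin 4) :
    densDeriv u.2.1.1 (u.2.2 (bvec μ)).1 α β =
      dens u.2.1.1 α β * (∑ l, gamC u l μ l + 2 * (1 / 3 * ∑ σ, torsion u σ σ μ)) -
      ∑ l, dens u.2.1.1 β l * gamC u α μ l - ∑ l, dens u.2.1.1 α l * gamC u β μ l := by
  refine densDeriv_of_premetricity (N := Matrix.of fun l ρ => gamC u l μ ρ) hu ?_ α β
  ext ρ σ
  have := h ρ σ μ
  rw [premetricityConstraint] at this
  simp only [Matrix.add_apply, Matrix.mul_apply, Matrix.smul_apply, Matrix.transpose_apply,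
    Matrix.of_apply, smul_eq_mul]
  have e1 : ∑ l, gamC u l μ ρ * mat u.2.1.1 l σ = ∑ l, gC u σ l * gamC u l μ ρ :=
    Finset.sum_congr rfl fun l _ => by
      rw [mul_comm]; exact congrArg (· * _) (congrFun (congrFun (mat_transpose u.2.1.1) l) σ).symm
  rw [e1]
  change gJ u ρ σ μ = ∑ l, gC u ρ l * gamC u l μ σ + _ + _ * gC u ρ σ
  linarith

/-- The Euler–Lagrange equations hold on the constraint set, whatever the second derivatives. -/
theorem eulerLagrange {u : JCoord} (hu : (mat u.2.1.1).det ≠ 0) (h : u ∈ constraintSet)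
    {X : Fin 4 → JCoord} (hX : ∀ ν, (X ν).2.1 = u.2.2 (bvec ν)) (k : Fiber) :
    fderiv ℝ lagrangian u (0, k, 0) = ∑ ν, fderiv ℝ (fun u => fiberDeriv ν u k) u (X ν) := by
  obtain ⟨hc, hm, ht, -⟩ := h
  simp only [fderiv_fiberDeriv_apply hu, fderiv_lagrangian hu, hX, ricLin_zero, zero_add,
    Finset.sum_add_distrib, ricLin_smulRight]
  -- The variation of `g` pairs a symmetric matrix with a Ricci tensor whose symmetric part
  -- vanishes. What remains is the equation for `Γ`.
  rw [sum_symm_mul_eq_zero (densDeriv_symm _ _) ((connectionConstraint_iff hu).1 hc), zero_add]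
  exact palatini_identity (dens_symm _) (torsion_of_constraint ht)
    (densDeriv_of_constraint hu hm)

end Palatini

/-! ### The Poincaré–Cartan form on semiholonomic 4-vectors. -/

section FieldEquation

theorem wedge_apply (a : Fin 4 → (JCoord →L[ℝ] ℝ)) (v : Fin 4 → JCoord) :
    wedge a v = (Matrix.of fun i j => a j (v i)).det := rfl

theorem wedge_eq_zero {a : Fin 4 → (JCoord →L[ℝ] ℝ)} {v : Fin 4 → JCoord} {j : Fin 4}
    (h : ∀ i, a j (v i) = 0) : wedge a v = 0 :=
  Matrix.det_eq_zero_of_column_eq_zero j h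

/-- The matrix of values is the identity with column `μ` replaced, so Cramer's rule for the identity
reads off the entry at `μ`. -/
theorem wedge_update {a : Fin 4 → (JCoord →L[ℝ] ℝ)} {v : Fin 4 → JCoord} (μ : Fin 4)
    (l : JCoord →L[ℝ] ℝ) (h : ∀ i j, j ≠ μ → a j (v i) = (1 : Matrix (Fin 4) (Fin 4) ℝ) i j) :
    wedge (Function.update a μ l) v = l (v μ) := by
  have : (Matrix.of fun i j => Function.update a μ l j (v i)) =
      (1 : Matrix (Fin 4) (Fin 4) ℝ).updateCol μ fun i => l (v i) := by
    ext i j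
    rcases eq_or_ne j μ with rfl | hj
    · simp
    · simp [hj, h i j hj]
  rw [wedge_apply, this, ← Matrix.cramer_apply, Matrix.cramer_one]
  rfl

theorem dx_apply (μ : Fin 4) (v : JCoord) : dx μ v = v.1 μ := rfl

theorem contactForm_apply (u v : JCoord) : contactForm u v = v.2.1 - u.2.2 v.1 := rfl

section Abstract

variable {E : Type*} [NormedAddCommGroup E] [NormedSpace ℝ E]

/-- The form `a_0 ∧ a_1 ∧ a_2 ∧ a_3` on a normed space. -/
noncomputable def wedgeForm (a : Fin 4 → (E →L[ℝ] ℝ)) : E [⋀^Fin 4]→L[ℝ] ℝ :=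
  detForm.compContinuousLinearMap (ContinuousLinearMap.pi a)

theorem of_update_eq_updateCol (a : Fin 4 → (E →L[ℝ] ℝ)) (μ : Fin 4) (l : E →L[ℝ] ℝ)
    (v : Fin 4 → E) : (Matrix.of fun i j => Function.update a μ l j (v i)) =
      (Matrix.of fun i j => a j (v i)).updateCol μ fun i => l (v i) := by
  ext i j
  rcases eq_or_ne j μ with rfl | hj <;> simp [*]

/-- `wedgeForm` as a linear function of one of its factors. -/
noncomputable def wedgeUpdate (a : Fin 4 → (E →L[ℝ] ℝ)) (μ : Fin 4) :
    (E →L[ℝ] ℝ) →ₗ[ℝ] E [⋀^Fin 4]→L[ℝ] ℝ where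
  toFun l := wedgeForm (Function.update a μ l)
  map_add' l m := by
    ext v
    change (Matrix.of fun i j => Function.update a μ (l + m) j (v i)).det =
      (Matrix.of fun i j => Function.update a μ l j (v i)).det +
      (Matrix.of fun i j => Function.update a μ m j (v i)).det
    simp only [of_update_eq_updateCol]
    exact Matrix.det_updateCol_add _ _ _ _
  map_smul' c l := by
    ext v
    change (Matrix.of fun i j => Function.update a μ (c • l) j (v i)).det =
      c * (Matrix.of fun i j => Function.update a μ l j (v i)).det
    simp only [of_update_eq_updateCol]
    exact Matrix.det_updateCol_smul _ _ _ _

/-- The wedge is linear in the factor that varies, and finite dimension makes this linear map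
continuous, so the derivative passes to that factor. -/
theorem fderiv_sum_wedge_add_smul [FiniteDimensional ℝ E] (a : Fin 4 → (E →L[ℝ] ℝ))
    {l : Fin 4 → E → (E →L[ℝ] ℝ)} {L : E → ℝ} {u : E} (hl : ∀ μ, DifferentiableAt ℝ (l μ) u)
    (hL : DifferentiableAt ℝ L u) (k : E) (v : Fin 4 → E) :
    fderiv ℝ (fun u => ∑ μ, wedgeForm (Function.update a μ (l μ u)) + L u • wedgeForm a) u k v =
      ∑ μ, wedgeForm (Function.update a μ (fderiv ℝ (l μ) u k)) v +
        fderiv ℝ L u k * wedgeForm a v := by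
  have h1 : ∀ μ, HasFDerivAt (fun u => wedgeForm (Function.update a μ (l μ u)))
      ((LinearMap.toContinuousLinearMap (wedgeUpdate a μ)).comp (fderiv ℝ (l μ) u)) u := fun μ =>
    (LinearMap.toContinuousLinearMap (wedgeUpdate a μ)).hasFDerivAt.comp u (hl μ).hasFDerivAt
  have h2 := (HasFDerivAt.fun_sum (u := Finset.univ) fun μ _ => h1 μ).fun_add
    (hL.hasFDerivAt.smul_const (wedgeForm a))
  rw [HasFDerivAt.fderiv h2, add_apply, ContinuousAlternatingMap.add_apply, sum_apply,
    ContinuousAlternatingMap.sum_apply]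
  rfl

end Abstract

theorem contDiffAt_fiberDeriv {u : JCoord} (hu : (mat u.2.1.1).det ≠ 0) (μ : Fin 4) :
    ContDiffAt ℝ ∞ (fiberDeriv μ) u :=
  ((contDiffAt_lagrangian hu).fderiv_right (m := ∞) (by simp)).clm_comp contDiffAt_const

theorem contDiff_contactForm : ContDiff ℝ ∞ contactForm := by
  unfold contactForm
  exact contDiff_const.sub ((contDiff_snd.comp contDiff_snd).clm_comp contDiff_const)

theorem fderiv_eval {E F G : Type*} [NormedAddCommGroup E] [NormedSpace ℝ E]
    [NormedAddCommGroup F] [NormedSpace ℝ F] [NormedAddCommGroup G] [NormedSpace ℝ G]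
    {f : E → F →L[ℝ] G} {u : E} (hf : DifferentiableAt ℝ f u) (x : F) (k : E) :
    fderiv ℝ (fun u => f u x) u k = fderiv ℝ f u k x := by
  rw [(hf.hasFDerivAt.clm_apply (hasFDerivAt_const x u)).fderiv]
  simp

theorem fderiv_comp_apply {E F G H : Type*} [NormedAddCommGroup E] [NormedSpace ℝ E]
    [NormedAddCommGroup F] [NormedSpace ℝ F] [NormedAddCommGroup G] [NormedSpace ℝ G]
    [NormedAddCommGroup H] [NormedSpace ℝ H]
    {f : E → G →L[ℝ] H} {c : E → F →L[ℝ] G} {u : E} (hf : DifferentiableAt ℝ f u)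
    (hc : DifferentiableAt ℝ c u) (k : E) (v : F) :
    fderiv ℝ (fun u => (f u).comp (c u)) u k v =
      fderiv ℝ f u k (c u v) + f u (fderiv ℝ (fun u => c u v) u k) := by
  rw [(hf.hasFDerivAt.clm_comp hc.hasFDerivAt).fderiv, fderiv_eval hc]
  simp [add_comm]

theorem fderiv_contactForm_apply (u k v : JCoord) :
    fderiv ℝ (fun u => contactForm u v) u k = -(k.2.2 v.1) := by
  have h1 : ContDiffAt ℝ ∞ (fun u => contactForm u v) u :=
    contDiff_contactForm.contDiffAt.clm_apply contDiffAt_const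
  refine (hasDerivAt_line h1 k).unique ?_
  have : (fun t : ℝ => contactForm (u + t • k) v) =
      fun t => contactForm u v + t • (-(k.2.2 v.1)) := by
    ext1 t
    simp only [contactForm_apply, Prod.snd_add, Prod.smul_snd, add_apply, smul_apply, smul_neg]
    abel
  rw [this]
  simpa using ((hasDerivAt_id (0 : ℝ)).smul_const (-(k.2.2 v.1))).const_add (contactForm u v)

/-- The derivative of the one-forms `(∂L/∂y^a_μ) θ^a`. -/
theorem fderiv_fiberDeriv_contact {u : JCoord} (hu : (mat u.2.1.1).det ≠ 0) (μ : Fin 4)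
    (k v : JCoord) :
    fderiv ℝ (fun u => (fiberDeriv μ u).comp (contactForm u)) u k v =
      fderiv ℝ (fun u' => fiberDeriv μ u' (contactForm u v)) u k -
        fiberDeriv μ u (k.2.2 v.1) := by
  have h1 : DifferentiableAt ℝ (fiberDeriv μ) u :=
    (contDiffAt_fiberDeriv hu μ).differentiableAt (by simp)
  have h2 : DifferentiableAt ℝ contactForm u :=
    contDiff_contactForm.contDiffAt.differentiableAt (by simp)
  rw [fderiv_comp_apply h1 h2, fderiv_eval h1, fderiv_contactForm_apply, map_neg, sub_eq_add_neg]

theorem differentiableAt_fiberDeriv_contact {u : JCoord} (hu : (mat u.2.1.1).det ≠ 0) (μ : Fin 4) :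
    DifferentiableAt ℝ (fun u => (fiberDeriv μ u).comp (contactForm u)) u :=
  ((contDiffAt_fiberDeriv hu μ).clm_comp contDiff_contactForm.contDiffAt).differentiableAt (by simp)

theorem fderiv_potential {u : JCoord} (hu : (mat u.2.1.1).det ≠ 0) (k : JCoord)
    (v : Fin 4 → JCoord) :
    fderiv ℝ poincareCartanPotential u k v =
      ∑ μ, wedge (Function.update dx μ
        (fderiv ℝ (fun u => (fiberDeriv μ u).comp (contactForm u)) u k)) v +
      fderiv ℝ lagrangian u k * wedge dx v :=
  fderiv_sum_wedge_add_smul dx (l := fun μ u => (fiberDeriv μ u).comp (contactForm u))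
    (L := lagrangian) (differentiableAt_fiberDeriv_contact hu)
    ((contDiffAt_lagrangian hu).differentiableAt (by simp)) k v

theorem sum_dirJ (l : Base →L[ℝ] Fiber) : ∑ μ, dirJ μ (l (bvec μ)) = (0, 0, l) := by
  simp only [dirJ_apply]
  refine Prod.ext (by simp [Prod.fst_sum]) (Prod.ext (by simp [Prod.fst_sum, Prod.snd_sum]) ?_)
  ext1 v
  simp only [Prod.snd_sum, sum_apply]
  conv_rhs => rw [base_sum v]
  simp

/-- The exterior derivative of the Poincaré–Cartan form, evaluated on a holonomic frame and a
vertical vector: the Euler–Lagrange expression. -/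
theorem extDeriv_potential_vertical {u : JCoord} (hu : (mat u.2.1.1).det ≠ 0)
    {X : Fin 4 → JCoord} (hX0 : ∀ ν, (X ν).1 = bvec ν)
    (hX : ∀ ν, (X ν).2.1 = u.2.2 (bvec ν)) (w : JCoord) (hw : w.1 = 0) :
    extDeriv poincareCartanPotential u (Fin.cons w X) =
      fderiv ℝ lagrangian u (0, w.2.1, 0) -
        ∑ ν, fderiv ℝ (fun u => fiberDeriv ν u w.2.1) u (X ν) := by
  have hdX : ∀ i j, dx j (X i) = (1 : Matrix (Fin 4) (Fin 4) ℝ) i j := fun i j => by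
    rw [dx_apply, hX0, Matrix.one_apply, bvec]
    simp [eq_comm]
  have hdw : ∀ j, dx j w = 0 := fun j => by rw [dx_apply, hw]; rfl
  have hcX : ∀ ν, contactForm u (X ν) = 0 := fun ν => by
    rw [contactForm_apply, hX0, hX, sub_self]
  have hcw : contactForm u w = w.2.1 := by rw [contactForm_apply, hw]; simp
  rw [extDeriv, ContinuousAlternatingMap.alternatizeUncurryFin_apply, Fin.sum_univ_succ]
  -- Contact forms vanish on the frame, so only their own derivative contributes. This removes the
  -- jet component of `w` from `dL(w)`.
  have h0 : fderiv ℝ poincareCartanPotential u w X = fderiv ℝ lagrangian u (0, w.2.1, 0) := by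
    rw [fderiv_potential hu, wedge_apply dx]
    have e1 : (Matrix.of fun i j => dx j (X i)) = 1 := by ext i j; exact hdX i j
    rw [e1, Matrix.det_one, mul_one]
    have e2 : ∀ μ, wedge (Function.update dx μ
        (fderiv ℝ (fun u => (fiberDeriv μ u).comp (contactForm u)) u w)) X =
        -fderiv ℝ lagrangian u (dirJ μ (w.2.2 (bvec μ))) := fun μ => by
      rw [wedge_update μ _ fun i j _ => hdX i j, fderiv_fiberDeriv_contact hu, hcX, hX0]
      simp only [map_zero, fderiv_fun_const, Pi.zero_apply, zero_apply, zero_sub]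
      rfl
    rw [Finset.sum_congr rfl fun μ _ => e2 μ, Finset.sum_neg_distrib, ← map_sum, sum_dirJ]
    have e3 : w = (0, w.2.1, 0) + (0, 0, w.2.2) := by
      refine Prod.ext (by simp [hw]) (Prod.ext (by simp) (by simp))
    conv_lhs => rw [e3]
    rw [map_add]
    simp
  have h1 : ∀ i : Fin 4, (-1 : ℤ) ^ (i.succ : ℕ) • fderiv ℝ poincareCartanPotential u
      ((Fin.cons w X : Fin 5 → JCoord) i.succ)
      (i.succ.removeNth (Fin.cons w X : Fin 5 → JCoord)) =
      -fderiv ℝ (fun u => fiberDeriv i u w.2.1) u (X i) := by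
    intro i
    have e1 : i.succ.removeNth (Fin.cons w X : Fin 5 → JCoord) =
        Matrix.vecCons w (i.removeNth X) := by
      ext1 j
      refine Fin.cases rfl (fun j => ?_) j
      simp [Fin.removeNth]
    -- Moving `w` from the front to slot `i` costs `(-1)^i`; together with the sign `(-1)^(i+1)` of
    -- the exterior derivative each term carries a minus sign.
    have e2 : fderiv ℝ poincareCartanPotential u (X i) (Function.update X i w) =
        (-1) ^ (i : ℕ) • fderiv ℝ poincareCartanPotential u (X i)
          (Matrix.vecCons w (i.removeNth X)) := by
      rw [← ContinuousAlternatingMap.map_insertNth, Fin.insertNth_removeNth]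
    rw [e1, Fin.cons_succ, Fin.val_succ, pow_succ, mul_neg_one, neg_smul, ← e2,
      fderiv_potential hu]
    have hup : ∀ ν j, dx ν (Function.update X i w j) =
        if j = i then 0 else (1 : Matrix (Fin 4) (Fin 4) ℝ) j ν := fun ν j => by
      rcases eq_or_ne j i with rfl | hj
      · simp [hdw]
      · simp [hj, hdX]
    -- Once `X i` is replaced by the vertical `w`, the form `dx i` vanishes on the whole frame, so
    -- only the summand in which that factor is replaced survives.
    have hcol : ∀ j, dx i (Function.update X i w j) = 0 := fun j => by
      rw [hup]; split_ifs with h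
      · rfl
      · exact Matrix.one_apply_ne h
    have e3 : wedge dx (Function.update X i w) = 0 := wedge_eq_zero hcol
    rw [e3, mul_zero, add_zero, Finset.sum_eq_single i]
    · rw [wedge_update i, Function.update_self, fderiv_fiberDeriv_contact hu, hcw, hw]
      · simp
      · intro j ν hν
        rw [hup]; split_ifs with h
        · subst h; exact (Matrix.one_apply_ne hν.symm).symm
        · rfl
    · intro μ _ hμ
      refine wedge_eq_zero (j := i) fun j => ?_
      rw [Function.update_of_ne hμ.symm]
      exact hcol j
    · simp
  rw [Finset.sum_congr rfl fun i _ => h1 i, Finset.sum_neg_distrib, ← sub_eq_add_neg]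
  congr 1
  simpa using h0

/-- A semiholonomic 4-vector solves the field equation at the points of the constraint set. -/
theorem contraction_poincareCartan {u : JCoord} (hu : (mat u.2.1.1).det ≠ 0)
    (h : u ∈ constraintSet) {X : Fin 4 → JCoord} (hX0 : ∀ ν, (X ν).1 = bvec ν)
    (hX : ∀ ν, (X ν).2.1 = u.2.2 (bvec ν)) (f : ℝ) :
    contraction (f • exteriorPower.ιMulti ℝ 4 X) (poincareCartan u) = 0 := by
  have hv : ∀ w : JCoord, w.1 = 0 → poincareCartan u (Fin.cons w X) = 0 := fun w hw => by
    change -extDeriv poincareCartanPotential u (Fin.cons w X) = 0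
    rw [extDeriv_potential_vertical hu hX0 hX w hw, eulerLagrange hu h hX, sub_self, neg_zero]
  funext w
  rw [contraction, map_smul, exteriorPower.alternatingMapLinearEquiv_apply_ιMulti]
  change f • (poincareCartan u).toAlternatingMap.curryLeft w X = 0
  set φ := (poincareCartan u).toAlternatingMap.curryLeft
  have hφX : ∀ ν, φ (X ν) X = 0 := fun ν =>
    (poincareCartan u).toAlternatingMap.map_eq_zero_of_eq (i := 0) (j := ν.succ)
      (Matrix.vecCons (X ν) X) rfl (Fin.succ_ne_zero ν).symm
  -- A combination of the `X ν` is killed by alternation, and the remainder is vertical.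
  have e : w = ∑ ν, w.1 ν • X ν + (w - ∑ ν, w.1 ν • X ν) := by abel
  have hz : φ (w - ∑ ν, w.1 ν • X ν) X = 0 := by
    refine hv _ ?_
    rw [Prod.fst_sub, Prod.fst_sum]
    simp only [Prod.smul_fst, hX0]
    rw [← base_sum, sub_self]
  let ψ : JCoord →ₗ[ℝ] ℝ :=
    { toFun := fun w => φ w X
      map_add' := fun v w => by rw [map_add]; rfl
      map_smul' := fun c v => by rw [map_smul]; rfl }
  have : ψ w = 0 := by
    rw [e, map_add, show ψ (w - ∑ ν, w.1 ν • X ν) = 0 from hz, add_zero, map_sum]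
    exact Finset.sum_eq_zero fun ν _ => by
      rw [map_smul, show ψ (X ν) = 0 from hφX ν, smul_zero]
  rw [show φ w X = 0 from this, smul_zero]

end FieldEquation

/-! ### Linearising the constraints; the tangent semiholonomic lift. -/

section Shear

/-- The symmetrised quadratic part of the Ricci tensor. -/
noncomputable def ricQuadSymm (Γ : Fin 4 → Fin 4 → Fin 4 → ℝ) (α β : Fin 4) : ℝ :=
  1 / 2 * (ricQuad Γ α β + ricQuad Γ β α)

theorem ricQuadSymm_comm (Γ : Fin 4 → Fin 4 → Fin 4 → ℝ) (α β : Fin 4) :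
    ricQuadSymm Γ α β = ricQuadSymm Γ β α := by
  unfold ricQuadSymm; ring

/-- The value of `g_{ρσ,μ}` prescribed by the pre-metricity constraints. -/
noncomputable def metricDeriv (s : Fiber) (μ ρ σ : Fin 4) : ℝ :=
  ∑ l, s.1 s(σ, l) * s.2 l μ ρ + ∑ l, s.1 s(ρ, l) * s.2 l μ σ +
    2 / 3 * s.1 s(ρ, σ) * ∑ l, (s.2 l l μ - s.2 l μ l)

theorem metricDeriv_comm (s : Fiber) (μ ρ σ : Fin 4) :
    metricDeriv s μ ρ σ = metricDeriv s μ σ ρ := by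
  unfold metricDeriv
  rw [Sym2.eq_swap (a := ρ) (b := σ), add_comm (∑ l, s.1 s(σ, l) * _)]

/-- A first derivative at a point with value `s` satisfying the pre-metricity constraints and the
symmetrised vacuum Einstein equations; its connection part is symmetric. -/
noncomputable def particularDeriv (s : Fiber) (μ : Fin 4) : Fiber :=
  (fun p => Sym2.lift ⟨metricDeriv s μ, metricDeriv_comm s μ⟩ p,
    fun l β α => -(1 / 3 * (delta l μ * ricQuadSymm s.2 α β)))

/-- `particularDeriv` as a linear map of the direction of differentiation. -/
noncomputable def particularJet (s : Fiber) : Base →L[ℝ] Fiber :=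
  ∑ μ, (EuclideanSpace.proj μ : Base →L[ℝ] ℝ).smulRight (particularDeriv s μ)

theorem particularJet_bvec (s : Fiber) (μ : Fin 4) :
    particularJet s (bvec μ) = particularDeriv s μ := by
  simp [particularJet, bvec, sum_apply, ite_smul]

theorem contDiff_particularDeriv (μ : Fin 4) : ContDiff ℝ ∞ fun s => particularDeriv s μ := by
  refine ContDiff.prodMk (contDiff_pi.2 fun p => ?_) (contDiff_pi.2 fun l => contDiff_pi.2 fun β =>
    contDiff_pi.2 fun α => ?_)
  · induction p with
    | h ρ σ =>
      change ContDiff ℝ ∞ fun s => metricDeriv s μ ρ σ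
      unfold metricDeriv; fun_prop
  · unfold ricQuadSymm ricQuad; fun_prop

theorem contDiff_particularJet : ContDiff ℝ ∞ particularJet :=
  ContDiff.sum fun μ _ => contDiff_const.smulRight (contDiff_particularDeriv μ)

/-- The shear of the jet space which straightens the constraint set. -/
noncomputable def shear (u : JCoord) : JCoord := (u.1, u.2.1, u.2.2 - particularJet u.2.1)

/-- The inverse of `shear`. -/
noncomputable def shearInv (u : JCoord) : JCoord := (u.1, u.2.1, u.2.2 + particularJet u.2.1)

theorem shearInv_shear (u : JCoord) : shearInv (shear u) = u := by simp [shear, shearInv]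

theorem shear_shearInv (u : JCoord) : shear (shearInv u) = u := by simp [shear, shearInv]

theorem contDiff_particularJet_fiber : ContDiff ℝ ∞ fun u : JCoord => particularJet u.2.1 :=
  contDiff_particularJet.comp (contDiff_fst.comp contDiff_snd)

theorem contDiff_shear : ContDiff ℝ ∞ shear :=
  contDiff_fst.prodMk ((contDiff_fst.comp contDiff_snd).prodMk
    ((contDiff_snd.comp contDiff_snd).sub contDiff_particularJet_fiber))

theorem contDiff_shearInv : ContDiff ℝ ∞ shearInv :=
  contDiff_fst.prodMk ((contDiff_fst.comp contDiff_snd).prodMk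
    ((contDiff_snd.comp contDiff_snd).add contDiff_particularJet_fiber))

theorem torsionConstraint_add (u v : JCoord) (α β γ : Fin 4) :
    torsionConstraint (u + v) α β γ = torsionConstraint u α β γ + torsionConstraint v α β γ := by
  have : ∀ a b c, torsion (u + v) a b c = torsion u a b c + torsion v a b c := fun a b c => by
    simp only [torsion, gamC, Prod.snd_add, Prod.fst_add, Pi.add_apply]; ring
  simp only [torsionConstraint, this, Finset.sum_add_distrib]; ring

theorem torsionConstraint_smul (c : ℝ) (u : JCoord) (α β γ : Fin 4) :
    torsionConstraint (c • u) α β γ = c * torsionConstraint u α β γ := by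
  have : ∀ a b d, torsion (c • u) a b d = c * torsion u a b d := fun a b d => by
    simp only [torsion, gamC, Prod.smul_snd, Prod.smul_fst, Pi.smul_apply, smul_eq_mul]; ring
  simp only [torsionConstraint, this, ← Finset.mul_sum]; ring

theorem torsionJetConstraint_add (u v : JCoord) (α β γ ν : Fin 4) :
    torsionJetConstraint (u + v) α β γ ν =
      torsionJetConstraint u α β γ ν + torsionJetConstraint v α β γ ν := by
  have : ∀ a b c, torsionJ (u + v) a b c ν = torsionJ u a b c ν + torsionJ v a b c ν :=
    fun a b c => by
      simp only [torsionJ, gamJ, Prod.snd_add, add_apply, Pi.add_apply]; ring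
  simp only [torsionJetConstraint, this, Finset.sum_add_distrib]; ring

theorem torsionJetConstraint_smul (c : ℝ) (u : JCoord) (α β γ ν : Fin 4) :
    torsionJetConstraint (c • u) α β γ ν = c * torsionJetConstraint u α β γ ν := by
  have : ∀ a b d, torsionJ (c • u) a b d ν = c * torsionJ u a b d ν := fun a b d => by
    simp only [torsionJ, gamJ, Prod.smul_snd, smul_apply, Pi.smul_apply, smul_eq_mul]; ring
  simp only [torsionJetConstraint, this, ← Finset.mul_sum]; ring

theorem ricLin_add (i j : Base →L[ℝ] Fiber) (α β : Fin 4) :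
    ricLin (i + j) α β = ricLin i α β + ricLin j α β := by
  simp only [ricLin, add_apply, Prod.snd_add, Pi.add_apply, ← Finset.sum_add_distrib]
  exact Finset.sum_congr rfl fun _ _ => by ring

theorem ricLin_smul (c : ℝ) (j : Base →L[ℝ] Fiber) (α β : Fin 4) :
    ricLin (c • j) α β = c * ricLin j α β := by
  simp only [ricLin, smul_apply, Prod.smul_snd, Pi.smul_apply, smul_eq_mul, Finset.mul_sum, mul_sub]

theorem gJ_add (u v : JCoord) (ρ σ μ : Fin 4) : gJ (u + v) ρ σ μ = gJ u ρ σ μ + gJ v ρ σ μ := rfl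

theorem gJ_smul (c : ℝ) (u : JCoord) (ρ σ μ : Fin 4) : gJ (c • u) ρ σ μ = c * gJ u ρ σ μ := rfl

/-- The linear subspace onto which `shear` maps the constraint set. -/
noncomputable def constraintSpace : Submodule ℝ JCoord where
  carrier := {u | (∀ α β, ricLin u.2.2 α β + ricLin u.2.2 β α = 0) ∧ (∀ ρ σ μ, gJ u ρ σ μ = 0) ∧
    (∀ α β γ, torsionConstraint u α β γ = 0) ∧ ∀ α β γ ν, torsionJetConstraint u α β γ ν = 0}
  add_mem' := by
    rintro u v ⟨a1, a2, a3, a4⟩ ⟨b1, b2, b3, b4⟩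
    refine ⟨fun α β => ?_, fun ρ σ μ => ?_, fun α β γ => ?_, fun α β γ ν => ?_⟩
    · rw [Prod.snd_add, Prod.snd_add, ricLin_add, ricLin_add, add_add_add_comm, a1, b1, add_zero]
    · rw [gJ_add, a2, b2, add_zero]
    · rw [torsionConstraint_add, a3, b3, add_zero]
    · rw [torsionJetConstraint_add, a4, b4, add_zero]
  zero_mem' := by
    simp [ricLin, gJ, torsionConstraint, torsionJetConstraint, torsion, torsionJ, gamC, gamJ]
  smul_mem' := by
    rintro c u ⟨a1, a2, a3, a4⟩
    refine ⟨fun α β => ?_, fun ρ σ μ => ?_, fun α β γ => ?_, fun α β γ ν => ?_⟩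
    · rw [Prod.smul_snd, Prod.smul_snd, ricLin_smul, ricLin_smul, ← mul_add, a1, mul_zero]
    · rw [gJ_smul, a2, mul_zero]
    · rw [torsionConstraint_smul, a3, mul_zero]
    · rw [torsionJetConstraint_smul, a4, mul_zero]

/-- The linear Ricci part of the jet `δ^l_μ S_{αβ}`, with `S` symmetric, is `(4 − 1) S`; hence the
factor `1/3` in `particularDeriv`, and the subtraction adds exactly the symmetrised quadratic part.
-/
theorem ricLin_shear (u : JCoord) (α β : Fin 4) :
    ricLin (shear u).2.2 α β = ricLin u.2.2 α β + ricQuadSymm u.2.1.2 α β := by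
  have h : ∀ l b a μ, ((shear u).2.2 (bvec μ)).2 l b a = (u.2.2 (bvec μ)).2 l b a +
      1 / 3 * (delta l μ * ricQuadSymm u.2.1.2 a b) := by
    intro l b a μ
    change ((u.2.2 - particularJet u.2.1) (bvec μ)).2 l b a = _
    rw [sub_apply, particularJet_bvec]
    change (u.2.2 (bvec μ)).2 l b a - -(1 / 3 * (delta l μ * ricQuadSymm u.2.1.2 a b)) = _
    rw [sub_neg_eq_add]
  simp only [ricLin, h, Finset.sum_sub_distrib, Finset.sum_add_distrib, ← Finset.mul_sum]
  simp [delta, ricQuadSymm_comm u.2.1.2 α β]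
  ring

theorem gJ_shear (u : JCoord) (ρ σ μ : Fin 4) :
    gJ (shear u) ρ σ μ = premetricityConstraint u ρ σ μ := by
  change ((u.2.2 - particularJet u.2.1) (bvec μ)).1 s(ρ, σ) = _
  rw [sub_apply, particularJet_bvec]
  change gJ u ρ σ μ - metricDeriv u.2.1 μ ρ σ = _
  simp only [metricDeriv, premetricityConstraint, torsion, gC, gamC]
  ring

/-- The connection part of `particularDeriv` is symmetric in the lower indices, so the derivative of
the torsion is unaffected. -/
theorem torsionJetConstraint_shear (u : JCoord) (α β γ ν : Fin 4) :
    torsionJetConstraint (shear u) α β γ ν = torsionJetConstraint u α β γ ν := by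
  have h : ∀ l b a, torsionJ (shear u) l b a ν = torsionJ u l b a ν := by
    intro l b a
    change ((u.2.2 - particularJet u.2.1) (bvec ν)).2 l b a -
      ((u.2.2 - particularJet u.2.1) (bvec ν)).2 l a b = _
    rw [sub_apply, particularJet_bvec]
    change (u.2.2 (bvec ν)).2 l b a - -_ - ((u.2.2 (bvec ν)).2 l a b - -_) = _
    rw [ricQuadSymm_comm, torsionJ, gamJ, gamJ]
    ring
  simp only [torsionJetConstraint, h]

theorem mem_constraintSet_iff_ricci {u : JCoord} (hu : (mat u.2.1.1).det ≠ 0) :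
    u ∈ constraintSet ↔ (∀ α β, ricci u α β + ricci u β α = 0) ∧
      (∀ ρ σ μ, premetricityConstraint u ρ σ μ = 0) ∧ (∀ α β γ, torsionConstraint u α β γ = 0) ∧
        ∀ α β γ ν, torsionJetConstraint u α β γ ν = 0 := by
  rw [← connectionConstraint_iff hu]; rfl

/-- All four families become linear: the Ricci condition loses its quadratic part, `m` becomes the
vanishing of the jet of `g`, and `t` and `r`, already linear, keep their values. -/
theorem mem_constraintSet_iff {u : JCoord} (hu : (mat u.2.1.1).det ≠ 0) :
    u ∈ constraintSet ↔ shear u ∈ constraintSpace := by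
  rw [mem_constraintSet_iff_ricci hu]
  change _ ↔ (∀ α β, ricLin (shear u).2.2 α β + ricLin (shear u).2.2 β α = 0) ∧
    (∀ ρ σ μ, gJ (shear u) ρ σ μ = 0) ∧ (∀ α β γ, torsionConstraint u α β γ = 0) ∧
    ∀ α β γ ν, torsionJetConstraint (shear u) α β γ ν = 0
  have h : ∀ α β, ricLin (shear u).2.2 α β + ricLin (shear u).2.2 β α =
      ricci u α β + ricci u β α := fun α β => by
    rw [ricLin_shear, ricLin_shear, ricci_eq, ricci_eq, ricQuadSymm, ricQuadSymm]; ring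
  simp only [h, gJ_shear, torsionJetConstraint_shear]

/-- A semiholonomic horizontal lift `v ↦ (v, y_v, F_v)` which is tangent to the constraint set. -/
noncomputable def localLift (u : JCoord) : Base →L[ℝ] JCoord :=
  (ContinuousLinearMap.id ℝ Base).prod (u.2.2.prod ((fderiv ℝ particularJet u.2.1).comp u.2.2))

theorem localLift_apply (u : JCoord) (v : Base) :
    localLift u v = (v, u.2.2 v, fderiv ℝ particularJet u.2.1 (u.2.2 v)) := rfl

theorem contDiff_localLift : ContDiff ℝ ∞ fun p : JCoord × Base => localLift p.1 p.2 := by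
  have h : ContDiff ℝ ∞ fun p : JCoord × Base => p.1.2.2 p.2 :=
    (contDiff_snd.comp (contDiff_snd.comp contDiff_fst)).clm_apply contDiff_snd
  change ContDiff ℝ ∞ fun p : JCoord × Base =>
    (p.2, p.1.2.2 p.2, fderiv ℝ particularJet p.1.2.1 (p.1.2.2 p.2))
  refine contDiff_snd.prodMk (h.prodMk (ContDiff.clm_apply ?_ h))
  exact (contDiff_particularJet.fderiv_right (m := ∞) (by simp)).comp
    (contDiff_fst.comp (contDiff_snd.comp contDiff_fst))

theorem fderiv_shear (u k : JCoord) : fderiv ℝ shear u k =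
    (k.1, k.2.1, k.2.2 - fderiv ℝ particularJet u.2.1 k.2.1) := by
  have h1 : HasFDerivAt (fun u : JCoord => particularJet u.2.1) _ u :=
    HasFDerivAt.comp (g := particularJet) (f := fun u : JCoord => u.2.1) u
      (contDiff_particularJet.differentiable (by simp) u.2.1).hasFDerivAt
      (hasFDerivAt_fst.comp u hasFDerivAt_snd)
  have h2 : HasFDerivAt shear _ u := HasFDerivAt.prodMk hasFDerivAt_fst
    (HasFDerivAt.prodMk (hasFDerivAt_fst.comp u hasFDerivAt_snd)
      ((hasFDerivAt_snd.comp u hasFDerivAt_snd).sub h1))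
  rw [h2.fderiv]
  rfl

/-- The jet part of `localLift` is the derivative of `particularJet` along `y_v`, so the sheared
vector is `(v, y_v, 0)`. Only `t` remains to be tested, and its value on `y_v` is `v^ν r_{…,ν}`.
This is where the constraints `r` are indispensable. -/
theorem fderiv_shear_localLift {u : JCoord} (h : ∀ α β γ ν, torsionJetConstraint u α β γ ν = 0)
    (v : Base) : fderiv ℝ shear u (localLift u v) ∈ constraintSpace := by
  rw [fderiv_shear, localLift_apply]
  simp only [sub_self]
  refine ⟨fun α β => by simp [ricLin], fun ρ σ μ => by simp [gJ], fun α β γ => ?_,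
    fun α β γ ν => by simp [torsionJetConstraint, torsionJ, gamJ]⟩
  have hT : ∀ a b c, torsion (v, u.2.2 v, 0) a b c = ∑ ν, v ν * torsionJ u a b c ν := by
    intro a b c
    change (u.2.2 v).2 a b c - (u.2.2 v).2 a c b = _
    have e : u.2.2 v = ∑ ν, v ν • u.2.2 (bvec ν) := by
      conv_lhs => rw [base_sum v]
      rw [map_sum]; simp only [map_smul]
    rw [e]
    simp only [Prod.snd_sum, Finset.sum_apply, Prod.smul_snd, Pi.smul_apply, smul_eq_mul,
      ← Finset.sum_sub_distrib, ← mul_sub]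
    rfl
  have key : torsionConstraint (v, u.2.2 v, 0) α β γ =
      ∑ ν, v ν * torsionJetConstraint u α β γ ν := by
    simp only [torsionConstraint, torsionJetConstraint, hT, mul_add, mul_sub,
      Finset.sum_add_distrib, Finset.sum_sub_distrib]
    congr 1
    · congr 1
      rw [Finset.sum_comm, Finset.mul_sum]
      exact Finset.sum_congr rfl fun ν _ => by rw [← Finset.mul_sum]; ring
    · rw [Finset.sum_comm, Finset.mul_sum]
      exact Finset.sum_congr rfl fun ν _ => by rw [← Finset.mul_sum]; ring
  rw [key]
  simp [h]

end Shear

/-! ### The constraints as conditions on multilinear maps. -/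

section Invariance

theorem isLinearMap_eq_zero {V : Type*} [AddCommGroup V] [Module ℝ V] {f : Base → V}
    (hf : IsLinearMap ℝ f) (h : ∀ i, f (bvec i) = 0) (v : Base) : f v = 0 := by
  have e : f v = hf.mk' f v := rfl
  rw [e, base_sum v, map_sum]
  exact Finset.sum_eq_zero fun i _ => by rw [map_smul, IsLinearMap.mk'_apply, h, smul_zero]

section Bilinear

variable (g h : Sym2 (Fin 4) → ℝ) (Γ Γ' : Fin 4 → Fin 4 → Fin 4 → ℝ) (v v' w w' : Base) (c : ℝ)

theorem chris_add_left : chris Γ (v + v') w = chris Γ v w + chris Γ v' w := by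
  ext; simp [chris, add_mul, Finset.sum_add_distrib]

theorem chris_add_right : chris Γ v (w + w') = chris Γ v w + chris Γ v w' := by
  ext; simp [chris, add_mul, mul_add, Finset.sum_add_distrib]

theorem chris_add : chris (Γ + Γ') v w = chris Γ v w + chris Γ' v w := by
  ext; simp [chris, mul_add, Finset.sum_add_distrib]

theorem chris_smul_left : chris Γ (c • v) w = c • chris Γ v w := by
  ext; simp [chris, Finset.mul_sum, mul_assoc]

theorem chris_smul_right : chris Γ v (c • w) = c • chris Γ v w := by
  ext; simp [chris, Finset.mul_sum, mul_assoc, mul_left_comm]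

theorem chris_smul : chris (c • Γ) v w = c • chris Γ v w := by
  ext; simp [chris, Finset.mul_sum, mul_left_comm]

theorem gform_add_left : gform g (v + v') w = gform g v w + gform g v' w := by
  simp [gform, add_mul, Finset.sum_add_distrib]

theorem gform_add_right : gform g v (w + w') = gform g v w + gform g v w' := by
  simp [gform, add_mul, mul_add, Finset.sum_add_distrib]

theorem gform_add : gform (g + h) v w = gform g v w + gform h v w := by
  simp [gform, mul_add, Finset.sum_add_distrib]

theorem gform_smul_left : gform g (c • v) w = c * gform g v w := by
  simp [gform, Finset.mul_sum, mul_assoc]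

theorem gform_smul_right : gform g v (c • w) = c * gform g v w := by
  simp [gform, Finset.mul_sum, mul_assoc, mul_left_comm]

theorem gform_smul : gform (c • g) v w = c * gform g v w := by
  simp [gform, Finset.mul_sum, mul_left_comm]

end Bilinear

theorem chris_bvec (Γ : Fin 4 → Fin 4 → Fin 4 → ℝ) (l μ ν : Fin 4) :
    chris Γ (bvec μ) (bvec ν) l = Γ l μ ν := by simp [chris, bvec]

theorem gform_bvec_right (g : Sym2 (Fin 4) → ℝ) (v : Base) (ν : Fin 4) :
    gform g v (bvec ν) = ∑ μ, v μ * g s(μ, ν) := by simp [gform, bvec]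

theorem gform_bvec (g : Sym2 (Fin 4) → ℝ) (μ ν : Fin 4) :
    gform g (bvec μ) (bvec ν) = g s(μ, ν) := by simp [gform, bvec]

theorem bvec_apply (μ l : Fin 4) : bvec μ l = delta l μ := by
  simp [bvec, delta]

/-- The connection of a 1-jet as a bilinear map. -/
noncomputable def conn (u : JCoord) (v w : Base) : Base := chris u.2.1.2 v w

/-- The derivative of the connection of a 1-jet as a trilinear map. -/
noncomputable def connDeriv (u : JCoord) (z v w : Base) : Base := chris (u.2.2 z).2 v w

/-- The curvature `R(z, v)w` of a 1-jet. -/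
noncomputable def curv (u : JCoord) (v w z : Base) : Base :=
  connDeriv u z v w - connDeriv u v z w + conn u z (conn u v w) - conn u v (conn u z w)

theorem isLinearMap_curv (u : JCoord) (v w : Base) : IsLinearMap ℝ (curv u v w) := by
  constructor
  · intro x y
    simp only [curv, conn, connDeriv, map_add, Prod.snd_add, chris_add, chris_add_left,
      chris_add_right]
    abel
  · intro c x
    simp only [curv, conn, connDeriv, map_smul, Prod.smul_snd, chris_smul, chris_smul_left,
      chris_smul_right, smul_add, smul_sub]

theorem isLinearMap_curv_left (u : JCoord) (w z : Base) :
    IsLinearMap ℝ fun v => curv u v w z := by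
  constructor
  · intro x y
    simp only [curv, conn, connDeriv, map_add, Prod.snd_add, chris_add, chris_add_left,
      chris_add_right]
    abel
  · intro c x
    simp only [curv, conn, connDeriv, map_smul, Prod.smul_snd, chris_smul, chris_smul_left,
      chris_smul_right, smul_add, smul_sub]

theorem isLinearMap_curv_right (u : JCoord) (v z : Base) :
    IsLinearMap ℝ fun w => curv u v w z := by
  constructor
  · intro x y
    simp only [curv, conn, connDeriv, chris_add_right]
    abel
  · intro c x
    simp only [curv, conn, connDeriv, chris_smul_right, smul_add, smul_sub]

/-- The Ricci tensor as the trace of the curvature. -/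
noncomputable def ric (u : JCoord) (v w : Base) : ℝ :=
  LinearMap.trace ℝ Base ((isLinearMap_curv u v w).mk' _)

theorem ric_eq_sum (u : JCoord) (v w : Base) : ric u v w = ∑ γ, curv u v w (bvec γ) γ := by
  rw [ric, LinearMap.trace_eq_sum_inner _ (EuclideanSpace.basisFun (Fin 4) ℝ)]
  refine Finset.sum_congr rfl fun γ _ => ?_
  rw [EuclideanSpace.basisFun_inner]
  simp [bvec]

theorem chris_bvec_left (Γ : Fin 4 → Fin 4 → Fin 4 → ℝ) (l μ : Fin 4) (w : Base) :
    chris Γ (bvec μ) w l = ∑ σ, Γ l μ σ * w σ := by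
  simp [chris, bvec, mul_comm]

/-- The arguments are reversed because the first lower index of `Γ` is the direction of
differentiation: `R_{αβ}` is the trace of `z ↦ R(z, e_β) e_α`. -/
theorem ric_bvec (u : JCoord) (α β : Fin 4) : ric u (bvec β) (bvec α) = ricci u α β := by
  rw [ric_eq_sum, ricci]
  have h : ∀ μ (v : Base) l, conn u (bvec μ) v l = ∑ σ, u.2.1.2 l μ σ * v σ := fun μ v l =>
    chris_bvec_left _ _ _ _
  simp only [curv, connDeriv, PiLp.add_apply, PiLp.sub_apply, chris_bvec, h]
  simp only [bvec_apply, delta, mul_ite, mul_one, mul_zero, Finset.sum_ite_eq', Finset.mem_univ,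
    if_true, Finset.sum_add_distrib, Finset.sum_sub_distrib]
  rw [Finset.sum_comm (f := fun γ σ => u.2.1.2 γ γ σ * u.2.1.2 σ β α)]
  simp only [gamJ, gamC, mul_comm (u.2.1.2 _ β α)]
  ring

/-- The constraints in terms of tensors. -/
def TensorConstraint (u : JCoord) : Prop :=
  ∃ (a : Base → ℝ) (aJ : Base → Base → ℝ),
    (∀ v w, conn u v w = conn u w v + a w • v - a v • w) ∧
    (∀ z v w, connDeriv u z v w = connDeriv u z w v + aJ z w • v - aJ z v • w) ∧
    (∀ z v w, gform (u.2.2 z).1 v w = gform u.2.1.1 (conn u z v) w + gform u.2.1.1 v (conn u z w) +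
      2 * a z * gform u.2.1.1 v w) ∧
    ∀ v w, ric u v w + ric u w v = 0

/-- Tracing the first two conditions gives `3a` and `3aJ` for the traces of the torsion and of its
derivative, so the existential witnesses are forced. -/
theorem mem_constraintSet_of_tensorConstraint {u : JCoord} (hu : (mat u.2.1.1).det ≠ 0)
    (h : TensorConstraint u) : u ∈ constraintSet := by
  obtain ⟨a, aJ, h1, h2, h3, h4⟩ := h
  rw [mem_constraintSet_iff_ricci hu]
  have e1 : ∀ α β γ, torsion u α β γ = a (bvec γ) * delta α β - a (bvec β) * delta α γ := by
    intro α β γ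
    have := congrArg (fun x : Base => x α) (h1 (bvec β) (bvec γ))
    simp only [conn, PiLp.add_apply, PiLp.sub_apply, PiLp.smul_apply, chris_bvec, bvec_apply,
      smul_eq_mul] at this
    rw [torsion, gamC, gamC, this]; ring
  have e2 : ∀ γ, ∑ l, torsion u l l γ = 3 * a (bvec γ) := by
    intro γ
    simp only [e1]
    simp [delta]; ring
  have f1 : ∀ α β γ ν, torsionJ u α β γ ν =
      aJ (bvec ν) (bvec γ) * delta α β - aJ (bvec ν) (bvec β) * delta α γ := by
    intro α β γ ν
    have := congrArg (fun x : Base => x α) (h2 (bvec ν) (bvec β) (bvec γ))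
    simp only [connDeriv, PiLp.add_apply, PiLp.sub_apply, PiLp.smul_apply, chris_bvec, bvec_apply,
      smul_eq_mul] at this
    rw [torsionJ, gamJ, gamJ, this]; ring
  have f2 : ∀ γ ν, ∑ l, torsionJ u l l γ ν = 3 * aJ (bvec ν) (bvec γ) := by
    intro γ ν
    simp only [f1]
    simp [delta]; ring
  refine ⟨fun α β => ?_, fun ρ σ μ => ?_, fun α β γ => ?_, fun α β γ ν => ?_⟩
  · rw [← ric_bvec, ← ric_bvec]; exact h4 _ _
  · have := h3 (bvec μ) (bvec ρ) (bvec σ)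
    rw [gform_comm _ (bvec ρ) (conn _ _ _)] at this
    simp only [gform_bvec] at this
    simp only [gform_bvec_right, conn, chris_bvec] at this
    rw [premetricityConstraint, e2, gJ, this]
    have s1 : ∑ l, u.2.1.2 l μ ρ * u.2.1.1 s(l, σ) = ∑ l, gC u σ l * gamC u l μ ρ :=
      Finset.sum_congr rfl fun l _ => by rw [mul_comm, Sym2.eq_swap]; rfl
    have s2 : ∑ l, u.2.1.2 l μ σ * u.2.1.1 s(l, ρ) = ∑ l, gC u ρ l * gamC u l μ σ :=
      Finset.sum_congr rfl fun l _ => by rw [mul_comm, Sym2.eq_swap]; rfl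
    rw [s1, s2, gC]; ring
  · rw [torsionConstraint, e1, e2, e2]; ring
  · rw [torsionJetConstraint, f1, f2, f2]; ring

theorem tensorConstraint_of_mem {u : JCoord} (hu : (mat u.2.1.1).det ≠ 0)
    (h : u ∈ constraintSet) : TensorConstraint u := by
  rw [mem_constraintSet_iff_ricci hu] at h
  obtain ⟨h4, h3, h1, h2⟩ := h
  -- The torsion `a(w) v − a(v) w` has trace `3a`, which dictates the witnesses. All conditions are
  -- multilinear, so checking them on the basis suffices.
  let a : Base → ℝ := fun w => 1 / 3 * ∑ l, (conn u (bvec l) w l - conn u w (bvec l) l)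
  let aJ : Base → Base → ℝ := fun z w =>
    1 / 3 * ∑ l, (connDeriv u z (bvec l) w l - connDeriv u z w (bvec l) l)
  have ha : ∀ γ, a (bvec γ) = 1 / 3 * ∑ l, torsion u l l γ := fun γ => by
    simp only [a, conn, chris_bvec]; rfl
  have haJ : ∀ ν γ, aJ (bvec ν) (bvec γ) = 1 / 3 * ∑ l, torsionJ u l l γ ν := fun ν γ => by
    simp only [aJ, connDeriv, chris_bvec]; rfl
  have a_add : ∀ v w, a (v + w) = a v + a w := fun v w => by
    simp only [a, conn, chris_add_left, chris_add_right, PiLp.add_apply, Finset.sum_sub_distrib,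
      Finset.sum_add_distrib]
    ring
  have a_smul : ∀ (c : ℝ) v, a (c • v) = c * a v := fun c v => by
    simp only [a, conn, chris_smul_left, chris_smul_right, PiLp.smul_apply, smul_eq_mul, ← mul_sub,
      ← Finset.mul_sum]
    ring
  have aJ_add : ∀ z v w, aJ z (v + w) = aJ z v + aJ z w := fun z v w => by
    simp only [aJ, connDeriv, chris_add_left, chris_add_right, PiLp.add_apply,
      Finset.sum_sub_distrib, Finset.sum_add_distrib]
    ring
  have aJ_smul : ∀ (c : ℝ) z v, aJ z (c • v) = c * aJ z v := fun c z v => by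
    simp only [aJ, connDeriv, chris_smul_left, chris_smul_right, PiLp.smul_apply, smul_eq_mul,
      ← mul_sub, ← Finset.mul_sum]
    ring
  have aJ_add_left : ∀ z z' v, aJ (z + z') v = aJ z v + aJ z' v := fun z z' v => by
    simp only [aJ, connDeriv, map_add, Prod.snd_add, chris_add, PiLp.add_apply,
      Finset.sum_sub_distrib, Finset.sum_add_distrib]
    ring
  have aJ_smul_left : ∀ (c : ℝ) z v, aJ (c • z) v = c * aJ z v := fun c z v => by
    simp only [aJ, connDeriv, map_smul, Prod.smul_snd, chris_smul, PiLp.smul_apply, smul_eq_mul,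
      ← mul_sub, ← Finset.mul_sum]
    ring
  refine ⟨a, aJ, fun v w => ?_, fun z v w => ?_, fun z v w => ?_, fun v w => ?_⟩
  · rw [← sub_eq_zero]
    revert v w
    refine fun v w => isLinearMap_eq_zero
      (f := fun v => conn u v w - (conn u w v + a w • v - a v • w)) ⟨fun x y => ?_, fun c x => ?_⟩
      (fun β => isLinearMap_eq_zero (f := fun w => conn u (bvec β) w -
        (conn u w (bvec β) + a w • bvec β - a (bvec β) • w)) ⟨fun x y => ?_, fun c x => ?_⟩
        (fun γ => ?_) w) v
    · simp only [conn, chris_add_left, chris_add_right, a_add, smul_add, add_smul]; abel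
    · simp only [conn, chris_smul_left, chris_smul_right, a_smul, smul_add, smul_sub, mul_smul,
        smul_comm c]
    · simp only [conn, chris_add_left, chris_add_right, a_add, smul_add, add_smul]; abel
    · simp only [conn, chris_smul_left, chris_smul_right, a_smul, smul_add, smul_sub, mul_smul,
        smul_comm c]
    · ext α
      have := h1 α β γ
      rw [torsionConstraint, torsion, gamC, gamC] at this
      simp only [conn, PiLp.add_apply, PiLp.sub_apply, PiLp.smul_apply, chris_bvec, bvec_apply,
        smul_eq_mul, ha, PiLp.zero_apply]
      linarith
  · rw [← sub_eq_zero]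
    refine isLinearMap_eq_zero
      (f := fun z => connDeriv u z v w - (connDeriv u z w v + aJ z w • v - aJ z v • w))
      ⟨fun x y => ?_, fun c x => ?_⟩ (fun ν => isLinearMap_eq_zero
      (f := fun v => connDeriv u (bvec ν) v w -
        (connDeriv u (bvec ν) w v + aJ (bvec ν) w • v - aJ (bvec ν) v • w))
      ⟨fun x y => ?_, fun c x => ?_⟩
      (fun β => isLinearMap_eq_zero (f := fun w => connDeriv u (bvec ν) (bvec β) w -
        (connDeriv u (bvec ν) w (bvec β) + aJ (bvec ν) w • bvec β - aJ (bvec ν) (bvec β) • w))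
        ⟨fun x y => ?_, fun c x => ?_⟩ (fun γ => ?_) w) v) z
    · simp only [connDeriv, map_add, Prod.snd_add, chris_add, aJ_add_left, add_smul]; abel
    · simp only [connDeriv, map_smul, Prod.smul_snd, chris_smul, aJ_smul_left, smul_add, smul_sub,
        mul_smul]
    · simp only [connDeriv, chris_add_left, chris_add_right, aJ_add, smul_add, add_smul]; abel
    · simp only [connDeriv, chris_smul_left, chris_smul_right, aJ_smul, smul_add, smul_sub,
        mul_smul, smul_comm c]
    · simp only [connDeriv, chris_add_left, chris_add_right, aJ_add, smul_add, add_smul]; abel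
    · simp only [connDeriv, chris_smul_left, chris_smul_right, aJ_smul, smul_add, smul_sub,
        mul_smul, smul_comm c]
    · ext α
      have := h2 α β γ ν
      rw [torsionJetConstraint, torsionJ, gamJ, gamJ] at this
      simp only [connDeriv, PiLp.add_apply, PiLp.sub_apply, PiLp.smul_apply, chris_bvec,
        bvec_apply, smul_eq_mul, haJ, PiLp.zero_apply]
      linarith
  · rw [← sub_eq_zero]
    refine isLinearMap_eq_zero
      (f := fun z => gform (u.2.2 z).1 v w - (gform u.2.1.1 (conn u z v) w +
        gform u.2.1.1 v (conn u z w) + 2 * a z * gform u.2.1.1 v w))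
      ⟨fun x y => ?_, fun c x => ?_⟩ (fun μ => isLinearMap_eq_zero
      (f := fun v => gform (u.2.2 (bvec μ)).1 v w - (gform u.2.1.1 (conn u (bvec μ) v) w +
        gform u.2.1.1 v (conn u (bvec μ) w) + 2 * a (bvec μ) * gform u.2.1.1 v w))
      ⟨fun x y => ?_, fun c x => ?_⟩
      (fun ρ => isLinearMap_eq_zero (f := fun w => gform (u.2.2 (bvec μ)).1 (bvec ρ) w -
        (gform u.2.1.1 (conn u (bvec μ) (bvec ρ)) w +
        gform u.2.1.1 (bvec ρ) (conn u (bvec μ) w) + 2 * a (bvec μ) * gform u.2.1.1 (bvec ρ) w))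
        ⟨fun x y => ?_, fun c x => ?_⟩ (fun σ => ?_) w) v) z
    · simp only [conn, map_add, Prod.fst_add, gform_add, chris_add_left, gform_add_left,
        gform_add_right, a_add]; ring
    · simp only [conn, map_smul, Prod.smul_fst, gform_smul, chris_smul_left, gform_smul_left,
        gform_smul_right, a_smul, smul_eq_mul]; ring
    · simp only [conn, chris_add_right, gform_add_left]; ring
    · simp only [conn, chris_smul_right, gform_smul_left, smul_eq_mul]; ring
    · simp only [conn, chris_add_right, gform_add_right]; ring
    · simp only [conn, chris_smul_right, gform_smul_right, smul_eq_mul]; ring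
    · have := h3 ρ σ μ
      rw [gform_comm _ (bvec ρ) (conn _ _ _)]
      simp only [gform_bvec]
      simp only [gform_bvec_right, conn, chris_bvec, ha]
      have s1 : ∑ l, u.2.1.2 l μ ρ * u.2.1.1 s(l, σ) = ∑ l, gC u σ l * gamC u l μ ρ :=
        Finset.sum_congr rfl fun l _ => by rw [mul_comm, Sym2.eq_swap]; rfl
      have s2 : ∑ l, u.2.1.2 l μ σ * u.2.1.1 s(l, ρ) = ∑ l, gC u ρ l * gamC u l μ σ :=
        Finset.sum_congr rfl fun l _ => by rw [mul_comm, Sym2.eq_swap]; rfl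
      rw [premetricityConstraint, gJ] at this
      rw [s1, s2]
      rw [gC] at this
      linarith
  · have hlin : ∀ w, IsLinearMap ℝ (fun v => ric u v w + ric u w v) := fun w => by
      constructor
      · intro x y
        simp only [ric_eq_sum, (isLinearMap_curv_left u w _).map_add,
          (isLinearMap_curv_right u w _).map_add, PiLp.add_apply, Finset.sum_add_distrib]
        ring
      · intro c x
        simp only [ric_eq_sum, (isLinearMap_curv_left u w _).map_smul,
          (isLinearMap_curv_right u w _).map_smul, PiLp.smul_apply, ← Finset.smul_sum, smul_add]
    refine isLinearMap_eq_zero (hlin w) (fun β => ?_) v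
    rw [add_comm]
    refine isLinearMap_eq_zero (hlin (bvec β)) (fun α => ?_) w
    rw [ric_bvec, ric_bvec]
    exact h4 _ _

theorem mem_constraintSet_iff_tensorConstraint {u : JCoord} (hu : (mat u.2.1.1).det ≠ 0) :
    u ∈ constraintSet ↔ TensorConstraint u :=
  ⟨tensorConstraint_of_mem hu, mem_constraintSet_of_tensorConstraint hu⟩

end Invariance

/-! ### Behaviour of the constraints and of semiholonomy under coordinate changes. -/

section Covariance

theorem hasDerivAt_coord {v : ℝ → Base} {v' : Base} {t : ℝ} (hv : HasDerivAt v v' t) (i : Fin 4) :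
    HasDerivAt (fun s => v s i) (v' i) t :=
  (EuclideanSpace.proj i : Base →L[ℝ] ℝ).hasFDerivAt.comp_hasDerivAt t hv

theorem hasDerivAt_gform {g : ℝ → Sym2 (Fin 4) → ℝ} {g' : Sym2 (Fin 4) → ℝ} {v w : ℝ → Base}
    {v' w' : Base} {t : ℝ} (hg : HasDerivAt g g' t) (hv : HasDerivAt v v' t)
    (hw : HasDerivAt w w' t) : HasDerivAt (fun s => gform (g s) (v s) (w s))
      (gform g' (v t) (w t) + gform (g t) v' (w t) + gform (g t) (v t) w') t := by
  have h := HasDerivAt.fun_sum (u := Finset.univ) fun μ _ =>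
    HasDerivAt.fun_sum (u := Finset.univ) fun ν _ =>
      ((hasDerivAt_coord hv μ).mul (hasDerivAt_coord hw ν)).mul (hasDerivAt_pi.1 hg s(μ, ν))
  refine h.congr_deriv ?_
  simp only [gform, ← Finset.sum_add_distrib]
  exact Finset.sum_congr rfl fun μ _ => Finset.sum_congr rfl fun ν _ => by
    simp only [Pi.mul_apply]; ring

theorem hasDerivAt_chris {Γ : ℝ → Fin 4 → Fin 4 → Fin 4 → ℝ} {Γ' : Fin 4 → Fin 4 → Fin 4 → ℝ}
    {v w : ℝ → Base} {v' w' : Base} {t : ℝ} (hΓ : HasDerivAt Γ Γ' t) (hv : HasDerivAt v v' t)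
    (hw : HasDerivAt w w' t) : HasDerivAt (fun s => chris (Γ s) (v s) (w s))
      (chris Γ' (v t) (w t) + chris (Γ t) v' (w t) + chris (Γ t) (v t) w') t := by
  have hl : ∀ l, HasDerivAt (fun s => chris (Γ s) (v s) (w s) l)
      ((chris Γ' (v t) (w t) + chris (Γ t) v' (w t) + chris (Γ t) (v t) w' : Base) l) t := by
    intro l
    have h := HasDerivAt.fun_sum (u := Finset.univ) fun μ _ =>
      HasDerivAt.fun_sum (u := Finset.univ) fun ν _ =>
        ((hasDerivAt_coord hv μ).mul (hasDerivAt_coord hw ν)).mul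
          (hasDerivAt_pi.1 (hasDerivAt_pi.1 (hasDerivAt_pi.1 hΓ l) μ) ν)
    refine h.congr_deriv ?_
    simp only [chris, PiLp.add_apply, ← Finset.sum_add_distrib]
    exact Finset.sum_congr rfl fun μ _ => Finset.sum_congr rfl fun ν _ => by
      simp only [Pi.mul_apply]; ring
  have := (hasDerivAt_pi.2 hl)
  exact ((PiLp.continuousLinearEquiv 2 ℝ fun _ : Fin 4 => ℝ).symm :
    (Fin 4 → ℝ) →L[ℝ] Base).hasFDerivAt.comp_hasDerivAt t this

theorem gform_zero_left (g : Sym2 (Fin 4) → ℝ) (w : Base) : gform g 0 w = 0 := by simp [gform]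

theorem gform_zero_right (g : Sym2 (Fin 4) → ℝ) (v : Base) : gform g v 0 = 0 := by simp [gform]

theorem chris_zero_left (Γ : Fin 4 → Fin 4 → Fin 4 → ℝ) (w : Base) : chris Γ 0 w = 0 := by
  ext; simp [chris]

theorem chris_zero_right (Γ : Fin 4 → Fin 4 → Fin 4 → ℝ) (v : Base) : chris Γ v 0 = 0 := by
  ext; simp [chris]

variable {φ ψ : Base → Base} {s t : Set Base}

theorem affineRep_base (h : LocDiffeo φ ψ s t) {u : JCoord} (hu : u.1 ∈ s) :
    affineRep u (ψ (φ u.1)) = u.2.1 := by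
  rw [h.li _ hu]; simp [affineRep]

theorem contDiffAt_push_affineRep (h : LocDiffeo φ ψ s t) (u : JCoord) {y : Base} (hy : y ∈ t) :
    ContDiffAt ℝ ∞ (fun y => push φ ψ y (affineRep u (ψ y))) y := by
  have a3 : ContDiffAt ℝ ∞ (fun p : Base => affineRep u (ψ p)) y :=
    contDiffAt_const.add (contDiffAt_const.clm_apply
      ((h.symm.contDiffAt hy).sub contDiffAt_const))
  exact ContDiffAt.comp (g := fun p : Base × Fiber => push φ ψ p.1 p.2)
    (f := fun y => (y, affineRep u (ψ y))) _ (push_contDiffAt h hy _) (contDiffAt_id.prodMk a3)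

/-- The data expressing how a 1-jet transforms under a change of coordinates: `A`, `Q`, `D` are
the first three derivatives of the inverse change of coordinates. -/
structure JetTransform (u u' : JCoord) (A B : Base →ₗ[ℝ] Base) (Q : Base →L[ℝ] Base →L[ℝ] Base)
    (D : Base → Base → Base → Base) : Prop where
  leftInv : ∀ v, B (A v) = v
  rightInv : ∀ v, A (B v) = v
  symmQ : ∀ v w, Q v w = Q w v
  symmD : ∀ z v w, D z v w = D v z w
  symmD' : ∀ z v w, D z v w = D z w v
  metric : ∀ v w, gform u'.2.1.1 v w = gform u.2.1.1 (A v) (A w)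
  conn : ∀ v w, A (conn u' v w) = conn u (A v) (A w) + Q v w
  metricDeriv : ∀ z v w, gform (u'.2.2 z).1 v w = gform (u.2.2 (A z)).1 (A v) (A w) +
    gform u.2.1.1 (Q z v) (A w) + gform u.2.1.1 (A v) (Q z w)
  connDeriv : ∀ z v w, Q z (EinsteinPalatini.conn u' v w) + A (connDeriv u' z v w) =
    connDeriv u (A z) (A v) (A w) + EinsteinPalatini.conn u (Q z v) (A w) +
      EinsteinPalatini.conn u (A v) (Q z w) + D z v w

/-- The inhomogeneous terms are harmless: `Q` is symmetric, so it leaves the torsion alone, and in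
premetricity it cancels against the derivative of `A`. The curvature transforms as a tensor, and its
trace is invariant. -/
theorem JetTransform.tensorConstraint {u u' : JCoord} {A B : Base →ₗ[ℝ] Base}
    {Q : Base →L[ℝ] Base →L[ℝ] Base} {D : Base → Base → Base → Base}
    (h : JetTransform u u' A B Q D)
    (hT : TensorConstraint u) : TensorConstraint u' := by
  obtain ⟨a, aJ, h1, h2, h3, h4⟩ := hT
  have hinj : Function.Injective A := Function.LeftInverse.injective h.leftInv
  have h1' : ∀ v w, EinsteinPalatini.conn u' v w =
      EinsteinPalatini.conn u' w v + a (A w) • v - a (A v) • w := by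
    intro v w
    apply hinj
    rw [map_sub, map_add, h.conn, h.conn, map_smul, map_smul, h1 (A v), h.symmQ v]
    abel
  -- The second witness is the derivative of `w ↦ a (A w)` along `z`: `Q z w` is the derivative of
  -- `A w`.
  refine ⟨fun v => a (A v), fun z w => aJ (A z) (A w) + a (Q z w), h1', ?_, ?_, ?_⟩
  · intro z v w
    apply hinj
    have e1 := h.connDeriv z v w
    have e2 := h.connDeriv z w v
    have e3 := congrArg (Q z) (h1' v w)
    have e4 := h1 (Q z v) (A w)
    have e5 := h1 (A v) (Q z w)
    simp only [map_add, map_sub, map_smul] at e3 ⊢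
    linear_combination (norm := module) e1 - e2 - e3 + h2 (A z) (A v) (A w) + e4 + e5 + h.symmD' z v w
  · intro z v w
    rw [h.metricDeriv, h3, h.metric, h.metric, h.metric, h.conn, h.conn, gform_add_left,
      gform_add_right]
    ring
  -- After antisymmetrisation in `z` and `v` the third derivatives `D` cancel by symmetry, and the
  -- terms in `Q` cancel in pairs.
  · have hcurv : ∀ v w z, A (curv u' v w z) = curv u (A v) (A w) (A z) := by
      intro v w z
      have e1 := h.connDeriv z v w
      have e2 := h.connDeriv v z w
      have e3 : ∀ x y z, A (EinsteinPalatini.conn u' z (EinsteinPalatini.conn u' x y)) =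
          EinsteinPalatini.conn u (A z) (EinsteinPalatini.conn u (A x) (A y)) +
          EinsteinPalatini.conn u (A z) (Q x y) + Q z (EinsteinPalatini.conn u' x y) := by
        intro x y z
        rw [h.conn, h.conn x y]
        exact congrArg (· + _) (chris_add_right _ _ _ _)
      have e4 := congrArg (fun x => EinsteinPalatini.conn u x (A w)) (h.symmQ z v)
      simp only [curv, map_add, map_sub]
      linear_combination (norm := module) e1 - e2 + e3 v w z - e3 z w v + h.symmD z v w + e4
    have hric : ∀ v w, ric u' v w = ric u (A v) (A w) := by
      intro v w
      -- The new curvature endomorphism is the old one conjugated by `A`, so cyclicity of the trace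
      -- applies.
      have : (isLinearMap_curv u' v w).mk' _ = B ∘ₗ ((isLinearMap_curv u (A v) (A w)).mk' _ ∘ₗ A) := by
        ext1 z
        change curv u' v w z = B (curv u (A v) (A w) (A z))
        rw [← hcurv, h.leftInv]
      have hAB : A ∘ₗ B = LinearMap.id := LinearMap.ext h.rightInv
      rw [ric, this, LinearMap.trace_comp_comm', LinearMap.comp_assoc, hAB, LinearMap.comp_id]
      rfl
    intro v w
    rw [hric, hric, h4]

theorem minSmoothness_two_le : minSmoothness ℝ 2 ≤ ∞ := by
  rw [minSmoothness_of_isRCLikeNormedField]; exact WithTop.coe_le_coe.2 le_top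

/-- The transformation laws of the metric and of the connection hold throughout `t`; the first-order
laws are their derivatives at `φ u.1` along `z`. The connection law is kept in the form with `A`
applied to the left side, so that the inverse of `A` is never differentiated. -/
theorem jetTransform_jetLift (h : LocDiffeo φ ψ s t) {u : JCoord} (hu : u.1 ∈ s) :
    JetTransform u (jetLift φ ψ u) (fderiv ℝ ψ (φ u.1)) (fderiv ℝ φ u.1)
      (fderiv ℝ (fderiv ℝ ψ) (φ u.1))
      (fun z v w => fderiv ℝ (fderiv ℝ (fderiv ℝ ψ)) (φ u.1) z v w) := by
  have hy := h.ms hu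
  have hψ := h.symm.contDiffAt hy
  set y := φ u.1 with hydef
  have hψy : ψ y = u.1 := h.li _ hu
  have c1 : ContDiffAt ℝ ∞ (fderiv ℝ ψ) y := hψ.fderiv_right (by simp)
  have c2 : ContDiffAt ℝ ∞ (fderiv ℝ (fderiv ℝ ψ)) y := c1.fderiv_right (by simp)
  set σ : Base → Fiber := fun y => push φ ψ y (affineRep u (ψ y)) with hσ
  have hσy : σ y = (jetLift φ ψ u).2.1 := rfl
  have hσd : fderiv ℝ σ y = (jetLift φ ψ u).2.2 := rfl
  have hin : ∀ᶠ y' in 𝓝 y, y' ∈ t := h.ot.mem_nhds hy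
  have hBA : ∀ y' ∈ t, ∀ v, fderiv ℝ ψ y' (fderiv ℝ φ (ψ y') v) = v := by
    intro y' hy' v
    have := h.symm.fderiv_fderiv (h.symm.ms hy') v
    rwa [h.ri _ hy'] at this
  have gσ : ∀ y' v w, gform (σ y').1 v w =
      gform (affineRep u (ψ y')).1 (fderiv ℝ ψ y' v) (fderiv ℝ ψ y' w) := fun y' v w =>
    gform_transport _ _ _ _ _ _
  have cσ : ∀ y' ∈ t, ∀ v w, fderiv ℝ ψ y' (chris (σ y').2 v w) =
      chris (affineRep u (ψ y')).2 (fderiv ℝ ψ y' v) (fderiv ℝ ψ y' w) +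
        fderiv ℝ (fderiv ℝ ψ) y' v w := fun y' hy' v w => by
    rw [show chris (σ y').2 v w = _ from chris_transport _ _ _ _ _ _, hBA y' hy']
  have symmQ : ∀ᶠ y' in 𝓝 y, ∀ v w, fderiv ℝ (fderiv ℝ ψ) y' v w =
      fderiv ℝ (fderiv ℝ ψ) y' w v := by
    filter_upwards [hin] with y' hy' v w
    exact ((h.symm.contDiffAt hy').isSymmSndFDerivAt minSmoothness_two_le).eq v w
  have lσ : ∀ z, HasDerivAt (fun r : ℝ => σ (y + r • z)) ((jetLift φ ψ u).2.2 z) 0 := fun z => by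
    rw [← hσd]; exact hasDerivAt_line (contDiffAt_push_affineRep h u hy) z
  have lψ : ∀ z, HasDerivAt (fun r : ℝ => affineRep u (ψ (y + r • z)))
      (u.2.2 (fderiv ℝ ψ y z)) 0 := fun z => by
    have := (u.2.2.hasFDerivAt.comp_hasDerivAt (0 : ℝ)
      ((hasDerivAt_line hψ z).sub_const u.1)).const_add u.2.1
    exact this
  have lA : ∀ z v, HasDerivAt (fun r : ℝ => fderiv ℝ ψ (y + r • z) v)
      (fderiv ℝ (fderiv ℝ ψ) y z v) 0 := fun z v =>
    ((hasDerivAt_line c1 z).clm_apply (hasDerivAt_const (0 : ℝ) v)).congr_deriv (by simp)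
  have lA' : ∀ z, HasDerivAt (fun r : ℝ => fderiv ℝ ψ (y + r • z))
      (fderiv ℝ (fderiv ℝ ψ) y z) 0 := fun z => hasDerivAt_line c1 z
  have lQ : ∀ z v w, HasDerivAt (fun r : ℝ => fderiv ℝ (fderiv ℝ ψ) (y + r • z) v w)
      (fderiv ℝ (fderiv ℝ (fderiv ℝ ψ)) y z v w) 0 := fun z v w =>
    (((hasDerivAt_line c2 z).clm_apply (hasDerivAt_const (0 : ℝ) v)).clm_apply
      (hasDerivAt_const (0 : ℝ) w)).congr_deriv (by simp)
  have hev : ∀ z {p : Base → Prop}, (∀ᶠ y' in 𝓝 y, p y') → ∀ᶠ r in 𝓝 (0 : ℝ), p (y + r • z) := by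
    intro z p hp
    have hc : ContinuousAt (fun r : ℝ => y + r • z) 0 := by fun_prop
    refine hc.eventually ?_
    simpa using hp
  have haff : affineRep u (ψ y) = u.2.1 := affineRep_base h hu
  refine ⟨?_, ?_, ?_, ?_, ?_, ?_, ?_, ?_, ?_⟩
  · intro v
    have := h.fderiv_fderiv hy v
    rwa [hψy] at this
  · intro v
    have := hBA y hy v
    rwa [hψy] at this
  · exact symmQ.self_of_nhds
  · intro z v w
    have := ((c1.isSymmSndFDerivAt minSmoothness_two_le).eq z v)
    exact congrArg (fun f : Base →L[ℝ] Base => f w) this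
  · intro z v w
    refine (lQ z v w).unique ((lQ z w v).congr_of_eventuallyEq ?_)
    filter_upwards [hev z symmQ] with r hr using hr v w
  · intro v w
    have := gσ y v w
    rwa [haff] at this
  · intro v w
    have := cσ y hy v w
    rwa [haff] at this
  · intro z v w
    have e1 := hasDerivAt_gform (hasFDerivAt_fst.comp_hasDerivAt (0 : ℝ) (lσ z))
      (hasDerivAt_const (0 : ℝ) v) (hasDerivAt_const (0 : ℝ) w)
    have e2 := hasDerivAt_gform (hasFDerivAt_fst.comp_hasDerivAt (0 : ℝ) (lψ z)) (lA z v) (lA z w)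
    have e3 := e1.unique (e2.congr_of_eventuallyEq (Filter.Eventually.of_forall fun r =>
      gσ (y + r • z) v w))
    simp only [zero_smul, add_zero, Function.comp_apply, haff, gform_zero_left, gform_zero_right]
      at e3
    exact e3
  · intro z v w
    have e1 := (lA' z).clm_apply (hasDerivAt_chris (hasFDerivAt_snd.comp_hasDerivAt (0 : ℝ) (lσ z))
      (hasDerivAt_const (0 : ℝ) v) (hasDerivAt_const (0 : ℝ) w))
    have e2 := (hasDerivAt_chris (hasFDerivAt_snd.comp_hasDerivAt (0 : ℝ) (lψ z)) (lA z v)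
      (lA z w)).add (lQ z v w)
    have e3 := e1.unique (e2.congr_of_eventuallyEq (by
      filter_upwards [hev z hin] with r hr using cσ (y + r • z) hr v w))
    simp only [zero_smul, add_zero, Function.comp_apply, haff, chris_zero_left, chris_zero_right]
      at e3
    exact e3

theorem tensorConstraint_jetLift (h : LocDiffeo φ ψ s t) {u : JCoord} (hu : u.1 ∈ s)
    (hT : TensorConstraint u) : TensorConstraint (jetLift φ ψ u) :=
  (jetTransform_jetLift h hu).tensorConstraint hT

theorem jetLift_isLorentzian (h : LocDiffeo φ ψ s t) {u : JCoord} (hu : u.1 ∈ s)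
    (hL : IsLorentzian u.2.1.1) : IsLorentzian (jetLift φ ψ u).2.1.1 := by
  refine push_isLorentzian h (h.ms hu) ?_
  rw [affineRep_base h hu]; exact hL

/-- The constraints are invariant under all changes of coordinates of the base. -/
theorem jetLift_mem_constraintSet (h : LocDiffeo φ ψ s t) {u : JCoord} (hu : u.1 ∈ s)
    (hL : IsLorentzian u.2.1.1) (hc : u ∈ constraintSet) : jetLift φ ψ u ∈ constraintSet := by
  rw [mem_constraintSet_iff_tensorConstraint hL.det_ne_zero] at hc
  rw [mem_constraintSet_iff_tensorConstraint (jetLift_isLorentzian h hu hL).det_ne_zero]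
  exact tensorConstraint_jetLift h hu hc

/-- Changes of jet coordinates map semiholonomic horizontal vectors to such vectors. -/
theorem fderiv_jetLift_semiholonomic (h : LocDiffeo φ ψ s t) {u : JCoord} (hu : u.1 ∈ s)
    (v : Base) (F : Base →L[ℝ] Fiber) :
    (fderiv ℝ (jetLift φ ψ) u (v, u.2.2 v, F)).1 = fderiv ℝ φ u.1 v ∧
      (fderiv ℝ (jetLift φ ψ) u (v, u.2.2 v, F)).2.1 =
        (jetLift φ ψ u).2.2 (fderiv ℝ φ u.1 v) := by
  have hy := h.ms hu
  have hd : HasFDerivAt (jetLift φ ψ) _ u :=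
    ((jetLift_contDiffAt h hu).differentiableAt (by simp)).hasFDerivAt
  have hφ : HasFDerivAt φ _ u.1 := ((h.contDiffAt hu).differentiableAt (by simp)).hasFDerivAt
  have hφ' : HasFDerivAt (fun u : JCoord => φ u.1) _ u := hφ.comp u hasFDerivAt_fst
  have hψ : HasFDerivAt ψ _ (φ u.1) :=
    ((h.symm.contDiffAt hy).differentiableAt (by simp)).hasFDerivAt
  constructor
  · have h1 : HasFDerivAt (fun u => (jetLift φ ψ u).1) _ u := hasFDerivAt_fst.comp u hd
    have := h1.unique hφ'
    exact congrArg (fun f : JCoord →L[ℝ] Base => f (v, u.2.2 v, F)) this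
  · have haff : affineRep u (ψ (φ u.1)) = u.2.1 := affineRep_base h hu
    have hP : HasFDerivAt (fun p : Base × Fiber => push φ ψ p.1 p.2) _ (φ u.1, u.2.1) :=
      ((push_contDiffAt h hy u.2.1).differentiableAt (by simp)).hasFDerivAt
    have h1 : HasFDerivAt (fun u => (jetLift φ ψ u).2.1) _ u :=
      (hasFDerivAt_fst.comp _ hasFDerivAt_snd).comp u hd
    -- The value part of the lifted jet depends only on base point and value, so `F` plays no role.
    -- Along `(v, y_v)` its derivative is that of the transformed affine section along `φ′v`, which
    -- the lifted jet records.
    have h2 : HasFDerivAt (fun u : JCoord => push φ ψ (φ u.1) u.2.1) _ u :=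
      HasFDerivAt.comp (g := fun p : Base × Fiber => push φ ψ p.1 p.2)
        (f := fun u : JCoord => (φ u.1, u.2.1)) u hP
        (hφ'.prodMk (hasFDerivAt_fst.comp u hasFDerivAt_snd))
    have hev : (fun u => (jetLift φ ψ u).2.1) =ᶠ[𝓝 u] fun u => push φ ψ (φ u.1) u.2.1 := by
      filter_upwards [(h.os.preimage continuous_fst).mem_nhds hu] with u' hu'
      change push φ ψ (φ u'.1) (affineRep u' (ψ (φ u'.1))) = _
      rw [affineRep_base h hu']
    have h3 := h1.unique (h2.congr_of_eventuallyEq hev)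
    have hA : HasFDerivAt (fun y => affineRep u (ψ y)) _ (φ u.1) :=
      ((u.2.2.hasFDerivAt).comp (φ u.1) (hψ.sub_const u.1)).const_add u.2.1
    have hP' := hP
    rw [← haff] at hP'
    have h4 : HasFDerivAt (fun y => push φ ψ y (affineRep u (ψ y))) _ (φ u.1) :=
      HasFDerivAt.comp (g := fun p : Base × Fiber => push φ ψ p.1 p.2)
        (f := fun y => (y, affineRep u (ψ y))) (φ u.1) hP' ((hasFDerivAt_id _).prodMk hA)
    have h5 : (jetLift φ ψ u).2.2 = _ := h4.fderiv
    rw [h5]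
    have h6 := congrArg (fun f : JCoord →L[ℝ] Fiber => f (v, u.2.2 v, F)) h3
    refine h6.trans ?_
    have h7 : fderiv ℝ ψ (φ u.1) (fderiv ℝ φ u.1 v) = v := by
      have := h.symm.fderiv_fderiv hu v
      exact this
    simp only [ContinuousLinearMap.comp_apply, ContinuousLinearMap.prod_apply, h7, haff]
    rfl

end Covariance

/-! ### Carrying the local lift from one chart to another. -/

section Lift

theorem eventually_mem_source {M : Type*} [TopologicalSpace M] {e e' : OpenPartialHomeomorph M Base}
    {x : Base} (h1 : x ∈ e.target) (h2 : e.symm x ∈ e'.source) :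
    ∀ᶠ y in 𝓝 x, y ∈ e.target ∧ e.symm y ∈ e'.source :=
  (e.symm ≫ₕ e').open_source.mem_nhds (x := x) ⟨h1, h2⟩

theorem fderiv_chartChange_self {M : Type*} [TopologicalSpace M] {e : OpenPartialHomeomorph M Base}
    {x : Base} (h1 : x ∈ e.target) (v : Base) : fderiv ℝ (e ∘ e.symm) x v = v := by
  have ev : (e ∘ e.symm) =ᶠ[𝓝 x] id :=
    Filter.eventuallyEq_of_mem (e.open_target.mem_nhds h1) fun y hy => e.right_inv hy
  rw [ev.fderiv_eq, fderiv_id]; rfl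

/-- The lift `localLift` in the chart `e'`, expressed in the chart `e`. -/
noncomputable def liftIn {M : Type*} [TopologicalSpace M] (e' e : OpenPartialHomeomorph M Base)
    (u : JCoord) : Base →L[ℝ] JCoord :=
  (fderiv ℝ (transition e' e) (transition e e' u)).comp
    ((localLift (transition e e' u)).comp (fderiv ℝ (e' ∘ e.symm) u.1))

theorem liftIn_apply {M : Type*} [TopologicalSpace M] (e' e : OpenPartialHomeomorph M Base)
    (u : JCoord) (v : Base) :
    liftIn e' e u v = fderiv ℝ (transition e' e) (transition e e' u)
      (localLift (transition e e' u) (fderiv ℝ (e' ∘ e.symm) u.1 v)) := rfl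

variable {M : Type*} [TopologicalSpace M] [ChartedSpace Base M] [IsManifold (𝓡 4) ∞ M]
  {e e' e'' : OpenPartialHomeomorph M Base}

theorem contDiffAt_transition (he : e ∈ IsManifold.maximalAtlas (𝓡 4) ∞ M)
    (he' : e' ∈ IsManifold.maximalAtlas (𝓡 4) ∞ M) {u : JCoord} (h1 : u.1 ∈ e.target)
    (h2 : e.symm u.1 ∈ e'.source) : ContDiffAt ℝ ∞ (transition e e') u :=
  jetLift_contDiffAt (locDiffeo_transition he he') ⟨h1, h2⟩

theorem contDiffAt_chartChange (he : e ∈ IsManifold.maximalAtlas (𝓡 4) ∞ M)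
    (he' : e' ∈ IsManifold.maximalAtlas (𝓡 4) ∞ M) {x : Base} (h1 : x ∈ e.target)
    (h2 : e.symm x ∈ e'.source) : ContDiffAt ℝ ∞ (e' ∘ e.symm) x :=
  (locDiffeo_transition he he').contDiffAt ⟨h1, h2⟩

theorem fderiv_transition_comp (he : e ∈ IsManifold.maximalAtlas (𝓡 4) ∞ M)
    (he' : e' ∈ IsManifold.maximalAtlas (𝓡 4) ∞ M) (he'' : e'' ∈ IsManifold.maximalAtlas (𝓡 4) ∞ M)
    {u : JCoord} (h1 : u.1 ∈ e.target) (h2 : e.symm u.1 ∈ e'.source)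
    (h3 : e.symm u.1 ∈ e''.source) (k : JCoord) :
    fderiv ℝ (transition e' e'') (transition e e' u) (fderiv ℝ (transition e e') u k) =
      fderiv ℝ (transition e e'') u k := by
  have d1 : DifferentiableAt ℝ (transition e e') u :=
    (contDiffAt_transition he he' h1 h2).differentiableAt (by simp)
  have d2 : DifferentiableAt ℝ (transition e' e'') (transition e e' u) := by
    refine (contDiffAt_transition he' he'' ?_ ?_).differentiableAt (by simp)
    · exact e'.map_source h2
    · rw [transition_fst, e'.left_inv h2]; exact h3
  have ev : (transition e' e'' ∘ transition e e') =ᶠ[𝓝 u] transition e e'' := by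
    filter_upwards [continuous_fst.continuousAt.eventually (eventually_mem_source h1 h2),
      continuous_fst.continuousAt.eventually (eventually_mem_source h1 h3)] with v hv hv'
    exact transition_comp he he' he'' hv.1 hv.2 hv'.2
  rw [← ev.fderiv_eq, fderiv_comp _ d2 d1]
  rfl

theorem fderiv_chartChange_comp (he : e ∈ IsManifold.maximalAtlas (𝓡 4) ∞ M)
    (he' : e' ∈ IsManifold.maximalAtlas (𝓡 4) ∞ M) (he'' : e'' ∈ IsManifold.maximalAtlas (𝓡 4) ∞ M)
    {x : Base} (h1 : x ∈ e.target) (h2 : e.symm x ∈ e'.source)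
    (h3 : e.symm x ∈ e''.source) (v : Base) :
    fderiv ℝ (e'' ∘ e'.symm) (e' (e.symm x)) (fderiv ℝ (e' ∘ e.symm) x v) =
      fderiv ℝ (e'' ∘ e.symm) x v := by
  have d1 : DifferentiableAt ℝ (e' ∘ e.symm) x :=
    (contDiffAt_chartChange he he' h1 h2).differentiableAt (by simp)
  have d2 : DifferentiableAt ℝ (e'' ∘ e'.symm) ((e' ∘ e.symm) x) := by
    refine (contDiffAt_chartChange he' he'' ?_ ?_).differentiableAt (by simp)
    · exact e'.map_source h2
    · rw [Function.comp_apply, e'.left_inv h2]; exact h3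
  have ev : ((e'' ∘ e'.symm) ∘ (e' ∘ e.symm)) =ᶠ[𝓝 x] (e'' ∘ e.symm) := by
    filter_upwards [eventually_mem_source h1 h2] with y hy
    simp only [Function.comp_apply, e'.left_inv hy.2]
  rw [← ev.fderiv_eq, fderiv_comp _ d2 d1]
  rfl

theorem liftIn_semiholonomic (he : e ∈ IsManifold.maximalAtlas (𝓡 4) ∞ M)
    (he' : e' ∈ IsManifold.maximalAtlas (𝓡 4) ∞ M) {u : JCoord} (h1 : u.1 ∈ e.target)
    (h2 : e.symm u.1 ∈ e'.source) (v : Base) :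
    (liftIn e' e u v).1 = v ∧ (liftIn e' e u v).2.1 = u.2.2 v := by
  have h3 : e'.symm (e' (e.symm u.1)) ∈ e.source := by
    rw [e'.left_inv h2]; exact e.map_target h1
  have hs : (transition e e' u).1 ∈ (e'.symm ≫ₕ e).source := ⟨e'.map_source h2, h3⟩
  have h := fderiv_jetLift_semiholonomic (locDiffeo_transition he' he) hs
    (fderiv ℝ (e' ∘ e.symm) u.1 v) (localLift (transition e e' u)
      (fderiv ℝ (e' ∘ e.symm) u.1 v)).2.2
  have hv : fderiv ℝ (e ∘ e'.symm) (transition e e' u).1 (fderiv ℝ (e' ∘ e.symm) u.1 v) = v := by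
    rw [transition_fst, fderiv_chartChange_comp he he' he h1 h2 (e.map_target h1),
      fderiv_chartChange_self h1]
  rw [hv] at h
  refine ⟨h.1, h.2.trans ?_⟩
  change (transition e' e (transition e e' u)).2.2 v = _
  rw [transition_comp he he' he h1 h2 (e.map_target h1), transition_self he h1]

theorem contDiffAt_liftIn (he : e ∈ IsManifold.maximalAtlas (𝓡 4) ∞ M)
    (he' : e' ∈ IsManifold.maximalAtlas (𝓡 4) ∞ M) {u : JCoord} (h1 : u.1 ∈ e.target)
    (h2 : e.symm u.1 ∈ e'.source) (v : Base) : ContDiffAt ℝ ∞ (fun u => liftIn e' e u v) u := by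
  have c1 := contDiffAt_transition he he' h1 h2
  have c2 : ContDiffAt ℝ ∞ (fderiv ℝ (transition e' e)) (transition e e' u) := by
    refine (contDiffAt_transition he' he (e'.map_source h2) ?_).fderiv_right (by simp)
    rw [transition_fst, e'.left_inv h2]; exact e.map_target h1
  have c3 : ContDiffAt ℝ ∞ (fun u : JCoord => fderiv ℝ (e' ∘ e.symm) u.1 v) u := by
    have : ContDiffAt ℝ ∞ (fderiv ℝ (e' ∘ e.symm)) u.1 :=
      (contDiffAt_chartChange he he' h1 h2).fderiv_right (by simp)
    exact (ContDiffAt.comp (g := fderiv ℝ (e' ∘ e.symm)) u this contDiffAt_fst).clm_apply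
      contDiffAt_const
  exact (c2.comp u c1).clm_apply (ContDiffAt.comp (g := fun p : JCoord × Base => localLift p.1 p.2)
    (f := fun u => (transition e e' u, fderiv ℝ (e' ∘ e.symm) u.1 v)) u
    contDiff_localLift.contDiffAt (c1.prodMk c3))

/-- By the chain rule, the lift defined in `e'` is a geometric object: its expressions in `e` and
`e''` correspond under the change of jet coordinates. -/
theorem fderiv_transition_liftIn (he : e ∈ IsManifold.maximalAtlas (𝓡 4) ∞ M)
    (he' : e' ∈ IsManifold.maximalAtlas (𝓡 4) ∞ M) (he'' : e'' ∈ IsManifold.maximalAtlas (𝓡 4) ∞ M)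
    {u : JCoord} (h1 : u.1 ∈ e.target) (h2 : e.symm u.1 ∈ e'.source)
    (h3 : e.symm u.1 ∈ e''.source) (v : Base) :
    fderiv ℝ (transition e e'') u (liftIn e' e u v) =
      liftIn e' e'' (transition e e'' u) (fderiv ℝ (e'' ∘ e.symm) u.1 v) := by
  have t1 : transition e' e (transition e e' u) = u := by
    rw [transition_comp he he' he h1 h2 (e.map_target h1), transition_self he h1]
  have t2 : transition e'' e' (transition e e'' u) = transition e e' u :=
    transition_comp he he'' he' h1 h3 h2
  have s1 : (transition e e' u).1 ∈ e'.target := e'.map_source h2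
  have s2 : e'.symm (transition e e' u).1 = e.symm u.1 := e'.left_inv h2
  rw [liftIn_apply, liftIn_apply, t2]
  conv_lhs => rw [← t1]
  rw [t1, transition_fst, fderiv_chartChange_comp he he'' he' h1 h3 h2]
  have := fderiv_transition_comp he' he he'' s1 (by rw [s2]; exact e.map_target h1)
    (by rw [s2]; exact h3) (localLift (transition e e' u) (fderiv ℝ (e' ∘ e.symm) u.1 v))
  rw [t1] at this
  exact this

end Lift

/-! ### Gluing the lifts by a partition of unity. -/

section GlobalLift

variable {M : Type*} [TopologicalSpace M] [ChartedSpace Base M]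

/-- The lifts `localLift` in the preferred charts, glued by a partition of unity and expressed in
the chart `e`. -/
noncomputable def globalLift (ρ : SmoothPartitionOfUnity M (𝓡 4) M)
    (e : OpenPartialHomeomorph M Base) (u : JCoord) (v : Base) : JCoord :=
  ∑ i ∈ ρ.finsupport (e.symm u.1), ρ i (e.symm u.1) • liftIn (chartAt Base i) e u v

variable {ρ : SmoothPartitionOfUnity M (𝓡 4) M} {e e' : OpenPartialHomeomorph M Base}

theorem isLinearMap_globalLift (e : OpenPartialHomeomorph M Base) (u : JCoord) :
    IsLinearMap ℝ (globalLift ρ e u) := by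
  constructor
  · intro v w
    simp only [globalLift, map_add, smul_add, Finset.sum_add_distrib]
  · intro c v
    simp only [globalLift, map_smul, Finset.smul_sum, smul_comm c]

theorem mem_source_of_mem_fintsupport (hρ : ρ.IsSubordinate fun i => (chartAt Base i).source)
    {x i : M} (h : i ∈ ρ.fintsupport x) : x ∈ (chartAt Base i).source :=
  hρ i ((ρ.mem_fintsupport_iff x i).1 h)

theorem mem_source_of_mem_finsupport (hρ : ρ.IsSubordinate fun i => (chartAt Base i).source)
    {x i : M} (h : i ∈ ρ.finsupport x) : x ∈ (chartAt Base i).source :=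
  mem_source_of_mem_fintsupport hρ (ρ.finsupport_subset_fintsupport x h)

variable [IsManifold (𝓡 4) ∞ M]

/-- Semiholonomy prescribes two components and leaves the third free, an affine condition preserved
by weights with sum 1. -/
theorem globalLift_semiholonomic (hρ : ρ.IsSubordinate fun i => (chartAt Base i).source)
    (he : e ∈ IsManifold.maximalAtlas (𝓡 4) ∞ M) {u : JCoord} (h1 : u.1 ∈ e.target) (v : Base) :
    (globalLift ρ e u v).1 = v ∧ (globalLift ρ e u v).2.1 = u.2.2 v := by
  have hs : ∀ i ∈ ρ.finsupport (e.symm u.1), (liftIn (chartAt Base i) e u v).1 = v ∧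
      (liftIn (chartAt Base i) e u v).2.1 = u.2.2 v := fun i hi =>
    liftIn_semiholonomic he (chartAt_mem i) h1 (mem_source_of_mem_finsupport hρ hi) v
  have h1 : ∑ i ∈ ρ.finsupport (e.symm u.1), ρ i (e.symm u.1) = 1 :=
    ρ.sum_finsupport _ (Set.mem_univ _)
  simp only [globalLift, Prod.fst_sum, Prod.snd_sum, Prod.smul_fst, Prod.smul_snd]
  rw [Finset.sum_congr rfl fun i hi => congrArg (ρ i (e.symm u.1) • ·) (hs i hi).1,
    Finset.sum_congr rfl fun i hi => congrArg (ρ i (e.symm u.1) • ·) (hs i hi).2,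
    ← Finset.sum_smul, ← Finset.sum_smul, h1, one_smul, one_smul]
  exact ⟨rfl, rfl⟩

theorem contDiffAt_globalLift (hρ : ρ.IsSubordinate fun i => (chartAt Base i).source)
    (he : e ∈ IsManifold.maximalAtlas (𝓡 4) ∞ M) {u : JCoord} (h1 : u.1 ∈ e.target) (v : Base) :
    ContDiffAt ℝ ∞ (fun u => globalLift ρ e u v) u := by
  have hc : ContinuousAt (fun u : JCoord => e.symm u.1) u :=
    (e.continuousAt_symm h1).comp continuous_fst.continuousAt
  -- The index set of the sum varies with the point, but near `u` it stays inside the fixed finite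
  -- set `fintsupport`, where the additional terms have weight zero.
  have ev : (fun u => globalLift ρ e u v) =ᶠ[𝓝 u] fun u' =>
      ∑ i ∈ ρ.fintsupport (e.symm u.1), ρ i (e.symm u'.1) • liftIn (chartAt Base i) e u' v := by
    filter_upwards [hc.eventually (ρ.eventually_finsupport_subset (e.symm u.1))] with u' hu'
    refine Finset.sum_subset hu' fun i _ hi => ?_
    rw [ρ.mem_finsupport, Function.notMem_support] at hi
    rw [hi, zero_smul]
  refine ContDiffAt.congr_of_eventuallyEq (ContDiffAt.sum fun i hi => ?_) ev
  have hρi : ContDiffAt ℝ ∞ (fun u : JCoord => ρ i (e.symm u.1)) u := by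
    have h2 : ContMDiffAt 𝓘(ℝ, Base) 𝓘(ℝ, ℝ) ∞ (ρ i ∘ e.symm) u.1 :=
      (ρ i).contMDiff.contMDiffAt.comp u.1 (contMDiffAt_symm_of_mem_maximalAtlas he h1)
    exact ContDiffAt.comp (g := ρ i ∘ e.symm) u h2.contDiffAt contDiffAt_fst
  exact hρi.smul (contDiffAt_liftIn he (chartAt_mem i) h1 (mem_source_of_mem_fintsupport hρ hi) v)

theorem fderiv_transition_globalLift (hρ : ρ.IsSubordinate fun i => (chartAt Base i).source)
    (he : e ∈ IsManifold.maximalAtlas (𝓡 4) ∞ M) (he' : e' ∈ IsManifold.maximalAtlas (𝓡 4) ∞ M)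
    {u : JCoord} (h1 : u.1 ∈ e.target) (h2 : e.symm u.1 ∈ e'.source) (v : Base) :
    fderiv ℝ (transition e e') u (globalLift ρ e u v) =
      globalLift ρ e' (transition e e' u) (fderiv ℝ (e' ∘ e.symm) u.1 v) := by
  have hx : e'.symm (transition e e' u).1 = e.symm u.1 := e'.left_inv h2
  rw [globalLift, globalLift, hx, map_sum]
  refine Finset.sum_congr rfl fun i hi => ?_
  rw [map_smul, fderiv_transition_liftIn he (chartAt_mem i) he' h1
    (mem_source_of_mem_finsupport hρ hi) h2]

end GlobalLift

/-! ### Differentials of charts of `M` and of `J¹π`. -/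

section JetManifold

variable {M : Type*} [TopologicalSpace M] [ChartedSpace Base M]
  {e e' : OpenPartialHomeomorph M Base}

theorem localCoord_mem_target (p : JetBundle M) :
    p.localCoord.1 ∈ (chartAt Base p.base).target :=
  (chartAt Base p.base).map_source (mem_chart_source _ _)

theorem symm_localCoord (p : JetBundle M) : (chartAt Base p.base).symm p.localCoord.1 = p.base :=
  (chartAt Base p.base).left_inv (mem_chart_source _ _)

theorem mfderiv_chart_apply (he : e ∈ IsManifold.maximalAtlas (𝓡 4) ∞ M) {x : M}
    (h : x ∈ e.source) (v : Base) :
    mfderiv (𝓡 4) (𝓡 4) e x v = fderiv ℝ (e ∘ (chartAt Base x).symm) (chartAt Base x x) v := by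
  have hd : MDifferentiableAt (𝓡 4) (𝓡 4) e x :=
    (contMDiffAt_of_mem_maximalAtlas he h).mdifferentiableAt (by simp)
  have hm : mfderiv (𝓡 4) (𝓡 4) e x =
      fderiv ℝ (e ∘ (chartAt Base x).symm) (chartAt Base x x) := by
    rw [hd.mfderiv]
    simp only [mfld_simps, fderivWithin_univ]
    rfl
  rw [hm]
  rfl

variable [IsManifold (𝓡 4) ∞ M]

/-- `jetChart` as a local homeomorphism. -/
noncomputable def jetHomeo (e : OpenPartialHomeomorph M Base)
    (he : e ∈ IsManifold.maximalAtlas (𝓡 4) ∞ M) : OpenPartialHomeomorph (JetBundle M) JCoord :=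
  (jetCore M).openPartialHomeomorph (jetChart e he) ⟨e, he, rfl⟩

theorem jetHomeo_mem (he : e ∈ IsManifold.maximalAtlas (𝓡 4) ∞ M) :
    jetHomeo e he ∈ IsManifold.maximalAtlas 𝓘(ℝ, JCoord) ∞ (JetBundle M) := by
  refine StructureGroupoid.subset_maximalAtlas _ ?_
  change _ ∈ ⋃ (c : PartialEquiv (JetBundle M) JCoord) (h : c ∈ (jetCore M).atlas),
    {(jetCore M).openPartialHomeomorph c h}
  simp only [Set.mem_iUnion, Set.mem_singleton_iff]
  exact ⟨_, ⟨e, he, rfl⟩, rfl⟩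

theorem jetChart_apply (he : e ∈ IsManifold.maximalAtlas (𝓡 4) ∞ M) (p : JetBundle M) :
    jetChart e he p = transition (chartAt Base p.base) e p.localCoord := rfl

theorem jetChart_fst (he : e ∈ IsManifold.maximalAtlas (𝓡 4) ∞ M) (p : JetBundle M) :
    (jetChart e he p).1 = e p.base := by
  rw [jetChart_apply, transition_fst, symm_localCoord]

theorem transition_jetChart (he : e ∈ IsManifold.maximalAtlas (𝓡 4) ∞ M)
    (he' : e' ∈ IsManifold.maximalAtlas (𝓡 4) ∞ M) {p : JetBundle M} (h : p.base ∈ e.source)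
    (h' : p.base ∈ e'.source) : transition e e' (jetChart e he p) = jetChart e' he' p :=
  transition_comp (chartAt_mem _) he he' (localCoord_mem_target p)
    (by rwa [symm_localCoord]) (by rwa [symm_localCoord])

theorem jetChart_chartAt (p : JetBundle M) :
    jetChart (chartAt Base p.base) (chartAt_mem p.base) p = p.localCoord :=
  transition_self (chartAt_mem _) (localCoord_mem_target p)

theorem extChartAt_jetBundle (p : JetBundle M) :
    (extChartAt 𝓘(ℝ, JCoord) p : JetBundle M → JCoord) =
      jetChart (chartAt Base p.base) (chartAt_mem p.base) := rfl

/-- Tangent vectors at `p` are identified with coordinate vectors through the preferred chart at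
`p`, so the differential of a jet chart is that of a change of jet coordinates. -/
theorem jetChartDeriv_apply (he : e ∈ IsManifold.maximalAtlas (𝓡 4) ∞ M) {p : JetBundle M}
    (h : p.base ∈ e.source) (k : JCoord) :
    jetChartDeriv e he p k = fderiv ℝ (transition (chartAt Base p.base) e) p.localCoord k := by
  have hd : MDifferentiableAt 𝓘(ℝ, JCoord) 𝓘(ℝ, JCoord) (jetChart e he) p :=
    (contMDiffAt_of_mem_maximalAtlas (jetHomeo_mem he) (x := p) h).mdifferentiableAt (by simp)
  have ev : writtenInExtChartAt 𝓘(ℝ, JCoord) 𝓘(ℝ, JCoord) p (jetChart e he) =ᶠ[𝓝 p.localCoord]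
      transition (chartAt Base p.base) e := by
    have hs : p.localCoord ∈ ((jetHomeo (chartAt Base p.base) (chartAt_mem _)).symm ≫ₕ
        jetHomeo e he).source := by
      change p.localCoord ∈ ((jetChart (chartAt Base p.base) (chartAt_mem _)).symm.trans
        (jetChart e he)).source
      rw [jetChart_trans_source]
      exact ⟨⟨localCoord_mem_target p, by
        change (chartAt Base p.base).symm p.localCoord.1 ∈ e.source
        rwa [symm_localCoord]⟩, p.lorentz⟩
    filter_upwards [((jetHomeo (chartAt Base p.base) (chartAt_mem _)).symm ≫ₕ
        jetHomeo e he).open_source.mem_nhds hs] with u hu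
    exact jetChart_transition (chartAt_mem _) he hu
  have h0 : extChartAt 𝓘(ℝ, JCoord) p p = p.localCoord := jetChart_chartAt p
  have hm : mfderiv 𝓘(ℝ, JCoord) 𝓘(ℝ, JCoord) (jetChart e he) p =
      fderiv ℝ (transition (chartAt Base p.base) e) p.localCoord := by
    rw [hd.mfderiv, h0]
    simp only [modelWithCornersSelf_coe, Set.range_id, fderivWithin_univ]
    exact ev.fderiv_eq
  change mfderiv 𝓘(ℝ, JCoord) 𝓘(ℝ, JCoord) (jetChart e he) p k = _
  rw [hm]
  rfl

end JetManifold

/-! ### Velocities of curves given in jet coordinates. -/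

section Velocity

variable {M : Type*} [TopologicalSpace M] [ChartedSpace Base M] [IsManifold (𝓡 4) ∞ M]
  {e e' : OpenPartialHomeomorph M Base}

theorem contMDiffAt_jetChart_symm_comp (he : e ∈ IsManifold.maximalAtlas (𝓡 4) ∞ M)
    {γ : ℝ → JCoord} (hγ : ContDiffAt ℝ ∞ γ 0) (h : γ 0 ∈ (jetChart e he).target) :
    ContMDiffAt 𝓘(ℝ, ℝ) 𝓘(ℝ, JCoord) ∞ ((jetChart e he).symm ∘ γ) 0 :=
  ContMDiffAt.comp (I' := 𝓘(ℝ, JCoord)) (0 : ℝ)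
    (contMDiffAt_symm_of_mem_maximalAtlas (jetHomeo_mem he) h) hγ.contMDiffAt

theorem mfderiv_jetChart_symm_comp (he : e ∈ IsManifold.maximalAtlas (𝓡 4) ∞ M)
    {γ : ℝ → JCoord} (hγ : ContDiffAt ℝ ∞ γ 0) {p : JetBundle M} (hp : p.base ∈ e.source)
    (h0 : γ 0 = jetChart e he p) {w : JCoord} (hw : HasDerivAt γ w 0) :
    (mfderiv 𝓘(ℝ, ℝ) 𝓘(ℝ, JCoord) ((jetChart e he).symm ∘ γ) 0 (1 : ℝ) : JCoord) =
      fderiv ℝ (transition e (chartAt Base p.base)) (jetChart e he p) w := by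
  have ht : jetChart e he p ∈ (jetChart e he).target := (jetChart e he).map_source hp
  have hp0 : ((jetChart e he).symm ∘ γ) 0 = p := by
    rw [Function.comp_apply, h0]; exact (jetChart e he).left_inv hp
  have hd := (contMDiffAt_jetChart_symm_comp he hγ (h0 ▸ ht)).mdifferentiableAt (by simp)
  have ev : writtenInExtChartAt 𝓘(ℝ, ℝ) 𝓘(ℝ, JCoord) 0 ((jetChart e he).symm ∘ γ) =ᶠ[𝓝 (0 : ℝ)]
      transition e (chartAt Base p.base) ∘ γ := by
    have hs : γ 0 ∈ ((jetHomeo e he).symm ≫ₕ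
        jetHomeo (chartAt Base p.base) (chartAt_mem _)).source := by
      rw [h0]
      refine ⟨ht, ?_⟩
      change (jetChart e he).symm (jetChart e he p) ∈
        (jetChart (chartAt Base p.base) (chartAt_mem _)).source
      rw [(jetChart e he).left_inv hp]
      exact mem_chart_source Base p.base
    filter_upwards [hγ.continuousAt.eventually
      (((jetHomeo e he).symm ≫ₕ jetHomeo (chartAt Base p.base)
        (chartAt_mem _)).open_source.mem_nhds hs)] with r hr
    change extChartAt 𝓘(ℝ, JCoord) (((jetChart e he).symm ∘ γ) 0) ((jetChart e he).symm (γ r)) = _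
    rw [hp0, extChartAt_jetBundle]
    exact jetChart_transition he (chartAt_mem _) hr
  have hm : mfderiv 𝓘(ℝ, ℝ) 𝓘(ℝ, JCoord) ((jetChart e he).symm ∘ γ) 0 =
      fderiv ℝ (transition e (chartAt Base p.base) ∘ γ) 0 := by
    rw [hd.mfderiv]
    simp only [modelWithCornersSelf_coe, Set.range_id, fderivWithin_univ]
    exact ev.fderiv_eq
  have hT : DifferentiableAt ℝ (transition e (chartAt Base p.base)) (jetChart e he p) := by
    refine (contDiffAt_transition he (chartAt_mem _) ht.1 ?_).differentiableAt (by simp)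
    rw [jetChart_fst, e.left_inv hp]
    exact mem_chart_source Base p.base
  have hc : HasDerivAt (transition e (chartAt Base p.base) ∘ γ)
      (fderiv ℝ (transition e (chartAt Base p.base)) (jetChart e he p) w) 0 :=
    HasFDerivAt.comp_hasDerivAt (l := transition e (chartAt Base p.base)) 0
      (h0 ▸ hT.hasFDerivAt) hw
  rw [hm]
  exact hc.deriv

end Velocity

/-! ### The shear as a change of charts. -/

section Slice

/-- `shear` as a homeomorphism. -/
noncomputable def shearHomeo : JCoord ≃ₜ JCoord where
  toFun := shear
  invFun := shearInv
  left_inv := shearInv_shear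
  right_inv := shear_shearInv
  continuous_toFun := contDiff_shear.continuous
  continuous_invFun := contDiff_shearInv.continuous

theorem shearHomeo_mem_groupoid :
    shearHomeo.toOpenPartialHomeomorph ∈ contDiffGroupoid ∞ 𝓘(ℝ, JCoord) := by
  refine mem_groupoid_of_pregroupoid.2 ⟨?_, ?_⟩
  · simp only [contDiffPregroupoid, mfld_simps]
    exact contDiff_shear.contDiffOn
  · simp only [contDiffPregroupoid, mfld_simps]
    exact contDiff_shearInv.contDiffOn

theorem trans_mem_maximalAtlas {H N : Type*} [TopologicalSpace H] [TopologicalSpace N]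
    [ChartedSpace H N] {G : StructureGroupoid H} {c : OpenPartialHomeomorph N H}
    {s : OpenPartialHomeomorph H H} (hc : c ∈ G.maximalAtlas N) (hs : s ∈ G) :
    c ≫ₕ s ∈ G.maximalAtlas N := by
  refine mem_maximalAtlas_iff.2 fun c' hc' => ?_
  obtain ⟨h1, h2⟩ := mem_maximalAtlas_iff.1 hc c' hc'
  constructor
  · rw [OpenPartialHomeomorph.trans_symm_eq_symm_trans_symm, OpenPartialHomeomorph.trans_assoc]
    exact G.trans (G.symm hs) h1
  · rw [← OpenPartialHomeomorph.trans_assoc]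
    exact G.trans h2 hs

theorem fderiv_shearInv_shear (u w : JCoord) :
    fderiv ℝ shearInv (shear u) (fderiv ℝ shear u w) = w := by
  have h : HasFDerivAt (shearInv ∘ shear) _ u := HasFDerivAt.comp (g := shearInv) (f := shear) u
    (contDiff_shearInv.differentiable (by simp) _).hasFDerivAt
    (contDiff_shear.differentiable (by simp) _).hasFDerivAt
  have e : shearInv ∘ shear = id := funext shearInv_shear
  rw [e] at h
  exact (DFunLike.congr_fun (h.unique (hasFDerivAt_id u)) w)

end Slice

/-! ### The constraint submanifold and its tangent vectors. -/

section Submanifold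

variable {M : Type*} [TopologicalSpace M] [ChartedSpace Base M] [IsManifold (𝓡 4) ∞ M]
  {e : OpenPartialHomeomorph M Base}

variable (M) in
/-- The submanifold of `J¹π` defined by the constraints. -/
def constraintSubmanifold : Set (JetBundle M) := {p | p.localCoord ∈ constraintSet}

/-- The preferred charts in the definition are not assumed adapted to `η`, so invariance is needed
under all coordinate changes and not only under volume-preserving ones. -/
theorem mem_constraintSubmanifold_iff (he : e ∈ IsManifold.maximalAtlas (𝓡 4) ∞ M)
    {p : JetBundle M} (hp : p.base ∈ e.source) :
    p ∈ constraintSubmanifold M ↔ jetChart e he p ∈ constraintSet := by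
  have key : ∀ {e' e'' : OpenPartialHomeomorph M Base}
      (he' : e' ∈ IsManifold.maximalAtlas (𝓡 4) ∞ M)
      (he'' : e'' ∈ IsManifold.maximalAtlas (𝓡 4) ∞ M), p.base ∈ e'.source → p.base ∈ e''.source →
      jetChart e' he' p ∈ constraintSet → jetChart e'' he'' p ∈ constraintSet := by
    intro e' e'' he' he'' h' h'' hc
    have ht := (jetChart e' he').map_source h'
    rw [← transition_jetChart he' he'' h' h'']
    refine jetLift_mem_constraintSet (locDiffeo_transition he' he'') ⟨ht.1, ?_⟩ ht.2 hc
    change e'.symm _ ∈ e''.source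
    rwa [jetChart_fst, e'.left_inv h']
  change p.localCoord ∈ constraintSet ↔ _
  rw [← jetChart_chartAt]
  exact ⟨key _ _ (mem_chart_source Base p.base) hp, key _ _ hp (mem_chart_source Base p.base)⟩

/-- Jet coordinates followed by the shear form a slice chart with slice `constraintSpace`. -/
theorem isEmbeddedSubmanifold_constraintSubmanifold :
    IsEmbeddedSubmanifold (Module.finrank ℝ constraintSpace) (constraintSubmanifold M) := by
  intro p _
  refine ⟨jetHomeo (chartAt Base p.base) (chartAt_mem _) ≫ₕ shearHomeo.toOpenPartialHomeomorph,
    trans_mem_maximalAtlas (jetHomeo_mem _) shearHomeo_mem_groupoid,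
    ⟨mem_chart_source Base p.base, trivial⟩, constraintSpace, rfl, fun q hq => ?_⟩
  have hq : q.base ∈ (chartAt Base p.base).source := hq.1
  rw [mem_constraintSubmanifold_iff (chartAt_mem _) hq,
    mem_constraintSet_iff ((jetChart _ (chartAt_mem p.base)).map_source hq).2.det_ne_zero]
  rfl

theorem fderiv_transition_mem_tangentSubspace (he : e ∈ IsManifold.maximalAtlas (𝓡 4) ∞ M)
    {p : JetBundle M} (hp : p.base ∈ e.source) (hS : p ∈ constraintSubmanifold M) {w : JCoord}
    (hw : fderiv ℝ shear (jetChart e he p) w ∈ constraintSpace) :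
    (fderiv ℝ (transition e (chartAt Base p.base)) (jetChart e he p) w : JCoord) ∈
      tangentSubspace (constraintSubmanifold M) p := by
  set u := jetChart e he p with hu
  have ht : u ∈ (jetChart e he).target := (jetChart e he).map_source hp
  -- A straight line in the sheared coordinates stays in the linear `constraintSpace`; its preimage
  -- is a curve of constrained jets with velocity `w`.
  set γ : ℝ → JCoord := fun r => shearInv (shear u + r • fderiv ℝ shear u w) with hγ
  have γ0 : γ 0 = u := by simp [hγ, shearInv_shear]
  have γs : ContDiff ℝ ∞ γ := contDiff_shearInv.comp (by fun_prop)
  have γd : HasDerivAt γ w 0 := by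
    have h1 : HasDerivAt (fun r : ℝ => shear u + r • fderiv ℝ shear u w) (fderiv ℝ shear u w) 0 := by
      simpa using ((hasDerivAt_id (0 : ℝ)).smul_const (fderiv ℝ shear u w)).const_add (shear u)
    have h2 := HasFDerivAt.comp_hasDerivAt (l := shearInv)
      (f := fun r : ℝ => shear u + r • fderiv ℝ shear u w) 0
      (contDiff_shearInv.differentiable (by simp) _).hasFDerivAt h1
    simp only [zero_smul, add_zero, fderiv_shearInv_shear] at h2
    exact h2
  refine Submodule.subset_span ⟨(jetChart e he).symm ∘ γ,
    contMDiffAt_jetChart_symm_comp he γs.contDiffAt (γ0 ▸ ht), ?_, ?_,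
    mfderiv_jetChart_symm_comp he γs.contDiffAt hp γ0 γd⟩
  · rw [Function.comp_apply, γ0]; exact (jetChart e he).left_inv hp
  -- The curve must remain over the chart and keep a Lorentzian metric; this holds near `r = 0` as
  -- the target is open.
  · have ho : ∀ᶠ r in 𝓝 (0 : ℝ), γ r ∈ (jetChart e he).target :=
      γs.continuous.continuousAt.eventually
        ((jetHomeo e he).open_target.mem_nhds (by rw [γ0]; exact ht))
    filter_upwards [ho] with r hr
    rw [Function.comp_apply, mem_constraintSubmanifold_iff he ((jetChart e he).map_target hr),
      (jetChart e he).right_inv hr, mem_constraintSet_iff hr.2.det_ne_zero, hγ, shear_shearInv]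
    exact constraintSpace.add_mem ((mem_constraintSet_iff ht.2.det_ne_zero).1
      ((mem_constraintSubmanifold_iff he hp).1 hS)) (constraintSpace.smul_mem _ hw)

/-- Each local lift is tangent in its own chart, and tangent vectors form a linear space, so the
weighted sum is tangent. -/
theorem globalLift_mem_tangentSubspace {ρ : SmoothPartitionOfUnity M (𝓡 4) M}
    (hρ : ρ.IsSubordinate fun i => (chartAt Base i).source) {p : JetBundle M}
    (hS : p ∈ constraintSubmanifold M) (v : Base) :
    (globalLift ρ (chartAt Base p.base) p.localCoord v : JCoord) ∈
      tangentSubspace (constraintSubmanifold M) p := by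
  unfold globalLift
  rw [symm_localCoord]
  refine Submodule.sum_mem (tangentSubspace (constraintSubmanifold M) p) fun i hi =>
    Submodule.smul_mem (tangentSubspace (constraintSubmanifold M) p) _ ?_
  have hi := mem_source_of_mem_finsupport hρ hi
  exact fderiv_transition_mem_tangentSubspace (chartAt_mem i) hi hS
    (fderiv_shear_localLift ((mem_constraintSubmanifold_iff (chartAt_mem i) hi).1 hS).2.2.2 _)

end Submanifold

/-! ### Decomposable 4-vectors and change of frame. -/

section ExteriorPower

theorem map_smul_ιMulti {V W : Type*} [AddCommGroup V] [Module ℝ V] [AddCommGroup W] [Module ℝ W]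
    (L : V →ₗ[ℝ] W) (c : ℝ) {n : ℕ} (v : Fin n → V) :
    exteriorPower.map n L (c • exteriorPower.ιMulti ℝ n v) =
      c • exteriorPower.ιMulti ℝ n fun i => L (v i) := by
  rw [map_smul]
  exact congrArg _ (exteriorPower.map_apply_ιMulti _ _)

theorem smul_ιMulti_mem_range_map {V : Type*} [AddCommGroup V] [Module ℝ V] {W : Submodule ℝ V}
    (c : ℝ) {n : ℕ} {v : Fin n → V} (h : ∀ i, v i ∈ W) :
    c • exteriorPower.ιMulti ℝ n v ∈ LinearMap.range (exteriorPower.map n W.subtype) :=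
  ⟨c • exteriorPower.ιMulti ℝ n fun i => ⟨v i, h i⟩, map_smul_ιMulti _ _ _⟩

theorem alternatingMap_apply_eq_detForm_smul {N : Type*} [AddCommGroup N] [Module ℝ N]
    (f : Base [⋀^Fin 4]→ₗ[ℝ] N) (v : Fin 4 → Base) :
    f v = detForm (fun i => WithLp.ofLp (v i)) • f bvec := by
  set b := (EuclideanSpace.basisFun (Fin 4) ℝ).toBasis with hb
  have hbv : ⇑b = bvec := by ext i : 1; simp [hb, bvec]
  have h : f = (LinearMap.toSpanSingleton ℝ N (f b)).compAlternatingMap b.det := by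
    refine Module.Basis.ext_alternating b fun i hi => ?_
    -- On injective families of basis vectors, that is on permutations of the basis, both sides are
    -- the sign times the value on the basis.
    let σ : Equiv.Perm (Fin 4) := Equiv.ofBijective i (Finite.injective_iff_bijective.1 hi)
    change f (b ∘ σ) = b.det (b ∘ σ) • f b
    simp [AlternatingMap.map_perm, Module.Basis.det_self]
  have hd : b.det v = detForm fun i => WithLp.ofLp (v i) := by
    rw [Module.Basis.det_apply, ← Matrix.det_transpose]
    rfl
  rw [← hd, ← hbv]
  conv_lhs => rw [h]
  rfl

theorem bvec_ne_zero_of_ne_zero {f : Base [⋀^Fin 4]→ₗ[ℝ] ℝ} (hf : f ≠ 0) : f bvec ≠ 0 := by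
  have hbv : ⇑(EuclideanSpace.basisFun (Fin 4) ℝ).toBasis = bvec := by ext i : 1; simp [bvec]
  rw [← hbv]
  exact (AlternatingMap.map_basis_ne_zero_iff _ f).2 hf

/-- A change of frame multiplies the wedge of the lifts by its determinant, which the normalising
factor cancels. -/
theorem inv_smul_ιMulti_comp {N : Type*} [AddCommGroup N] [Module ℝ N] {c : ℝ} (hc : c ≠ 0)
    {G : Base → N} (hG : IsLinearMap ℝ G) {A : Base → Base}
    (hA : detForm (fun i => WithLp.ofLp (A (bvec i))) = c) :
    (c⁻¹ • exteriorPower.ιMulti ℝ 4 fun ν => G (A (bvec ν))) =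
      exteriorPower.ιMulti ℝ 4 fun ν => G (bvec ν) := by
  have h : (exteriorPower.ιMulti ℝ 4 fun ν => G (A (bvec ν))) = _ :=
    alternatingMap_apply_eq_detForm_smul
      ((exteriorPower.ιMulti ℝ 4 (M := N)).compLinearMap hG.mk') fun i => A (bvec i)
  rw [h, hA, inv_smul_smul₀ hc]
  rfl

end ExteriorPower

/-! ### The 4-vector field and its properties. -/

section Field

variable {M : Type*} [TopologicalSpace M] [ChartedSpace Base M]

/-- The component of the form `η` in the preferred chart at `x`. -/
noncomputable def volumeCoeff (η : ∀ x : M, TangentSpace (𝓡 4) x [⋀^Fin 4]→ₗ[ℝ] ℝ) (x : M) : ℝ :=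
  η x fun i => (bvec i : Base)

variable [IsManifold (𝓡 4) ∞ M]

/-- The 4-vector field spanned by the lifts `globalLift`, normalised by the volume form `η`. -/
noncomputable def liftField (ρ : SmoothPartitionOfUnity M (𝓡 4) M)
    (η : ∀ x : M, TangentSpace (𝓡 4) x [⋀^Fin 4]→ₗ[ℝ] ℝ) : MultivectorField M := fun p =>
  (volumeCoeff η p.base)⁻¹ • exteriorPower.ιMulti ℝ 4
    (M := TangentSpace 𝓘(ℝ, JCoord) p) fun ν =>
      globalLift ρ (chartAt Base p.base) p.localCoord (bvec ν)

variable {ρ : SmoothPartitionOfUnity M (𝓡 4) M}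
  {η : ∀ x : M, TangentSpace (𝓡 4) x [⋀^Fin 4]→ₗ[ℝ] ℝ} {e : OpenPartialHomeomorph M Base}

/-- In an adapted chart `η` is the determinant of the chart differential, so `volumeCoeff` is the
determinant of the change from the preferred frame to the coordinate frame, and the coefficient
becomes 1. -/
theorem inCoord_liftField (hρ : ρ.IsSubordinate fun i => (chartAt Base i).source)
    (hη : IsVolumeForm η) (he : e ∈ IsManifold.maximalAtlas (𝓡 4) ∞ M) (hA : IsAdapted η e)
    {p : JetBundle M} (hp : p.base ∈ e.source) :
    inCoord e he p (liftField ρ η p) =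
      exteriorPower.ιMulti ℝ 4 fun ν => globalLift ρ e (jetChart e he p) (bvec ν) := by
  have h0 : volumeCoeff η p.base ≠ 0 :=
    bvec_ne_zero_of_ne_zero (f := η p.base) (hη.ne_zero p.base)
  set A : Base → Base := fun v => mfderiv (𝓡 4) (𝓡 4) e p.base v with hAdef
  have hdet : detForm (fun i => WithLp.ofLp (A (bvec i))) = volumeCoeff η p.base :=
    (hA _ hp fun i => (bvec i : Base)).symm
  have h2 : ∀ ν, jetChartDeriv e he p
      (globalLift ρ (chartAt Base p.base) p.localCoord (bvec ν)) =
        globalLift ρ e (jetChart e he p) (A (bvec ν)) := fun ν => by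
    rw [jetChartDeriv_apply he hp, fderiv_transition_globalLift hρ (chartAt_mem _) he
      (localCoord_mem_target p) (by rwa [symm_localCoord]), hAdef]
    exact congrArg _ (mfderiv_chart_apply he hp _).symm
  refine (map_smul_ιMulti (V := TangentSpace 𝓘(ℝ, JCoord) p) (jetChartDeriv e he p) _ _).trans ?_
  rw [← inv_smul_ιMulti_comp h0 (isLinearMap_globalLift (ρ := ρ) e (jetChart e he p)) hdet]
  exact congrArg _ (congrArg _ (funext h2))

theorem isSemiholonomic_liftField (hρ : ρ.IsSubordinate fun i => (chartAt Base i).source)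
    (hη : IsVolumeForm η) : IsSemiholonomic η (liftField ρ η) := by
  intro e he hA
  -- The normalisation by `η` makes the coefficient `f` equal to 1 in every adapted chart.
  refine ⟨fun _ => 1, fun ν u => (globalLift ρ e u (bvec ν)).2.2, contDiffOn_const, fun ν u hu => ?_,
    fun _ _ => one_ne_zero, fun p hp => ?_⟩
  · exact (contDiffAt_globalLift hρ he hu.1 (bvec ν)).snd.snd.contDiffWithinAt
  · have ht := ((jetChart e he).map_source hp).1
    rw [inCoord_liftField hρ hη he hA hp, one_smul]
    congr 1
    funext ν
    have h := globalLift_semiholonomic hρ he ht (bvec ν)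
    exact Prod.ext h.1 (Prod.ext h.2 rfl)

theorem solvesFieldEquation_liftField (hρ : ρ.IsSubordinate fun i => (chartAt Base i).source)
    (hη : IsVolumeForm η) {p : JetBundle M} (hS : p ∈ constraintSubmanifold M) :
    SolvesFieldEquation η (liftField ρ η) p := by
  intro e he hA hp
  have ht := (jetChart e he).map_source hp
  have h := fun ν => globalLift_semiholonomic hρ he ht.1 (bvec ν)
  rw [inCoord_liftField hρ hη he hA hp, ← one_smul ℝ (exteriorPower.ιMulti ℝ 4 _)]
  exact contraction_poincareCartan ht.2.det_ne_zero ((mem_constraintSubmanifold_iff he hp).1 hS)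
    (fun ν => (h ν).1) (fun ν => (h ν).2) 1

theorem isTangentTo_liftField (hρ : ρ.IsSubordinate fun i => (chartAt Base i).source) :
    IsTangentTo (liftField ρ η) (constraintSubmanifold M) := by
  exact fun p hS => smul_ιMulti_mem_range_map (V := TangentSpace 𝓘(ℝ, JCoord) p) _ fun ν =>
    globalLift_mem_tangentSubspace hρ hS (bvec ν)

end Field

end EinsteinPalatini

/-! ### The theorem. -/

open EinsteinPalatini in
theorem mainTheorem1 {M : Type*} [TopologicalSpace M] [T2Space M] [SecondCountableTopology M]
    [ConnectedSpace M] [ChartedSpace (EuclideanSpace ℝ (Fin 4)) M] [IsManifold (𝓡 4) ∞ M]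
    (η : ∀ x : M, TangentSpace (𝓡 4) x [⋀^Fin 4]→ₗ[ℝ] ℝ) (hη : IsVolumeForm η) :
    ∃ S : Set (JetBundle M),
      (∃ d : ℕ, IsEmbeddedSubmanifold d S) ∧
      (∀ (e : OpenPartialHomeomorph M (EuclideanSpace ℝ (Fin 4)))
        (he : e ∈ IsManifold.maximalAtlas (𝓡 4) ∞ M), IsAdapted η e →
          ∀ p : JetBundle M, p.base ∈ e.source →
            (p ∈ S ↔ jetChart e he p ∈ constraintSet)) ∧
      ∃ X : MultivectorField M, IsSemiholonomic η X ∧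
        (∀ p ∈ S, SolvesFieldEquation η X p) ∧ IsTangentTo X S := by
  -- Local compactness and second countability give the σ-compactness needed for a smooth partition
  -- of unity.
  have : LocallyCompactSpace M := Manifold.locallyCompact_of_finiteDimensional (𝓡 4)
  obtain ⟨ρ, hρ⟩ := SmoothPartitionOfUnity.exists_isSubordinate_chartAt_source (𝓡 4) M
  exact ⟨constraintSubmanifold M, ⟨_, isEmbeddedSubmanifold_constraintSubmanifold⟩,
    fun e he _ p hp => mem_constraintSubmanifold_iff he hp, liftField ρ η,
    isSemiholonomic_liftField hρ hη, fun p hp => solvesFieldEquation_liftField hρ hη hp,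
    isTangentTo_liftField hρ⟩
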